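/- **Theorem.** *Notation.* Write $e(x)=e^{2\pi i x}$, $q=e(\tau)$, and let $\tau$ range over the upper half-plane $\mathbb H$. Let $\theta(\xi,\tau)=\sum_{\nu\in\mathbb Z+1/2}(-1)^{\nu-1/2}q^{\nu^2/2}e(\nu\xi)$, $F(\xi,\alpha,\tau)=\dfrac{\theta'(0,\tau)\theta(\xi+\alpha,\tau)}{\theta(\xi,\tau)\theta(\alpha,\tau)}$, and define $\omega_n(\xi,\tau)$ for $n\ge 0$ by the expansion at $\alpha=0$ $$e\Big(\tfrac{\operatorname{Im}\xi}{\operatorname{Im}\tau}\alpha\Big)F(\xi,\alpha,\tau)=\sum_{n\ge0}\omega_n(\xi,\tau)(2\pi i\alpha)^{n-1}.$$ For $n,r\ge1$ the A- and B-elliptic multiple zeta values of depth one, $A_{n,r}(\tau)=A(n,0,\dots,0;\tau)$ and $B_{n,r}(\tau)=B(n,0,\dots,0;\tau)$ (with $r-1$ zeros), are defined by $$A(n_1,\dots,n_r;\tau)=\int\omega_{n_1}(t_1,\tau)\cdots\omega_{n_r}(t_r,\tau)\,dt_1\cdots dt_r,\qquad B(n_1,\dots,n_r;\tau)=\tau^{n_1+\cdots+n_r}\int\omega_{n_1}(\tau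 t_1,\tau)\cdots\omega_{n_r}(\tau t_r,\tau)\,dt_1\cdots dt_r$$ over $1\ge t_1\ge\cdots\ge t_r\ge0$, regularized as follows: the integral over $1-\varepsilon\ge t_1\ge\cdots\ge t_r\ge\varepsilon$ equals $\sum_{k=0}^r c_k\log(-2\pi i\varepsilon)^k+O(\varepsilon^\nu)$ for some $\nu>0$ as $\varepsilon\to0^+$ (principal branch of the logarithm), and the regularized value is $c_0$. Let $\mathbb G_k=(2\pi i)^{1-k}G_k$, where $G_0=-1$, $G_k=0$ for $k$ odd, and $G_k(\tau)=\sum_{(m,n)\ne(0,0)}(m\tau+n)^{-k}$ for $k\ge2$ even (for $k=2$ summing first over $n$, then over $m$). For a function $f$ on $\mathbb H$ that is the sum of a Laurent polynomial in $\tau$, a constant multiple of $\log\tau$, and a function which is $O(\tau^Nq)$ for some $N$ as $\operatorname{Im}\tau\to\infty$, write $f=f^\infty+f^0$, where $f^0$ is the last, exponentially small, part; the decomposition is unique. If $f^\infty$ is a polynomial, put $\int_\tau^{\vec 1_\infty}f(z)\,dz=\int_\tau^{i\infty}f^0(z)\,dz-\int_0^\tau f^\infty(z)\,dz$. Define $\Gamma^L_{n,1}(\tau)=\int_\tau^{\vec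 1_\infty}\mathbb G_n(z)\,dz$ and $\Gamma^L_{n,k}(\tau)=\int_\tau^{\vec 1_\infty}\mathbb G_0(z)\Gamma^L_{n,k-1}(z)\,dz$ for $k\ge2$. *Statement.* For all $n,r\ge1$ the regularized values defining $A_{n,r}(\tau)$ and $B_{n,r}(\tau)$ exist, and $A_{n,r}=A^\infty_{n,r}+A^0_{n,r}$, $B_{n,r}=B^\infty_{n,r}+B^0_{n,r}$ and $\Gamma^L_{n+r,r}=\Gamma^{L,\infty}_{n+r,r}+\Gamma^{L,0}_{n+r,r}$ have a decomposition as above, where $A^\infty_{n,r}$ is constant, $B^\infty_{n,r}$ is a Laurent polynomial in $\tau$ (plus a constant multiple of $\log\tau$ if $n=1$), and $\Gamma^{L,\infty}_{n+r,r}$ is a Laurent polynomial in $\tau$. For every $\tau\in\mathbb H$, the formal power series $$\mathcal B^0(X,Y;\tau)=\sum_{n,r\ge1}\frac{B^0_{n,r}(\tau)}{(2\pi i)^{r-1}}X^{n-1}Y^{r-1},\qquad \mathcal E^0(X,Y;\tau)=\sum_{n,k\ge1}\frac{(-1)^{n-1}}{(2\pi i)^{k-1}}\frac{(n+k-1)!}{(n-1)!}\Gamma^{L,0}_{n+k,k}(\tau)X^{n-1}Y^{k-1}$$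 satisfy $$\mathcal B^0(X,Y;\tau)=(e^Y-1)\,\mathcal E^0\Big(-\tau X,-X-\frac Y\tau;\tau\Big).$$ Moreover, for all $n,r\ge1$ and $\tau\in\mathbb H$, $$B_{n,r}(\tau)=B^\infty_{n,r}(\tau)+\frac{(2\pi i)^{r-1}}{(n-1)!}\sum_{j=1}^{r-1}\frac{(n+j-1)!}{(r-j)!}\sum_{i=0}^{j-1}\frac{(-1)^{j-i-1}(n+i-1)!}{i!(j-i-1)!}\sum_{k=1}^{n+i}\frac{(-1)^{k-1}\tau^{n-k}}{(2\pi i)^{k-1}(n+i-k)!}\Gamma^{L,0}_{n+j,k}(\tau)$$ and, with $\mathtt B_m$ the Bernoulli numbers ($\mathtt B_1=-\tfrac12$), $$B_{n,r}(\tau)=B^\infty_{n,r}(\tau)+\frac{(-1)^{n-1}(2\pi i)^{r-1}}{(n-1)!}\sum_{j=1}^{r-1}\frac1{(r-j)!}\sum_{i=0}^{j-1}\frac{(-1)^i(n+i-1)!}{i!(j-i-1)!}\sum_{k=1}^{n+i}\frac{(n+j-k-1)!\,\tau^{n-k}}{(n+i-k)!}\sum_{l=2}^{k+1}\frac{\mathtt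 B_{k+1-l}}{(k+1-l)!(2\pi i)^{l-1}}A^0_{n+j-k,l}(\tau).$$ -/

import Mathlib

open Complex Filter Topology Asymptotics
open scoped Real

namespace EMZV

/-! ### The Kronecker function and the functions `ω_n` -/

/-- The odd Jacobi theta function `θ(ξ,τ) = ∑_{ν ∈ ℤ + 1/2} (-1)^(ν - 1/2) q^(ν²/2) u^ν`, where
`q = e(τ)`, `u = e(ξ)`, `e(x) = exp(2πix)`, and `ν = n + 1/2`. -/
noncomputable def theta (ξ τ : ℂ) : ℂ :=
  ∑' n : ℤ, (-1 : ℂ) ^ n *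
    cexp (2 * π * I * (((n : ℂ) + 1 / 2) ^ 2 / 2 * τ + ((n : ℂ) + 1 / 2) * ξ))

/-- The Kronecker function `F(ξ,α,τ) = θ'(0,τ) θ(ξ+α,τ) / (θ(ξ,τ) θ(α,τ))`. -/
noncomputable def kronecker (ξ α τ : ℂ) : ℂ :=
  deriv (fun z => theta z τ) 0 * theta (ξ + α) τ / (theta ξ τ * theta α τ)

/-- `Ω(ξ,α,τ) = e(r_τ(ξ) α) F(ξ,α,τ)` with `r_τ(ξ) = Im ξ / Im τ`. -/
noncomputable def Omega (ξ α τ : ℂ) : ℂ :=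
  cexp (2 * π * I * ((ξ.im / τ.im : ℝ) : ℂ) * α) * kronecker ξ α τ

/-- The functions `ω_n(ξ,τ)` in the expansion `Ω(ξ,α,τ) = ∑_{n ≥ 0} ω_n(ξ,τ) (2πiα)^(n-1)` at
`α = 0`. The function `α ↦ α Ω(ξ,α,τ)` has a removable singularity with value `1` at `α = 0`, and
`ω_n(ξ,τ) (2πi)^(n-1)` is its `n`-th Taylor coefficient. -/
noncomputable def omega (n : ℕ) (ξ τ : ℂ) : ℂ :=
  2 * π * I / ((2 * π * I) ^ n * (n.factorial : ℂ)) *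
    iteratedDeriv n (Function.update (fun α : ℂ => α * Omega ξ α τ) 0 1) 0

/-! ### Regularized iterated integrals and elliptic multiple zeta values -/

/-- The iterated integral `∫_{b ≥ t₁ ≥ ⋯ ≥ t_r ≥ a} f₁(t₁) ⋯ f_r(t_r) dt₁ ⋯ dt_r`. -/
noncomputable def iterInt : List (ℝ → ℂ) → ℝ → ℝ → ℂ
  | [], _, _ => 1
  | f :: fs, a, b => ∫ t in a..b, f t * iterInt fs a t

/-- `a` is the regularized value of `J(ε)` as `ε → 0⁺`: there are constants `c₀ = a, c₁, …, c_r`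
with `J(ε) = ∑_{k ≤ r} c_k log(-2πiε)^k + O(ε^ν)` for some `ν > 0`. (With the principal branch,
`log(-2πiε) = log(2πε) - πi/2`.) -/
def IsRegValue (r : ℕ) (J : ℝ → ℂ) (a : ℂ) : Prop :=
  ∃ c : ℕ → ℂ, c 0 = a ∧ ∃ ν : ℝ, 0 < ν ∧
    (fun ε : ℝ => J ε - ∑ k ∈ Finset.range (r + 1), c k * Complex.log (-2 * π * I * ε) ^ k)
      =O[𝓝[>] 0] fun ε : ℝ => ε ^ ν

open Classical in
/-- The regularized value (which is unique when it exists). -/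
noncomputable def regValue (r : ℕ) (J : ℝ → ℂ) : ℂ :=
  if h : ∃ a, IsRegValue r J a then h.choose else 0

/-- The truncated integral over `[ε, 1-ε]` defining `A(n₁,…,n_r;τ)`. -/
noncomputable def truncA (ns : List ℕ) (τ : ℂ) (ε : ℝ) : ℂ :=
  iterInt (ns.map fun n (t : ℝ) => omega n t τ) ε (1 - ε)

/-- The truncated integral over `[ε, 1-ε]` defining `B(n₁,…,n_r;τ)`. -/
noncomputable def truncB (ns : List ℕ) (τ : ℂ) (ε : ℝ) : ℂ :=
  τ ^ ns.sum * iterInt (ns.map fun n (t : ℝ) => omega n (τ * t) τ) ε (1 - ε)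

/-- The (regularized) A-elliptic multiple zeta value `A(n₁,…,n_r;τ)`. -/
noncomputable def ellA (ns : List ℕ) (τ : ℂ) : ℂ := regValue ns.length (truncA ns τ)

/-- The (regularized) B-elliptic multiple zeta value `B(n₁,…,n_r;τ)`. -/
noncomputable def ellB (ns : List ℕ) (τ : ℂ) : ℂ := regValue ns.length (truncB ns τ)

/-- The tuple `(n, 0, …, 0)` of length `r` (for `r ≥ 1`). -/
def depthOne (n r : ℕ) : List ℕ := n :: List.replicate (r - 1) 0

/-- `A_{n,r}(τ) = A(n,0,…,0;τ)`, of length `r`. -/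
noncomputable def A (n r : ℕ) (τ : ℂ) : ℂ := ellA (depthOne n r) τ

/-- `B_{n,r}(τ) = B(n,0,…,0;τ)`, of length `r`. -/
noncomputable def B (n r : ℕ) (τ : ℂ) : ℂ := ellB (depthOne n r) τ

/-! ### Splitting off the exponentially small part as `τ → i∞`

Functions on the upper half-plane are represented by functions `ℂ → ℂ`; only their values at `τ`
with `Im τ > 0` matter. -/

/-- The function `τ ↦ ∑_i p_i τ^i + c log τ`: a Laurent polynomial plus a logarithmic term. -/
noncomputable def laurentLog (p : ℤ →₀ ℂ) (c : ℂ) (τ : ℂ) : ℂ :=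
  (p.sum fun i a => a * τ ^ i) + c * Complex.log τ

/-- `R(τ) = O(τ^N q)` as `Im τ → ∞`, for some `N`. -/
def IsExpSmall (R : ℂ → ℂ) : Prop :=
  ∃ N : ℕ, R =O[comap Complex.im atTop] fun τ : ℂ => τ ^ N * cexp (2 * π * I * τ)

/-- `f` is the sum of the Laurent polynomial `p`, of `c log τ`, and of an exponentially small
function. The pair `(p, c)` is unique. -/
def IsSplitting (f : ℂ → ℂ) (p : ℤ →₀ ℂ) (c : ℂ) : Prop :=
  IsExpSmall fun τ => f τ - laurentLog p c τ

open Classical in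
/-- `f^∞`: the Laurent polynomial part of `f` (including a logarithmic term, if there is one). -/
noncomputable def infPart (f : ℂ → ℂ) : ℂ → ℂ :=
  if h : ∃ x : (ℤ →₀ ℂ) × ℂ, IsSplitting f x.1 x.2 then laurentLog h.choose.1 h.choose.2 else 0

/-- `f⁰ = f - f^∞`: the exponentially small part of `f`. -/
noncomputable def expPart (f : ℂ → ℂ) (τ : ℂ) : ℂ := f τ - infPart f τ

/-! ### Iterated integrals of Eisenstein series -/

/-- `G_k(τ) = ∑_{(m,n) ≠ (0,0)} (mτ+n)^(-k)` for `k ≥ 2` even, where for `k = 2` the summation is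
first over `n`, then over `m`; by convention `G_0 = -1` and `G_k = 0` for odd `k`. -/
noncomputable def G (k : ℕ) (τ : ℂ) : ℂ :=
  if k = 0 then -1
  else if Odd k then 0
  else ∑' m : ℤ, ∑' n : ℤ, if m = 0 ∧ n = 0 then 0 else 1 / ((m : ℂ) * τ + n) ^ k

/-- `𝔾_k(τ) = (2πi)^(1-k) G_k(τ)`. -/
noncomputable def GG (k : ℕ) (τ : ℂ) : ℂ := (2 * π * I) ^ (1 - (k : ℤ)) * G k τ

/-- The regularized integral from `τ` to the tangential base point `1` at `i∞`:
`∫_τ^{i∞} f⁰(z) dz - ∫_0^τ f^∞(z) dz`, with `z = τ + is` in the first integral and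
`z = tτ` in the second one. -/
noncomputable def regInt (f : ℂ → ℂ) (τ : ℂ) : ℂ :=
  (∫ s in Set.Ioi (0 : ℝ), expPart f (τ + I * s) * I) - ∫ t in (0 : ℝ)..1, infPart f (t * τ) * τ

/-- `Γ(n₁,…,n_r;τ) = ∫_{[τ,∞]} 𝔾_{n_r}(z_r) dz_r ⋯ 𝔾_{n_1}(z_1) dz_1` (regularized), the variable
`z_1` being the one closest to `τ`. -/
noncomputable def Gam : List ℕ → ℂ → ℂ
  | [] => fun _ => 1
  | n :: ns => regInt fun z => GG n z * Gam ns z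

/-- `Γ^L_{n,k}(τ) = Γ(0,…,0,n;τ)` with `k - 1` zeros. -/
noncomputable def GamL (n k : ℕ) : ℂ → ℂ := Gam (List.replicate (k - 1) 0 ++ [n])

/-! ### Generating series, as formal power series in `X = X 0` and `Y = X 1` -/

/-- `𝓔⁰(X,Y;τ) = ∑_{n,k ≥ 1} (-1)^(n-1) (2πi)^(1-k) (n+k-1)!/(n-1)! Γ^{L,0}_{n+k,k}(τ)
X^(n-1) Y^(k-1)`. -/
noncomputable def serE (τ : ℂ) : MvPowerSeries (Fin 2) ℂ := fun d =>
  let n := d 0 + 1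
  let k := d 1 + 1
  (-1) ^ (n - 1) / (2 * π * I) ^ (k - 1) * ((n + k - 1).factorial / (n - 1).factorial : ℂ) *
    expPart (GamL (n + k) k) τ

/-- `𝓑⁰(X,Y;τ) = ∑_{n,r ≥ 1} (2πi)^(1-r) B⁰_{n,r}(τ) X^(n-1) Y^(r-1)`. -/
noncomputable def serB (τ : ℂ) : MvPowerSeries (Fin 2) ℂ := fun d =>
  let n := d 0 + 1
  let r := d 1 + 1
  expPart (B n r) τ / (2 * π * I) ^ (r - 1)

/-- The formal power series `e^Y`. -/
noncomputable def expY : MvPowerSeries (Fin 2) ℂ :=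
  PowerSeries.subst (MvPowerSeries.X 1 : MvPowerSeries (Fin 2) ℂ) (PowerSeries.exp ℂ)

/-- The substitution `(X, Y) ↦ (-τX, -X - Y/τ)`. -/
noncomputable def substB (τ : ℂ) : Fin 2 → MvPowerSeries (Fin 2) ℂ :=
  ![-(τ • MvPowerSeries.X 0), -MvPowerSeries.X 0 - τ⁻¹ • MvPowerSeries.X 1]

/-- The substitution is a legitimate substitution of formal power series. -/
theorem hasSubst_substB (τ : ℂ) : MvPowerSeries.HasSubst (substB τ) := by
  apply MvPowerSeries.hasSubst_of_constantCoeff_zero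
  intro s
  fin_cases s <;> simp [substB]

end EMZV

/-! Write `z = e(ξ)`, `w = e(α)`. Everything rests on Kronecker's expansion, valid for `0 ≤ Im ξ <
Im τ`, `z ≠ 1` and small `α ≠ 0`: F = -2πi (1/(1-w) + z/(1-z) + ∑_{m,k≥1} (z^m w^k - z^(-m) w^(-k))
q^(mk)). Multiplying the double series by `θ(α)` and shearing the summation indices pulls out
`θ(ξ+α)` times a factor that does not involve `α`; differentiating at `α = 0` identifies this
factor. The Taylor coefficients in `α` (`omega_succ`) then present `ω_{n+1}` as a Bernoulli
polynomial in `Im ξ / Im τ` minus an explicit series.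

Since `ω_0 = 2πi`, the zeros in `(n+1,0,…,0)` only contribute a weight `(t-ε)^m / m!`, so
`A_{n+1,m+1}` and `B_{n+1,m+1}` are regularized moments of `ω_{n+1}` on `[0,1]` and `[0,τ]`. All
exponentially small parts are combinations of the series S_{a,b} = ∑ k^a m^(-b) q^(mk) (`sSer`).

For `A`, termwise integration of `t^m e(±Mt)` gives `aSum`; the rest does not depend on `τ`. For
`B`, `ω_{n+1}(τt)` involves `f(t) - (-1)^n f(1-t)` with f(t) = ∑_{M≥1,k≥0} (k+t)^n q^(M(k+t)).
Folding along `t ↦ 1-t` replaces the weight `t^m` by `Q = t^m - (-1)^n (1-t)^m`. Integrating by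
parts, the upper boundary term of index `k` and the lower one of index `k+1` carry the same power of
`q`, so only Q(t+1) - Q(t) = ∑_{s<m} C(m,s) (1 + (-1)^(n+s)) t^s enters the exponentially small
part; the lower boundary at `k = 0` yields the Laurent polynomial and the logarithm
(`hasReg_bFun_mul`). For `Γ^L_{N,k}`, the Lipschitz formula gives the `q`-expansion of `𝔾_N`, and
each integration divides the coefficient indexed by `(m,k)` by `mk`, so a single `S_{a,b}` remains
(`expPart_GamL`).

Comparison gives `bExp_eq`, a double sum of `Γ^{L,0}`. In it the factors `1/(m-s)!` are the
coefficients of `e^Y - 1` and the binomials come from expanding `-X - Y/τ`, which is the identity of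
generating series (`serB_eq`). The stated triple sum collapses to the same double sum by finite
differences of binomial coefficients (`sum_binomial_inversion`). Finally `A⁰` is a convolution of
`Γ^{L,0}` with the coefficients of `e^x - 1`, and Bernoulli numbers invert it
(`sum_bernoulli_aExp`). -/

namespace EMZV

/-! ### The exponential `e(x)` -/

/-- `e(x) = exp(2πix)`. -/
noncomputable def ee (x : ℂ) : ℂ := cexp (2 * π * I * x)

theorem ee_add (x y : ℂ) : ee (x + y) = ee x * ee y := by
  simp only [ee, ← Complex.exp_add]; ring_nf

theorem ee_zero : ee 0 = 1 := by simp [ee]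

theorem ee_ne_zero (x : ℂ) : ee x ≠ 0 := Complex.exp_ne_zero _

theorem ee_neg (x : ℂ) : ee (-x) = (ee x)⁻¹ := by
  simp only [ee, ← Complex.exp_neg]; ring_nf

theorem ee_nat_mul (n : ℕ) (x : ℂ) : ee (n * x) = ee x ^ n := by
  simp only [ee, ← Complex.exp_nat_mul]; ring_nf

theorem ee_int (n : ℤ) : ee n = 1 := by
  rw [ee, mul_comm]; exact Complex.exp_int_mul_two_pi_mul_I n

theorem ee_half_int (n : ℤ) : ee (n / 2) = (-1) ^ n := by
  rw [ee, ← Complex.exp_pi_mul_I, ← Complex.exp_int_mul]; ring_nf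

theorem norm_ee (x : ℂ) : ‖ee x‖ = Real.exp (-(2 * π * x.im)) := by
  rw [ee, Complex.norm_exp]; congr 1; simp

theorem differentiable_ee : Differentiable ℂ ee := by unfold ee; fun_prop

theorem continuous_ee : Continuous ee := differentiable_ee.continuous

theorem norm_ee_lt_one {x : ℂ} (hx : 0 < x.im) : ‖ee x‖ < 1 := by
  rw [norm_ee, Real.exp_lt_one_iff]
  have := Real.pi_pos
  have : 0 < 2 * π * x.im := by positivity
  linarith

theorem norm_ee_le_one {x : ℂ} (hx : 0 ≤ x.im) : ‖ee x‖ ≤ 1 := by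
  rw [norm_ee, Real.exp_le_one_iff]
  have := Real.pi_pos
  have : 0 ≤ 2 * π * x.im := by positivity
  linarith

theorem ee_ne_one {x : ℂ} (hx : 0 < x.im) : ee x ≠ 1 := by
  intro h
  have := norm_ee_lt_one hx
  rw [h] at this
  simp at this

/-! ### The theta function -/

/-- The general term of the theta series. -/
noncomputable def thetaTerm (τ ξ : ℂ) (n : ℤ) : ℂ :=
  (-1) ^ n * ee ((n + 1 / 2) ^ 2 / 2 * τ + (n + 1 / 2) * ξ)

/-- The shift of the argument by `τ/2 + 1/2` absorbs the sign and the half-integral exponents, so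
convergence and holomorphy are inherited from `jacobiTheta₂`. -/
theorem thetaTerm_eq (τ ξ : ℂ) (n : ℤ) :
    thetaTerm τ ξ n = ee (τ / 8 + ξ / 2) * jacobiTheta₂_term n (ξ + τ / 2 + 1 / 2) τ := by
  rw [thetaTerm, ← ee_half_int, ← ee_add, jacobiTheta₂_term, ee, ee, ← Complex.exp_add]
  congr 1; ring

theorem theta_eq_tsum (ξ τ : ℂ) : theta ξ τ = ∑' n, thetaTerm τ ξ n := rfl

theorem theta_eq (ξ τ : ℂ) :
    theta ξ τ = ee (τ / 8 + ξ / 2) * jacobiTheta₂ (ξ + τ / 2 + 1 / 2) τ := by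
  rw [theta_eq_tsum, jacobiTheta₂, ← tsum_mul_left]
  exact tsum_congr (thetaTerm_eq τ ξ)

variable {τ : ℂ}

theorem summable_thetaTerm (hτ : 0 < τ.im) (ξ : ℂ) : Summable (thetaTerm τ ξ) := by
  rw [funext (thetaTerm_eq τ ξ)]
  exact ((summable_jacobiTheta₂_term_iff _ τ).mpr hτ).mul_left _

theorem differentiable_theta (hτ : 0 < τ.im) : Differentiable ℂ fun ξ => theta ξ τ := by
  have : (fun ξ => theta ξ τ) =
      fun ξ => ee (τ / 8 + ξ / 2) * jacobiTheta₂ (ξ + τ / 2 + 1 / 2) τ :=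
    funext fun ξ => theta_eq ξ τ
  rw [this]
  intro ξ
  refine DifferentiableAt.mul ?_ ?_
  · unfold ee; fun_prop
  · exact DifferentiableAt.comp ξ (differentiableAt_jacobiTheta₂_fst _ hτ) (by fun_prop)

theorem theta_neg (ξ τ : ℂ) : theta (-ξ) τ = -theta ξ τ := by
  -- The symmetry `ν ↦ -ν` of `ℤ + 1/2` reads `n ↦ -1 - n`; it reverses the sign `(-1)^n`.
  rw [theta_eq_tsum, theta_eq_tsum, ← tsum_neg,
    ← (Equiv.subLeft (-1 : ℤ)).tsum_eq]
  refine tsum_congr fun n => ?_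
  simp only [Equiv.subLeft_apply, thetaTerm]
  rw [← neg_mul]
  congr 1
  · rw [zpow_sub₀ (by norm_num)]
    rcases Int.even_or_odd n with h | h <;> simp [h.neg_one_zpow]
  · congr 1; push_cast; ring

theorem theta_zero (τ : ℂ) : theta 0 τ = 0 := by
  have := theta_neg 0 τ
  rw [neg_zero] at this
  exact self_eq_neg.mp this

/-- Termwise integration over `[0,1]` of a series of continuous functions with summable bounds. -/
theorem hasSum_integral_unit {ι : Type*} [Countable ι] {F : ι → ℝ → ℂ} {u : ι → ℝ}
    (hF : ∀ i, ContinuousOn (F i) (Set.Icc 0 1)) (hu : Summable u)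
    (hb : ∀ i, ∀ t ∈ Set.Icc (0 : ℝ) 1, ‖F i t‖ ≤ u i) :
    HasSum (fun i => ∫ t in (0 : ℝ)..1, F i t) (∫ t in (0 : ℝ)..1, ∑' i, F i t) := by
  have hsub : Set.uIoc (0 : ℝ) 1 ⊆ Set.Icc 0 1 := by
    rw [Set.uIoc_of_le zero_le_one]; exact Set.Ioc_subset_Icc_self
  refine intervalIntegral.hasSum_integral_of_dominated_convergence (fun i _ => u i) ?_ ?_ ?_ ?_ ?_
  · intro i
    exact ((hF i).mono hsub).aestronglyMeasurable measurableSet_uIoc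
  · intro i
    exact Filter.Eventually.of_forall fun t ht => hb i t (hsub ht)
  · exact Filter.Eventually.of_forall fun t _ => hu
  · exact intervalIntegrable_const
  · exact Filter.Eventually.of_forall fun t ht =>
      (Summable.of_norm_bounded hu fun i => hb i t (hsub ht)).hasSum

/-- The theta function is not identically zero on the real line. -/
theorem exists_theta_ofReal_ne_zero (hτ : 0 < τ.im) : ∃ t : ℝ, theta t τ ≠ 0 := by
  by_contra! h
  -- Orthogonality of characters: after multiplication by `e(-t/2)` the theta series is a Fourier
  -- series whose zeroth coefficient `e(τ/8)` is non-zero.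
  have key : ∀ n : ℤ, (∫ t in (0 : ℝ)..1, ee (n * t)) = if n = 0 then 1 else 0 := by
    intro n
    split_ifs with hn
    · simp [hn, ee_zero]
    · have hc : (2 * π * I * n : ℂ) ≠ 0 := by
        simp [hn, Real.pi_ne_zero]
      have := integral_exp_mul_complex (a := 0) (b := 1) hc
      simp only [ee]
      simp only [← mul_assoc]
      rw [this]
      have h1 := ee_int n
      rw [ee] at h1
      simp [h1]
  have hs : HasSum (fun n : ℤ => ∫ t in (0 : ℝ)..1, thetaTerm τ t n * ee (-(t / 2)))
      (∫ t in (0 : ℝ)..1, ∑' n, thetaTerm τ t n * ee (-(t / 2))) := by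
    refine hasSum_integral_unit (u := fun n => ‖thetaTerm τ 0 n‖) (fun n => ?_)
      (summable_thetaTerm hτ 0).norm fun n t _ => le_of_eq ?_
    · unfold thetaTerm ee; fun_prop
    · simp only [thetaTerm, norm_mul, norm_ee]
      simp
  have h0 : ∀ t : ℝ, ∑' n, thetaTerm τ t n * ee (-(t / 2)) = 0 := by
    intro t
    rw [tsum_mul_right, ← theta_eq_tsum, h t, zero_mul]
  simp only [h0, intervalIntegral.integral_zero] at hs
  have h1 : ∀ n : ℤ, (∫ t in (0 : ℝ)..1, thetaTerm τ t n * ee (-(t / 2))) =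
      if n = 0 then ee (τ / 8) else 0 := by
    intro n
    have : ∀ t : ℝ, thetaTerm τ t n * ee (-(t / 2)) =
        (-1) ^ n * ee ((n + 1 / 2) ^ 2 / 2 * τ) * ee (n * t) := by
      intro t
      rw [thetaTerm, mul_assoc, mul_assoc, ← ee_add, ← ee_add]
      congr 2; ring
    simp only [this]
    rw [intervalIntegral.integral_const_mul, key]
    split_ifs with hn
    · subst hn; simp; congr 1; ring
    · simp
  simp only [h1] at hs
  have := hs.unique (hasSum_ite_eq (0 : ℤ) (ee (τ / 8)))
  exact ee_ne_zero _ this.symm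

end EMZV

/-! ### Kronecker's expansion, the functions `ω_n`, and their regularized moments -/

namespace EMZV

variable {τ ξ α : ℂ}

/-! ### The Kronecker double series -/

/-- The sign in the Kronecker double series. -/
noncomputable def ksign (m k : ℤ) : ℂ :=
  if 0 ≤ m ∧ 0 ≤ k then 1 else if m < 0 ∧ k < 0 then -1 else 0

/-- The general term of the Kronecker double series. -/
noncomputable def kTerm (τ ξ α : ℂ) (p : ℤ × ℤ) : ℂ :=
  ksign p.1 p.2 * ee (p.1 * p.2 * τ + p.1 * ξ + p.2 * α)

theorem summable_pow_natAbs {r : ℝ} (h0 : 0 ≤ r) (h1 : r < 1) :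
    Summable fun n : ℤ => r ^ n.natAbs := by
  apply Summable.of_nat_of_neg <;> simpa using summable_geometric_of_lt_one h0 h1

theorem summable_kTerm (hξ : 0 < ξ.im) (hα : 0 < α.im) (h : ξ.im + α.im < τ.im) :
    Summable (kTerm τ ξ α) := by
  -- The constant `c` is the smallest margin in the three inequalities. The `-1` in `hE` is forced
  -- by the corner `m = k = -1`, where the exponent is only `Im (τ - ξ - α)`.
  set c := min (min ξ.im α.im) (τ.im - ξ.im - α.im) with hc
  have hc0 : 0 < c := by simp only [hc, lt_min_iff]; exact ⟨⟨hξ, hα⟩, by linarith⟩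
  have hcx : c ≤ ξ.im := (min_le_left _ _).trans (min_le_left _ _)
  have hcy : c ≤ α.im := (min_le_left _ _).trans (min_le_right _ _)
  have hct : c ≤ τ.im - ξ.im - α.im := min_le_right _ _
  have hpi := Real.pi_pos
  set r := Real.exp (-(2 * π * c)) with hr
  have hr1 : r < 1 := by rw [hr, Real.exp_lt_one_iff]; have : 0 < 2 * π * c := by positivity
                         linarith
  have hs := (summable_pow_natAbs (Real.exp_pos _).le hr1).mul_of_nonneg
    (summable_pow_natAbs (Real.exp_pos _).le hr1) (fun n => by positivity) (fun n => by positivity)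
  refine Summable.of_norm_bounded (hs.mul_left (Real.exp (2 * π * c))) ?_
  rintro ⟨m, k⟩
  have hE : ∀ s : ℝ, c * ((m.natAbs : ℝ) + k.natAbs - 1) ≤ s →
      Real.exp (-(2 * π * s)) ≤ Real.exp (2 * π * c) * (r ^ m.natAbs * r ^ k.natAbs) := by
    intro s hs
    rw [hr, ← Real.exp_nat_mul, ← Real.exp_nat_mul, ← Real.exp_add, ← Real.exp_add]
    apply Real.exp_le_exp.mpr
    have := mul_le_mul_of_nonneg_left hs (by positivity : 0 ≤ 2 * π)
    linarith
  simp only [kTerm, norm_mul, norm_ee]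
  have him : ((m : ℂ) * k * τ + m * ξ + k * α).im = m * k * τ.im + m * ξ.im + k * α.im := by
    simp [← Complex.ofReal_intCast]
  rw [him]
  unfold ksign
  split_ifs with h1 h2
  · obtain ⟨a, rfl⟩ := Int.eq_ofNat_of_zero_le h1.1
    obtain ⟨b, rfl⟩ := Int.eq_ofNat_of_zero_le h1.2
    rw [norm_one, one_mul]
    apply hE
    simp only [Int.natAbs_natCast, Int.cast_natCast]
    have ha : (0 : ℝ) ≤ a := a.cast_nonneg
    have hb : (0 : ℝ) ≤ b := b.cast_nonneg
    have h3 := mul_le_mul_of_nonneg_left hcx ha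
    have h4 := mul_le_mul_of_nonneg_left hcy hb
    have h5 : 0 ≤ (a : ℝ) * b * τ.im := by
      have : 0 ≤ τ.im := by linarith
      positivity
    linarith
  · obtain ⟨a, rfl⟩ := Int.eq_negSucc_of_lt_zero h2.1
    obtain ⟨b, rfl⟩ := Int.eq_negSucc_of_lt_zero h2.2
    rw [norm_neg, norm_one, one_mul]
    apply hE
    simp only [Int.natAbs_negSucc, Int.cast_negSucc]
    push_cast
    have ha : (0 : ℝ) ≤ a := a.cast_nonneg
    have hb : (0 : ℝ) ≤ b := b.cast_nonneg
    have h3 := mul_nonneg ha hb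
    have h4 := mul_le_mul_of_nonneg_left hct (by positivity : (0 : ℝ) ≤ (a + 1) * (b + 1))
    have h5 : 0 ≤ ((a : ℝ) + 1) * b * ξ.im := by positivity
    have h6 : 0 ≤ ((b : ℝ) + 1) * a * α.im := by positivity
    have h7 : 0 ≤ (a : ℝ) * b * c := by positivity
    nlinarith
  · rw [norm_zero, zero_mul]; positivity

/-- The Kronecker double series. -/
noncomputable def kSeries (τ ξ α : ℂ) : ℂ := ∑' p, kTerm τ ξ α p

/-- The terms of the double series by which `θ(ξ+α)` has to be multiplied to give
`θ(α)` times the Kronecker double series. -/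
noncomputable def dTerm (τ ξ : ℂ) (N : ℤ) (p : ℤ × ℤ) : ℂ :=
  ksign (p.1 + N) p.2 * ((-1) ^ p.2 *
    ee (p.2 * (p.2 - 1) / 2 * τ + p.1 * p.2 * τ + p.1 * ξ - ξ / 2))

/-- The reindexing `(N, (m, k)) ↦ (N - k, (m + N, k))`. -/
def shearEquiv : ℤ × (ℤ × ℤ) ≃ ℤ × (ℤ × ℤ) where
  toFun x := (x.1 - x.2.2, (x.2.1 + x.1, x.2.2))
  invFun x := (x.1 + x.2.2, (x.2.1 - x.1 - x.2.2, x.2.2))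
  left_inv x := by
    ext <;> simp
    ring
  right_inv x := by ext <;> simp

/-- The shear is chosen so that the powers of `e(α)`, namely `N - k + 1/2` and `k`, add up to `N +
1/2`: all dependence on `α` is then in the theta term of index `N`. -/
theorem thetaTerm_mul_kTerm (τ ξ α : ℂ) (x : ℤ × (ℤ × ℤ)) :
    thetaTerm τ α (shearEquiv x).1 * kTerm τ ξ α (shearEquiv x).2 =
      thetaTerm τ (ξ + α) x.1 * dTerm τ ξ x.1 x.2 := by
  obtain ⟨N, m, k⟩ := x
  simp only [shearEquiv, Equiv.coe_fn_mk, thetaTerm, kTerm, dTerm]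
  have h1 : ((-1 : ℂ)) ^ (N - k) = (-1) ^ N * (-1) ^ k := by
    rw [sub_eq_add_neg, zpow_add₀ (by norm_num)]
    rcases Int.even_or_odd k with h | h <;> simp [h.neg_one_zpow]
  rw [h1]
  have h2 : ∀ a b s x y u v : ℂ, x * y = u * v →
      a * b * x * (s * y) = a * u * (s * (b * v)) := by
    intro a b s x y u v h
    calc a * b * x * (s * y) = a * b * s * (x * y) := by ring
      _ = _ := by rw [h]; ring
  apply h2
  rw [← ee_add, ← ee_add]
  congr 1
  push_cast
  ring

theorem summable_thetaTerm_mul_kTerm (hξ : 0 < ξ.im) (hα : 0 < α.im) (h : ξ.im + α.im < τ.im) :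
    Summable fun x : ℤ × (ℤ × ℤ) => thetaTerm τ (ξ + α) x.1 * dTerm τ ξ x.1 x.2 := by
  have h1 := summable_mul_of_summable_norm (summable_thetaTerm (by linarith) α).norm
    (summable_kTerm hξ hα h).norm
  rw [← shearEquiv.summable_iff] at h1
  exact h1.congr fun x => (thetaTerm_mul_kTerm τ ξ α x)

theorem thetaTerm_ne_zero (τ ξ : ℂ) (n : ℤ) : thetaTerm τ ξ n ≠ 0 :=
  mul_ne_zero (zpow_ne_zero _ (by norm_num)) (ee_ne_zero _)

/-- An auxiliary `α` in the middle of the admissible range makes the whole product summable; its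
fibre over `N` is a non-zero multiple of the series in question. -/
theorem summable_dTerm (hξ : 0 < ξ.im) (h : ξ.im < τ.im) (N : ℤ) :
    Summable (dTerm τ ξ N) := by
  have h1 := (summable_thetaTerm_mul_kTerm (τ := τ) (ξ := ξ) (α := ((τ.im - ξ.im) / 2 : ℝ) * I)
    hξ (by simp; linarith) (by simp; linarith)).prod_factor N
  exact (summable_mul_left_iff (thetaTerm_ne_zero _ _ N)).mp h1

/-- The two sign patterns differ only on the column `m = -(N+1)`, where the difference is `1` for
every `k`. On that column the terms are antisymmetric under `k ↦ 2N + 3 - k`, so their sum equals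
its own negative. -/
theorem tsum_dTerm_succ (hξ : 0 < ξ.im) (h : ξ.im < τ.im) (N : ℤ) :
    ∑' p, dTerm τ ξ (N + 1) p = ∑' p, dTerm τ ξ N p := by
  rw [← sub_eq_zero, ← (summable_dTerm hξ h (N + 1)).tsum_sub (summable_dTerm hξ h N)]
  set g : ℤ × ℤ → ℂ := fun p => if p.1 = -(N + 1) then
    (-1) ^ p.2 * ee (p.2 * (p.2 - 1) / 2 * τ + p.1 * p.2 * τ + p.1 * ξ - ξ / 2) else 0 with hg
  have h1 : ∀ p, dTerm τ ξ (N + 1) p - dTerm τ ξ N p = g p := by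
    rintro ⟨m, k⟩
    simp only [dTerm, hg, ← sub_mul]
    by_cases hm : m = -(N + 1)
    · rw [if_pos hm]
      have : ksign (m + (N + 1)) k - ksign (m + N) k = 1 := by
        subst hm
        unfold ksign
        rcases lt_or_ge k 0 with hk | hk
        · simp [hk, hk.not_ge]
        · simp [hk, hk.not_gt]
      rw [this, one_mul]
    · rw [if_neg hm]
      have : ksign (m + (N + 1)) k = ksign (m + N) k := by
        unfold ksign
        have e1 : 0 ≤ m + (N + 1) ↔ 0 ≤ m + N := by omega
        have e2 : m + (N + 1) < 0 ↔ m + N < 0 := by omega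
        simp only [e1, e2]
      rw [this, sub_self, zero_mul]
  rw [tsum_congr h1]
  have h2 : ∑' p, g p = -∑' p, g p := by
    rw [← tsum_neg, ← ((Equiv.refl ℤ).prodCongr (Equiv.subLeft (2 * N + 3))).tsum_eq]
    refine tsum_congr fun p => ?_
    obtain ⟨m, k⟩ := p
    simp only [hg, Equiv.prodCongr_apply, Prod.map, Equiv.refl_apply, Equiv.subLeft_apply]
    split_ifs with hm
    · rw [← neg_mul]
      congr 1
      · rw [show 2 * N + 3 - k = 2 * (N + 1) + 1 - k by ring, zpow_sub₀ (by norm_num),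
          zpow_add₀ (by norm_num), zpow_mul]
        rcases Int.even_or_odd k with h | h <;> simp [h.neg_one_zpow]
      · congr 1; subst hm; push_cast; ring
    · simp
  exact self_eq_neg.mp h2

theorem tsum_dTerm (hξ : 0 < ξ.im) (h : ξ.im < τ.im) (N : ℤ) :
    ∑' p, dTerm τ ξ N p = ∑' p, dTerm τ ξ 0 p := by
  induction N using Int.induction_on with
  | zero => rfl
  | succ i ih => rw [tsum_dTerm_succ hξ h, ih]
  | pred i ih => rw [← ih, ← tsum_dTerm_succ hξ h]; congr! 3; ring

/-- As the inner sums do not depend on `N`, they come out as a common factor, which involves `ξ` but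
not `α`. -/
theorem theta_mul_kSeries_aux (hξ : 0 < ξ.im) (hα : 0 < α.im) (h : ξ.im + α.im < τ.im) :
    theta α τ * kSeries τ ξ α = theta (ξ + α) τ * ∑' p, dTerm τ ξ 0 p := by
  have h1 := summable_thetaTerm (τ := τ) (by linarith) α
  have h2 := summable_kTerm hξ hα h
  have h3 := summable_thetaTerm_mul_kTerm hξ hα h
  rw [theta_eq_tsum, kSeries, tsum_mul_tsum_of_summable_norm h1.norm h2.norm,
    ← shearEquiv.tsum_eq, tsum_congr (thetaTerm_mul_kTerm τ ξ α), h3.tsum_prod, theta_eq_tsum,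
    ← tsum_mul_right]
  refine tsum_congr fun N => ?_
  simp only [tsum_mul_left, tsum_dTerm hξ (by linarith : ξ.im < τ.im)]

/-! ### The Lambert form of the Kronecker series -/

/-- The general term of the Lambert series. -/
noncomputable def lamTerm (τ ξ α : ℂ) (p : ℕ × ℕ) : ℂ :=
  ee ((p.1 + 1) * (p.2 + 1) * τ + (p.1 + 1) * ξ + (p.2 + 1) * α) -
    ee ((p.1 + 1) * (p.2 + 1) * τ - (p.1 + 1) * ξ - (p.2 + 1) * α)

/-- The Lambert series `∑_{m,k ≥ 1} (z^m w^k - z^(-m) w^(-k)) q^(mk)`. -/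
noncomputable def lam (τ ξ α : ℂ) : ℂ := ∑' p, lamTerm τ ξ α p

theorem summable_pow_succ_mul_succ {r : ℝ} (h0 : 0 ≤ r) (h1 : r < 1) :
    Summable fun p : ℕ × ℕ => r ^ ((p.1 + 1) * (p.2 + 1)) := by
  have hs := (summable_geometric_of_lt_one h0 h1).mul_of_nonneg
    (summable_geometric_of_lt_one h0 h1) (fun n => by positivity) (fun n => by positivity)
  refine Summable.of_nonneg_of_le (fun p => by positivity) (fun p => ?_) hs
  rw [← pow_add]
  refine pow_le_pow_of_le_one h0 h1.le ?_
  nlinarith [Nat.zero_le (p.1 * p.2)]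

/-- The common bound for the exponential terms of the Lambert series. -/
theorem norm_ee_lam_le {σ x y : ℝ} (h : |x| + |y| ≤ σ) (p : ℕ × ℕ) {u : ℂ}
    (hu : u.im = (p.1 + 1) * (p.2 + 1) * τ.im + (p.1 + 1) * x + (p.2 + 1) * y) :
    ‖ee u‖ ≤ Real.exp (-(2 * π * (τ.im - σ))) ^ ((p.1 + 1) * (p.2 + 1)) := by
  have hpi := Real.pi_pos
  rw [norm_ee, hu, ← Real.exp_nat_mul]
  apply Real.exp_le_exp.mpr
  push_cast
  have ha : (0 : ℝ) ≤ p.1 := Nat.cast_nonneg _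
  have hb : (0 : ℝ) ≤ p.2 := Nat.cast_nonneg _
  have h1 : -|x| * ((p.1 + 1) * (p.2 + 1)) ≤ (p.1 + 1) * x := by
    have := neg_abs_le x
    nlinarith [abs_nonneg x, mul_nonneg ha (abs_nonneg x), mul_nonneg hb (abs_nonneg x),
      mul_nonneg (mul_nonneg ha hb) (abs_nonneg x)]
  have h2 : -|y| * ((p.1 + 1) * (p.2 + 1)) ≤ (p.2 + 1) * y := by
    have := neg_abs_le y
    nlinarith [abs_nonneg y, mul_nonneg ha (abs_nonneg y), mul_nonneg hb (abs_nonneg y),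
      mul_nonneg (mul_nonneg ha hb) (abs_nonneg y)]
  have h3 := mul_le_mul_of_nonneg_left h (by positivity : (0 : ℝ) ≤ (p.1 + 1) * (p.2 + 1))
  have h4 : ((p.1 : ℝ) + 1) * (p.2 + 1) * (τ.im - σ) ≤
      (p.1 + 1) * (p.2 + 1) * τ.im + (p.1 + 1) * x + (p.2 + 1) * y := by linarith
  have := mul_le_mul_of_nonneg_left h4 (by positivity : (0 : ℝ) ≤ 2 * π)
  linarith

theorem norm_lamTerm_le {σ : ℝ} (h : |ξ.im| + |α.im| ≤ σ) (p : ℕ × ℕ) :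
    ‖lamTerm τ ξ α p‖ ≤ 2 * Real.exp (-(2 * π * (τ.im - σ))) ^ ((p.1 + 1) * (p.2 + 1)) := by
  have h1 := norm_ee_lam_le (τ := τ) h p
    (u := (p.1 + 1) * (p.2 + 1) * τ + (p.1 + 1) * ξ + (p.2 + 1) * α) (by simp)
  have h2 := norm_ee_lam_le (τ := τ) (x := -ξ.im) (y := -α.im) (by simpa using h) p
    (u := (p.1 + 1) * (p.2 + 1) * τ - (p.1 + 1) * ξ - (p.2 + 1) * α) (by simp; ring)
  refine (norm_sub_le _ _).trans ?_
  linarith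

theorem exp_gap_lt_one {σ : ℝ} (h : σ < τ.im) : Real.exp (-(2 * π * (τ.im - σ))) < 1 := by
  rw [Real.exp_lt_one_iff]
  have : 0 < 2 * π * (τ.im - σ) := mul_pos (by positivity) (by linarith)
  linarith

theorem continuousOn_lam {σ : ℝ} (hσ : σ < τ.im) :
    ContinuousOn (fun x : ℂ × ℂ => lam τ x.1 x.2) {x | |x.1.im| + |x.2.im| ≤ σ} := by
  refine continuousOn_tsum (fun p => ?_)
    ((summable_pow_succ_mul_succ (Real.exp_pos _).le (exp_gap_lt_one hσ)).mul_left 2)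
    fun p x hx => norm_lamTerm_le hx p
  unfold lamTerm ee
  fun_prop

theorem continuousAt_lam (h : |ξ.im| + |α.im| < τ.im) :
    ContinuousAt (fun x : ℂ × ℂ => lam τ x.1 x.2) (ξ, α) := by
  obtain ⟨σ, h1, h2⟩ := exists_between h
  refine (continuousOn_lam h2).continuousAt ?_
  have hc : Continuous fun x : ℂ × ℂ => |x.1.im| + |x.2.im| := by
    have := Complex.continuous_im
    fun_prop
  exact Filter.mem_of_superset (hc.isOpen_preimage _ isOpen_Iio |>.mem_nhds
    (show |ξ.im| + |α.im| ∈ Set.Iio σ from h1)) fun x hx => by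
      have h3 : |x.1.im| + |x.2.im| < σ := hx
      simpa using h3.le

theorem differentiableAt_lam (h : |ξ.im| + |α.im| < τ.im) :
    DifferentiableAt ℂ (lam τ ξ) α := by
  obtain ⟨σ, h1, h2⟩ := exists_between h
  have hc : Continuous fun x : ℂ => |ξ.im| + |x.im| := by
    have := Complex.continuous_im
    fun_prop
  have ho : IsOpen {x : ℂ | |ξ.im| + |x.im| < σ} := hc.isOpen_preimage _ isOpen_Iio
  have := differentiableOn_tsum_of_summable_norm (F := fun p (α : ℂ) => lamTerm τ ξ α p)
    ((summable_pow_succ_mul_succ (Real.exp_pos _).le (exp_gap_lt_one h2)).mul_left 2)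
    (fun p => by unfold lamTerm ee; fun_prop) ho
    (fun p x hx => norm_lamTerm_le (le_of_lt hx) p)
  exact (this α h1).differentiableAt (ho.mem_nhds h1)

theorem summable_ee_succ {σ x y : ℝ} (h : |x| + |y| ≤ σ) (hσ : σ < τ.im) {u : ℕ × ℕ → ℂ}
    (hu : ∀ p, (u p).im = (p.1 + 1) * (p.2 + 1) * τ.im + (p.1 + 1) * x + (p.2 + 1) * y) :
    Summable fun p => ee (u p) :=
  Summable.of_norm_bounded
    (summable_pow_succ_mul_succ (Real.exp_pos _).le (exp_gap_lt_one hσ))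
    fun p => norm_ee_lam_le h p (hu p)

/-- The two axes of the first quadrant are geometric series sharing the origin, hence the `-1`. The
open quadrants combine into the Lambert series, which converges for `|Im ξ| + |Im α| < Im τ`, in
particular around `α = 0` and for real `ξ`. -/
theorem kSeries_eq (hξ : 0 < ξ.im) (hα : 0 < α.im) (h : ξ.im + α.im < τ.im) :
    kSeries τ ξ α = 1 / (1 - ee ξ) + 1 / (1 - ee α) - 1 + lam τ ξ α := by
  have hk := summable_kTerm hξ hα h
  set P : Set (ℤ × ℤ) := {p | 0 ≤ p.1 ∧ 0 ≤ p.2} with hP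
  set Q : Set (ℤ × ℤ) := {p | p.1 < 0 ∧ p.2 < 0} with hQ
  have hsplit : ∀ p, kTerm τ ξ α p = P.indicator (kTerm τ ξ α) p + Q.indicator (kTerm τ ξ α) p := by
    rintro ⟨m, k⟩
    simp only [Set.indicator, hP, hQ, Set.mem_ofPred_eq]
    by_cases h1 : 0 ≤ m ∧ 0 ≤ k
    · have : ¬(m < 0 ∧ k < 0) := by omega
      simp [h1]
    · by_cases h2 : m < 0 ∧ k < 0
      · simp [h2]
      · simp [h1, h2, kTerm, ksign]
  have hi1 : Function.Injective fun p : ℕ × ℕ => ((p.1 : ℤ), (p.2 : ℤ)) := by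
    rintro ⟨a, b⟩ ⟨c, d⟩ h
    simpa using h
  have hi2 : Function.Injective fun p : ℕ × ℕ => (Int.negSucc p.1, Int.negSucc p.2) := by
    rintro ⟨a, b⟩ ⟨c, d⟩ h
    simpa using h
  have hs1 : Function.support (P.indicator (kTerm τ ξ α)) ⊆
      Set.range fun p : ℕ × ℕ => ((p.1 : ℤ), (p.2 : ℤ)) := by
    rintro ⟨m, k⟩ hp
    obtain ⟨h1, h2⟩ := Set.mem_of_indicator_ne_zero hp
    exact ⟨(m.toNat, k.toNat), by simp [Int.toNat_of_nonneg h1, Int.toNat_of_nonneg h2]⟩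
  have hs2 : Function.support (Q.indicator (kTerm τ ξ α)) ⊆
      Set.range fun p : ℕ × ℕ => (Int.negSucc p.1, Int.negSucc p.2) := by
    rintro ⟨m, k⟩ hp
    obtain ⟨h1, h2⟩ := Set.mem_of_indicator_ne_zero hp
    obtain ⟨a, rfl⟩ := Int.eq_negSucc_of_lt_zero h1
    obtain ⟨b, rfl⟩ := Int.eq_negSucc_of_lt_zero h2
    exact ⟨(a, b), rfl⟩
  have ht1 : ∀ p : ℕ × ℕ, P.indicator (kTerm τ ξ α) ((p.1 : ℤ), (p.2 : ℤ)) =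
      ee (p.1 * p.2 * τ + p.1 * ξ + p.2 * α) := by
    intro p
    rw [Set.indicator_of_mem (by simp [hP])]
    simp [kTerm, ksign]
  have ht2 : ∀ p : ℕ × ℕ, Q.indicator (kTerm τ ξ α) (Int.negSucc p.1, Int.negSucc p.2) =
      -ee ((p.1 + 1) * (p.2 + 1) * τ - (p.1 + 1) * ξ - (p.2 + 1) * α) := by
    intro p
    rw [Set.indicator_of_mem (by simp [hQ])]
    have h1 : ksign (Int.negSucc p.1) (Int.negSucc p.2) = -1 := by
      simp [ksign]
    simp only [kTerm, h1, neg_one_mul]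
    congr 2
    push_cast
    ring
  have hsum1 : Summable fun p : ℕ × ℕ => ee (p.1 * p.2 * τ + p.1 * ξ + p.2 * α) :=
    ((hk.indicator P).comp_injective hi1).congr ht1
  have hz := norm_ee_lt_one hξ
  have hw := norm_ee_lt_one hα
  have hab : |ξ.im| + |α.im| < τ.im := by rwa [abs_of_pos hξ, abs_of_pos hα]
  have hp : Summable fun p : ℕ × ℕ =>
      ee ((p.1 + 1) * (p.2 + 1) * τ + (p.1 + 1) * ξ + (p.2 + 1) * α) :=
    summable_ee_succ le_rfl hab fun p => by simp
  have hm : Summable fun p : ℕ × ℕ =>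
      ee ((p.1 + 1) * (p.2 + 1) * τ - (p.1 + 1) * ξ - (p.2 + 1) * α) :=
    summable_ee_succ (x := -ξ.im) (y := -α.im) (by simp) hab fun p => by simp; ring
  have hfirst : ∑' p : ℕ × ℕ, ee (p.1 * p.2 * τ + p.1 * ξ + p.2 * α) =
      1 / (1 - ee α) + (1 / (1 - ee ξ) - 1 + ∑' p : ℕ × ℕ,
        ee ((p.1 + 1) * (p.2 + 1) * τ + (p.1 + 1) * ξ + (p.2 + 1) * α)) := by
    rw [hsum1.tsum_prod, hsum1.prod.tsum_eq_zero_add]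
    congr 1
    · simp only [Nat.cast_zero, zero_mul, zero_add, ee_nat_mul]
      rw [tsum_geometric_of_norm_lt_one hw, one_div]
    · have hrow : ∀ m : ℕ, ∑' k : ℕ, ee (((m + 1 : ℕ) : ℂ) * k * τ + (m + 1 : ℕ) * ξ + k * α) =
          ee ξ ^ (m + 1) + ∑' k : ℕ, ee ((m + 1) * (k + 1) * τ + (m + 1) * ξ + (k + 1) * α) := by
        intro m
        rw [(hsum1.prod_factor (m + 1)).tsum_eq_zero_add]
        congr 1
        · rw [← ee_nat_mul]; congr 1; push_cast; ring
        · refine tsum_congr fun k => ?_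
          push_cast; rfl
      have hg : Summable fun m : ℕ => ee ξ ^ (m + 1) :=
        (summable_nat_add_iff 1).mpr (summable_geometric_of_norm_lt_one hz)
      rw [tsum_congr hrow, hg.tsum_add hp.prod, hp.tsum_prod]
      congr 1
      have := (summable_geometric_of_norm_lt_one hz).tsum_eq_zero_add
      rw [tsum_geometric_of_norm_lt_one hz, pow_zero] at this
      rw [one_div, this]; ring
  rw [kSeries, tsum_congr hsplit, (hk.indicator P).tsum_add (hk.indicator Q),
    ← hi1.tsum_eq hs1, ← hi2.tsum_eq hs2, tsum_congr ht1, tsum_congr ht2, hfirst, tsum_neg, lam]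
  simp only [lamTerm]
  rw [hp.tsum_sub hm]
  ring

/-! ### The Kronecker function as a Lambert series -/

/-- `(1 - w)` times the Lambert form of the Kronecker series. -/
noncomputable def kronW (τ ξ α : ℂ) : ℂ :=
  1 + (1 - ee α) * (ee ξ / (1 - ee ξ) + lam τ ξ α)

theorem kronW_eq (hξ : 0 < ξ.im) (hα : 0 < α.im) (h : ξ.im + α.im < τ.im) :
    kronW τ ξ α = (1 - ee α) * kSeries τ ξ α := by
  have h1 : 1 - ee ξ ≠ 0 := sub_ne_zero.mpr (ee_ne_one hξ).symm
  have h2 : 1 - ee α ≠ 0 := sub_ne_zero.mpr (ee_ne_one hα).symm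
  rw [kSeries_eq hξ hα h, kronW]
  field_simp
  ring

theorem differentiableAt_kronW (h : |ξ.im| + |α.im| < τ.im) :
    DifferentiableAt ℂ (kronW τ ξ) α := by
  have h1 := differentiableAt_lam h
  have h2 := differentiable_ee α
  unfold kronW
  fun_prop

theorem kronW_zero (τ ξ : ℂ) : kronW τ ξ 0 = 1 := by simp [kronW, ee_zero]

theorem hasDerivAt_ee_zero : HasDerivAt ee (2 * π * I) 0 := by
  have := ((hasDerivAt_id (0 : ℂ)).const_mul (2 * π * I)).cexp
  simpa [ee] using! this

/-- Identity theorem: the strip is convex, hence connected, and agreement is known on its open upper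
half. It carries the identities from `Im α > 0` across `α = 0`. -/
theorem eqOn_strip {f g : ℂ → ℂ} {s : ℝ} (hs : 0 < s)
    (hf : ∀ z : ℂ, |z.im| < s → DifferentiableAt ℂ f z)
    (hg : ∀ z : ℂ, |z.im| < s → DifferentiableAt ℂ g z)
    (h : ∀ z : ℂ, 0 < z.im → z.im < s → f z = g z) (z : ℂ) (hz : |z.im| < s) : f z = g z := by
  have hc : Continuous fun z : ℂ => |z.im| := Complex.continuous_im.abs
  have ho : IsOpen {z : ℂ | |z.im| < s} := hc.isOpen_preimage _ isOpen_Iio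
  have hconv : Convex ℝ {z : ℂ | |z.im| < s} := by
    have : {z : ℂ | |z.im| < s} = Complex.imLm ⁻¹' Set.Ioo (-s) s := by
      ext z; simp [abs_lt]
    rw [this]
    exact (convex_Ioo _ _).is_linear_preimage (Complex.imLm.isLinear)
  have hF : AnalyticOnNhd ℂ f {z : ℂ | |z.im| < s} :=
    DifferentiableOn.analyticOnNhd (fun z hz => (hf z hz).differentiableWithinAt) ho
  have hG : AnalyticOnNhd ℂ g {z : ℂ | |z.im| < s} :=
    DifferentiableOn.analyticOnNhd (fun z hz => (hg z hz).differentiableWithinAt) ho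
  have h0 : ((s / 2 : ℝ) : ℂ) * I ∈ {z : ℂ | |z.im| < s} := by
    simp [abs_of_pos (half_pos hs), hs]
  refine hF.eqOn_of_preconnected_of_eventuallyEq hG hconv.isPreconnected h0 ?_ hz
  have hU : IsOpen {z : ℂ | 0 < z.im ∧ z.im < s} :=
    (isOpen_lt continuous_const Complex.continuous_im).inter
      (isOpen_lt Complex.continuous_im continuous_const)
  refine Filter.mem_of_superset (hU.mem_nhds (x := ((s / 2 : ℝ) : ℂ) * I) ?_)
    fun z hz => h z hz.1 hz.2
  simp [hs]

theorem theta_mul_kronW_aux (hξ : 0 < ξ.im) (hα : |α.im| < τ.im - ξ.im) :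
    theta α τ * kronW τ ξ α = theta (ξ + α) τ * (∑' p, dTerm τ ξ 0 p) * (1 - ee α) := by
  have hs : 0 < τ.im - ξ.im := (abs_nonneg _).trans_lt hα
  have hτ : 0 < τ.im := by linarith
  have hth := differentiable_theta hτ
  refine eqOn_strip (f := fun α => theta α τ * kronW τ ξ α)
    (g := fun α => theta (ξ + α) τ * (∑' p, dTerm τ ξ 0 p) * (1 - ee α)) hs ?_ ?_ ?_ α hα
  · intro z hz
    exact (hth z).mul (differentiableAt_kronW (by rw [abs_of_pos hξ]; linarith))
  · intro z _
    have h1 : DifferentiableAt ℂ (fun α => theta (ξ + α) τ) z :=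
      (hth (ξ + z)).comp z (by fun_prop)
    have h2 := differentiable_ee z
    fun_prop
  · intro z hz1 hz2
    rw [kronW_eq hξ hz1 (by linarith), ← theta_mul_kSeries_aux hξ hz1 (by linarith)]
    ring

/-- Both sides of `theta_mul_kronW_aux` vanish at `α = 0`, through `θ(0) = 0` and `1 - e(0) = 0`.
Comparing first derivatives there determines the unknown factor. -/
theorem deriv_theta_eq_aux (hξ : 0 < ξ.im) (h : ξ.im < τ.im) :
    deriv (fun z => theta z τ) 0 = -(2 * π * I) * (theta ξ τ * ∑' p, dTerm τ ξ 0 p) := by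
  have hτ : 0 < τ.im := by linarith
  have hth := differentiable_theta hτ
  have hL := (hth 0).hasDerivAt.mul (differentiableAt_kronW (τ := τ) (ξ := ξ) (α := 0)
    (by rw [abs_of_pos hξ]; simpa)).hasDerivAt
  have h1 : DifferentiableAt ℂ (fun α => theta (ξ + α) τ) 0 :=
      (hth (ξ + 0)).comp 0 (by fun_prop)
  have hR := (h1.hasDerivAt.mul_const (∑' p, dTerm τ ξ 0 p)).mul (hasDerivAt_ee_zero.const_sub 1)
  have hEq : (fun α => theta α τ * kronW τ ξ α) =ᶠ[𝓝 0]
      fun α => theta (ξ + α) τ * (∑' p, dTerm τ ξ 0 p) * (1 - ee α) := by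
    have hc : Continuous fun z : ℂ => |z.im| := Complex.continuous_im.abs
    have ho : IsOpen {z : ℂ | |z.im| < τ.im - ξ.im} := hc.isOpen_preimage _ isOpen_Iio
    refine Filter.mem_of_superset (ho.mem_nhds (x := 0) (by simpa)) fun z hz =>
      theta_mul_kronW_aux hξ hz
  have := (hL.congr_of_eventuallyEq hEq.symm).unique hR
  simp only [theta_zero, kronW_zero, ee_zero, add_zero, sub_self, mul_zero, zero_mul, zero_add,
    mul_one] at this
  rw [this]
  ring

theorem theta_mul_kronW_aux' (hξ : 0 < ξ.im) (hα : |α.im| < τ.im - ξ.im) :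
    -(2 * π * I) * (theta ξ τ * theta α τ * kronW τ ξ α) =
      deriv (fun z => theta z τ) 0 * theta (ξ + α) τ * (1 - ee α) := by
  rw [deriv_theta_eq_aux (τ := τ) hξ (by linarith [(abs_nonneg α.im).trans_lt hα]), mul_assoc,
    mul_assoc, theta_mul_kronW_aux hξ hα]
  ring

/-- The boundary case `Im ξ = 0`, needed for the A-values, is the limit along `ξ + is`, `s → 0⁺`;
both sides are continuous in `ξ` as long as `e(ξ) ≠ 1`. -/
theorem theta_mul_kronW (hξ : 0 ≤ ξ.im) (hz : ee ξ ≠ 1) (hα : |α.im| < τ.im - ξ.im) :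
    -(2 * π * I) * (theta ξ τ * theta α τ * kronW τ ξ α) =
      deriv (fun z => theta z τ) 0 * theta (ξ + α) τ * (1 - ee α) := by
  have hτ : 0 < τ.im := by linarith [abs_nonneg α.im]
  have hth := (differentiable_theta hτ).continuous
  have hpath : Tendsto (fun s : ℝ => ξ + s * I) (𝓝[>] 0) (𝓝 ξ) := by
    have : Continuous fun s : ℝ => ξ + s * I := by fun_prop
    have := this.tendsto 0
    simp only [ofReal_zero, zero_mul, add_zero] at this
    exact this.mono_left nhdsWithin_le_nhds
  have hlam : ContinuousAt (fun ξ => lam τ ξ α) ξ :=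
    ContinuousAt.comp (f := fun ξ : ℂ => (ξ, α)) (x := ξ)
      (g := fun x : ℂ × ℂ => lam τ x.1 x.2)
      (continuousAt_lam (by rw [abs_of_nonneg hξ]; linarith)) (by fun_prop)
  have hW : ContinuousAt (fun ξ => kronW τ ξ α) ξ := by
    unfold kronW
    have h1 : 1 - ee ξ ≠ 0 := sub_ne_zero.mpr hz.symm
    have h2 := continuous_ee
    have h3 : ContinuousAt (fun ξ => ee ξ / (1 - ee ξ)) ξ :=
      h2.continuousAt.div (by fun_prop) h1
    fun_prop
  have hL : ContinuousAt (fun ξ => -(2 * π * I) * (theta ξ τ * theta α τ * kronW τ ξ α)) ξ := by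
    have := hth.continuousAt (x := ξ)
    fun_prop
  have hR : ContinuousAt
      (fun ξ => deriv (fun z => theta z τ) 0 * theta (ξ + α) τ * (1 - ee α)) ξ := by
    have : Continuous fun ξ => theta (ξ + α) τ := hth.comp (by fun_prop)
    fun_prop
  refine tendsto_nhds_unique_of_eventuallyEq (hL.tendsto.comp hpath) (hR.tendsto.comp hpath) ?_
  have hs : 0 < τ.im - ξ.im - |α.im| := by linarith
  filter_upwards [Ioo_mem_nhdsGT hs] with s hs
  have him : (ξ + s * I).im = ξ.im + s := by simp
  exact theta_mul_kronW_aux' (by rw [him]; linarith [hs.1]) (by rw [him]; linarith [hs.2])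

/-! ### Non-vanishing of `θ'(0)` and of `θ` -/

theorem theta_not_eventually_zero (hτ : 0 < τ.im) (x : ℂ) : ¬∀ᶠ z in 𝓝 x, theta z τ = 0 := by
  intro h
  obtain ⟨t, ht⟩ := exists_theta_ofReal_ne_zero hτ
  have h1 : AnalyticOnNhd ℂ (fun z => theta z τ) Set.univ :=
    (differentiable_theta hτ).differentiableOn.analyticOnNhd isOpen_univ
  have := h1.eqOn_of_preconnected_of_eventuallyEq (g := fun _ => 0)
    analyticOnNhd_const isPreconnected_univ (Set.mem_univ x) h (Set.mem_univ (t : ℂ))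
  exact ht this

theorem eventually_abs_im_lt {s : ℝ} (hs : 0 < s) : ∀ᶠ z : ℂ in 𝓝 0, |z.im| < s := by
  have hc : Continuous fun z : ℂ => |z.im| := Complex.continuous_im.abs
  exact (hc.isOpen_preimage _ isOpen_Iio).mem_nhds (by simpa using hs)

/-- If `θ'(0) = 0`, then `θ(ξ) θ(α)` vanishes for small `α`, because `kronW` is close to `1` there.
Since `θ` is not zero near `0`, it would have to vanish at every `ξ` of an open strip. -/
theorem deriv_theta_ne_zero (hτ : 0 < τ.im) : deriv (fun z => theta z τ) 0 ≠ 0 := by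
  intro h0
  have hmul : ∀ ξ : ℂ, 0 < ξ.im → ξ.im < τ.im → theta ξ τ = 0 := by
    intro ξ h1 h2
    by_contra hne
    apply theta_not_eventually_zero hτ 0
    have hW : ∀ᶠ α in 𝓝 0, kronW τ ξ α ≠ 0 := by
      have := (differentiableAt_kronW (τ := τ) (ξ := ξ) (α := 0)
        (by rw [abs_of_pos h1]; simpa)).continuousAt
      exact this.eventually_ne (by simp [kronW_zero])
    filter_upwards [hW, eventually_abs_im_lt (sub_pos.mpr h2)] with α hα hα2
    have := theta_mul_kronW_aux' h1 hα2
    rw [h0] at this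
    simpa [Real.pi_ne_zero, hne, hα] using this
  apply theta_not_eventually_zero hτ (((τ.im / 2 : ℝ) : ℂ) * I)
  have hU : IsOpen {z : ℂ | 0 < z.im ∧ z.im < τ.im} :=
    (isOpen_lt continuous_const Complex.continuous_im).inter
      (isOpen_lt Complex.continuous_im continuous_const)
  refine Filter.mem_of_superset (hU.mem_nhds (x := ((τ.im / 2 : ℝ) : ℂ) * I) ?_)
    fun z hz => hmul z hz.1 hz.2
  simp [hτ]

theorem eventually_ee_ne_one : ∀ᶠ α in 𝓝[≠] (0 : ℂ), ee α ≠ 1 := by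
  have := hasDerivAt_ee_zero.eventually_ne (c := 1) (by simp [Real.pi_ne_zero])
  simpa using! this

/-- At a zero `ξ` the left side of `theta_mul_kronW` vanishes for all small `α`, which forces
`θ(ξ+α) = 0` near `α = 0`. -/
theorem theta_ne_zero (hξ : 0 ≤ ξ.im) (hz : ee ξ ≠ 1) (h : ξ.im < τ.im) : theta ξ τ ≠ 0 := by
  intro h0
  have hτ : 0 < τ.im := by linarith
  have h1 : ∀ᶠ α in 𝓝 (0 : ℂ), theta (ξ + α) τ = 0 := by
    have h2 : ∀ᶠ α in 𝓝[≠] (0 : ℂ), theta (ξ + α) τ = 0 := by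
      filter_upwards [eventually_ee_ne_one,
        (eventually_abs_im_lt (sub_pos.mpr h)).filter_mono nhdsWithin_le_nhds] with α h3 h4
      have := theta_mul_kronW hξ hz h4
      rw [h0] at this
      have h5 : 1 - ee α ≠ 0 := sub_ne_zero.mpr h3.symm
      simpa [deriv_theta_ne_zero hτ, h5] using this
    rw [eventually_nhdsWithin_iff] at h2
    filter_upwards [h2] with α hα
    by_cases hα0 : α = 0
    · simpa [hα0] using h0
    · exact hα hα0
  apply theta_not_eventually_zero hτ ξ
  have h2 : Tendsto (fun z : ℂ => z - ξ) (𝓝 ξ) (𝓝 0) := by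
    have : Continuous fun z : ℂ => z - ξ := by fun_prop
    simpa using this.tendsto ξ
  filter_upwards [h2.eventually h1] with z hz
  simpa using hz

/-- The Kronecker function near `α = 0`. -/
theorem kronecker_eventuallyEq (hξ : 0 ≤ ξ.im) (hz : ee ξ ≠ 1) (h : ξ.im < τ.im) :
    ∀ᶠ α in 𝓝[≠] (0 : ℂ), kronecker ξ α τ =
      -(2 * π * I) * (1 / (1 - ee α) + ee ξ / (1 - ee ξ) + lam τ ξ α) := by
  have hτ : 0 < τ.im := by linarith
  have h1 := (differentiable_theta hτ 0).hasDerivAt.eventually_ne (c := 0) (deriv_theta_ne_zero hτ)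
  filter_upwards [eventually_ee_ne_one, h1,
    (eventually_abs_im_lt (sub_pos.mpr h)).filter_mono nhdsWithin_le_nhds] with α h2 h3 h4
  have h5 := theta_mul_kronW hξ hz h4
  have h6 := theta_ne_zero hξ hz h
  have h7 : 1 - ee α ≠ 0 := sub_ne_zero.mpr h2.symm
  rw [kronecker, div_eq_iff (mul_ne_zero h6 h3)]
  apply mul_right_cancel₀ h7
  rw [← h5, kronW]
  have h8 : 1 - ee ξ ≠ 0 := sub_ne_zero.mpr hz.symm
  field_simp
  ring

/-! ### Taylor coefficients -/

theorem iteratedDeriv_eq_of_hasSum {f : ℂ → ℂ} {a : ℕ → ℂ} {δ : ℝ} (hδ : 0 < δ)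
    (h : ∀ z : ℂ, ‖z‖ < δ → HasSum (fun j => a j * z ^ j) (f z)) (n : ℕ) :
    iteratedDeriv n f 0 = n.factorial * a n := by
  set p := FormalMultilinearSeries.ofScalars ℂ a with hp
  set r : NNReal := ⟨δ / 2, by positivity⟩ with hr
  have hr0 : 0 < r := by rw [← NNReal.coe_pos]; exact half_pos hδ
  have hrad : (r : ENNReal) ≤ p.radius := by
    apply p.le_radius_of_summable_norm
    have h1 := (h ((δ / 2 : ℝ) : ℂ) (by
      rw [Complex.norm_real, Real.norm_of_nonneg (by positivity)]; linarith)).summable.norm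
    refine h1.congr fun j => ?_
    rw [hp, FormalMultilinearSeries.ofScalars_norm, norm_mul, norm_pow, Complex.norm_real,
      Real.norm_of_nonneg (by positivity)]
    rfl
  have hf : HasFPowerSeriesOnBall f p 0 r := by
    refine ⟨hrad, by simpa using hr0, fun {y} hy => ?_⟩
    have hy' : ‖y‖ < δ := by
      have h2 : ‖y‖ < δ / 2 := by
        have := hy
        rw [Metric.mem_eball, edist_zero_right, enorm_lt_coe] at this
        exact_mod_cast this
      linarith
    have := h y hy'
    rw [zero_add]
    refine this.congr_fun fun j => ?_
    simp [hp, mul_comm]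
  have := hf.factorial_smul (1 : ℂ) n
  rw [iteratedDeriv_eq_iteratedFDeriv, ← this]
  simp [hp]

/-- The sum over `i` and the exponential series may be interchanged: the hypothesis is exactly the
sum of the absolute values of the double family. -/
theorem hasSum_exp_series {ι : Type*} {c μ : ι → ℂ} {x : ℂ}
    (hs : Summable fun i => ‖c i‖ * Real.exp (‖μ i‖ * ‖x‖)) :
    HasSum (fun j : ℕ => (∑' i, c i * μ i ^ j) / (j.factorial : ℂ) * x ^ j)
      (∑' i, c i * cexp (μ i * x)) := by
  have hexp : ∀ i, HasSum (fun j : ℕ => c i * ((μ i * x) ^ j / j.factorial))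
      (c i * cexp (μ i * x)) := by
    intro i
    rw [Complex.exp_eq_exp_ℂ]
    exact (NormedSpace.expSeries_div_hasSum_exp (μ i * x)).mul_left _
  have hsum : Summable fun y : ι × ℕ => c y.1 * ((μ y.1 * x) ^ y.2 / y.2.factorial) := by
    apply Summable.of_norm
    have hn : ∀ i, HasSum (fun j : ℕ => ‖c i * ((μ i * x) ^ j / j.factorial)‖)
        (‖c i‖ * Real.exp (‖μ i‖ * ‖x‖)) := by
      intro i
      have := (NormedSpace.expSeries_div_hasSum_exp (‖μ i‖ * ‖x‖)).mul_left ‖c i‖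
      rw [← Real.exp_eq_exp_ℝ] at this
      refine this.congr_fun fun j => ?_
      simp [mul_pow]
    rw [summable_prod_of_nonneg fun _ => norm_nonneg _]
    exact ⟨fun i => (hn i).summable, hs.congr fun i => (hn i).tsum_eq.symm⟩
  have h1 := hsum.hasSum
  rw [hsum.tsum_prod] at h1
  simp only [fun i => (hexp i).tsum_eq] at h1
  rw [← (Equiv.prodComm ℕ ι).hasSum_iff] at h1
  have h2 := h1.prod_fiberwise fun j => ((hsum.prod_symm.prod_factor j).hasSum)
  refine h2.congr_fun fun j => ?_
  rw [← tsum_div_const, ← tsum_mul_right]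
  refine tsum_congr fun i => ?_
  simp only [Prod.swap, mul_pow]
  ring

/-! ### The functions `ω_n` -/

/-- The function `x / (e^x - 1)`, `x = 2πiα`, extended to `α = 0`. -/
noncomputable def todd (α : ℂ) : ℂ := 2 * π * I / dslope ee 0 α

theorem analyticAt_todd : AnalyticAt ℂ todd 0 := by
  have h1 : DifferentiableOn ℂ (dslope ee 0) Set.univ :=
    (Complex.differentiableOn_dslope Filter.univ_mem).mpr differentiable_ee.differentiableOn
  have h2 : AnalyticAt ℂ (dslope ee 0) 0 := h1.analyticAt Filter.univ_mem
  refine analyticAt_const.div h2 ?_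
  rw [dslope_same, hasDerivAt_ee_zero.deriv]
  simp [Real.pi_ne_zero]

theorem todd_zero : todd 0 = 1 := by
  rw [todd, dslope_same, hasDerivAt_ee_zero.deriv]
  exact div_self (by simp [Real.pi_ne_zero])

theorem todd_of_ne {α : ℂ} (h : α ≠ 0) : todd α = 2 * π * I * α / (ee α - 1) := by
  rw [todd, dslope_of_ne _ h, slope_def_field, ee_zero, sub_zero, div_div_eq_mul_div]

/-- The coefficient of `x^n` in `e^(ρx) x / (e^x - 1)`. -/
noncomputable def beta (n : ℕ) (ρ : ℂ) : ℂ :=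
  iteratedDeriv n (fun α => ee (ρ * α) * todd α) 0 / ((2 * π * I) ^ n * n.factorial)

/-- By Leibniz' rule the coefficient is polynomial in `ρ` (it is the Bernoulli polynomial divided by
`n!`); only its continuity is used. -/
theorem beta_eq (n : ℕ) (ρ : ℂ) : beta n ρ =
    (∑ i ∈ Finset.range (n + 1), (n.choose i : ℂ) * (2 * π * I * ρ) ^ i *
      iteratedDeriv (n - i) todd 0) / ((2 * π * I) ^ n * n.factorial) := by
  rw [beta]
  congr 1
  have h1 : ContDiffAt ℂ n (fun α => ee (ρ * α)) 0 := by unfold ee; fun_prop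
  rw [iteratedDeriv_fun_mul h1 analyticAt_todd.contDiffAt]
  refine Finset.sum_congr rfl fun i _ => ?_
  congr 2
  have : (fun α => ee (ρ * α)) = fun α => cexp (2 * π * I * ρ * α) := by
    funext α; rw [ee, mul_assoc (2 * (π : ℂ) * I)]
  rw [this, iteratedDeriv_cexp_const_mul]
  simp

theorem continuous_beta (n : ℕ) : Continuous (beta n) := by
  rw [funext (beta_eq n)]
  fun_prop

theorem omega_zero (ξ τ : ℂ) : omega 0 ξ τ = 2 * π * I := by
  simp [omega]

theorem summable_lam_exp {ρ : ℝ} {x : ℂ} (h : |ξ.im| + ‖x‖ < τ.im) (s : ℤ) (hs : s = 1 ∨ s = -1) :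
    Summable fun p : ℕ × ℕ => ‖ee ((p.1 + 1) * (p.2 + 1) * τ + s * ((p.1 + 1) * ξ))‖ *
      Real.exp (‖2 * π * I * (ρ + s * (p.2 + 1))‖ * ‖x‖) := by
  have hpi := Real.pi_pos
  -- The growth `exp(2π(k+1)‖x‖)` is that of the Lambert terms with second variable `-i‖x‖`, so the
  -- bound for the Lambert series applies. Here `k` is the second index.
  have h1 := (summable_ee_succ (x := s * ξ.im) (y := -‖x‖) (σ := |ξ.im| + ‖x‖)
    (u := fun p => (p.1 + 1) * (p.2 + 1) * τ + s * ((p.1 + 1) * ξ) - (p.2 + 1) * (‖x‖ * I))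
    (by rw [abs_neg, abs_norm]; rcases hs with rfl | rfl <;> simp) h
    (fun p => by simp [← Complex.ofReal_intCast]; ring)).norm
  refine Summable.of_nonneg_of_le (fun p => by positivity) (fun p => ?_)
    (h1.mul_left (Real.exp (2 * π * |ρ| * ‖x‖)))
  have h2 : ‖2 * π * I * (ρ + s * (p.2 + 1))‖ ≤ 2 * π * (|ρ| + (p.2 + 1)) := by
    rw [norm_mul]
    have h3 : ‖2 * (π : ℂ) * I‖ = 2 * π := by simp [abs_of_pos hpi]
    rw [h3]
    have h4 : ‖(ρ : ℂ) + s * (p.2 + 1)‖ ≤ |ρ| + (p.2 + 1) := by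
      refine (norm_add_le _ _).trans (add_le_add (by simp) ?_)
      have h5 : ‖(p.2 : ℂ) + 1‖ = p.2 + 1 := by
        rw [← Nat.cast_add_one, Complex.norm_natCast]; push_cast; rfl
      rw [norm_mul, h5]
      rcases hs with rfl | rfl <;> simp
    exact mul_le_mul_of_nonneg_left h4 (by positivity)
  have h3 := mul_le_mul_of_nonneg_right h2 (norm_nonneg x)
  calc _ ≤ ‖ee ((p.1 + 1) * (p.2 + 1) * τ + s * ((p.1 + 1) * ξ))‖ *
        Real.exp (2 * π * (|ρ| + (p.2 + 1)) * ‖x‖) := by gcongr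
    _ = _ := by
      rw [norm_ee, norm_ee, ← Real.exp_add, ← Real.exp_add]
      congr 1
      simp [← Complex.ofReal_intCast]
      ring

theorem exp_two_pi_eq (ρ α : ℂ) : cexp (2 * π * I * ρ * α) = ee (ρ * α) := by
  rw [ee]; ring_nf

/-- The `x^n`-coefficient of the regular part of the Kronecker function, times `n!`. -/
noncomputable def lamCoeff (τ ξ : ℂ) (ρ : ℂ) (n : ℕ) : ℂ :=
  ee ξ / (1 - ee ξ) * ρ ^ n +
    (∑' p : ℕ × ℕ, ee ((p.1 + 1) * (p.2 + 1) * τ + (p.1 + 1) * ξ) * (ρ + (p.2 + 1)) ^ n -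
      ∑' p : ℕ × ℕ, ee ((p.1 + 1) * (p.2 + 1) * τ - (p.1 + 1) * ξ) * (ρ - (p.2 + 1)) ^ n)

theorem hasSum_lam_exp {ρ : ℝ} {x : ℂ} (h : |ξ.im| + ‖x‖ < τ.im) (s : ℤ) (hs : s = 1 ∨ s = -1) :
    HasSum (fun j : ℕ => (2 * π * I) ^ j * (∑' p : ℕ × ℕ,
        ee ((p.1 + 1) * (p.2 + 1) * τ + s * ((p.1 + 1) * ξ)) * (ρ + s * (p.2 + 1)) ^ j) /
          (j.factorial : ℂ) * x ^ j)
      (ee (ρ * x) * ∑' p : ℕ × ℕ,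
        ee ((p.1 + 1) * (p.2 + 1) * τ + s * ((p.1 + 1) * ξ) + s * ((p.2 + 1) * x))) := by
  have h1 := hasSum_exp_series
    (c := fun p : ℕ × ℕ => ee ((p.1 + 1) * (p.2 + 1) * τ + s * ((p.1 + 1) * ξ)))
    (μ := fun p : ℕ × ℕ => 2 * π * I * (ρ + s * (p.2 + 1)))
    (summable_lam_exp (ρ := ρ) h s hs)
  have e1 : ∀ j : ℕ, ∑' p : ℕ × ℕ, ee ((p.1 + 1) * (p.2 + 1) * τ + s * ((p.1 + 1) * ξ)) *
      (2 * π * I * (ρ + s * (p.2 + 1))) ^ j = (2 * π * I) ^ j *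
      ∑' p : ℕ × ℕ, ee ((p.1 + 1) * (p.2 + 1) * τ + s * ((p.1 + 1) * ξ)) *
        (ρ + s * (p.2 + 1)) ^ j := by
    intro j
    rw [← tsum_mul_left]
    refine tsum_congr fun p => ?_
    rw [mul_pow]; ring
  have e2 : ∑' p : ℕ × ℕ, ee ((p.1 + 1) * (p.2 + 1) * τ + s * ((p.1 + 1) * ξ)) *
      cexp (2 * π * I * (ρ + s * (p.2 + 1)) * x) = ee (ρ * x) * ∑' p : ℕ × ℕ,
        ee ((p.1 + 1) * (p.2 + 1) * τ + s * ((p.1 + 1) * ξ) + s * ((p.2 + 1) * x)) := by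
    rw [← tsum_mul_left]
    refine tsum_congr fun p => ?_
    rw [exp_two_pi_eq, ← ee_add, ← ee_add]
    congr 1; ring
  rw [e2] at h1
  exact h1.congr_fun fun j => by rw [e1]

theorem hasSum_lamCoeff {ρ : ℝ} {x : ℂ} (h : |ξ.im| + ‖x‖ < τ.im) :
    HasSum (fun j : ℕ => (2 * π * I) ^ j / (j.factorial : ℂ) * lamCoeff τ ξ ρ j * x ^ j)
      (ee (ρ * x) * (ee ξ / (1 - ee ξ) + lam τ ξ x)) := by
  have h1 := hasSum_lam_exp (ρ := ρ) h 1 (Or.inl rfl)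
  have h2 := hasSum_lam_exp (ρ := ρ) h (-1) (Or.inr rfl)
  simp only [Int.cast_one, one_mul, Int.cast_neg, neg_mul, ← sub_eq_add_neg] at h1 h2
  have h3 : HasSum (fun j : ℕ => ee ξ / (1 - ee ξ) *
      ((2 * π * I * ρ * x) ^ j / (j.factorial : ℂ))) (ee ξ / (1 - ee ξ) * ee (ρ * x)) := by
    have h6 := (NormedSpace.expSeries_div_hasSum_exp (2 * π * I * ρ * x)).mul_left
      (ee ξ / (1 - ee ξ))
    rwa [← Complex.exp_eq_exp_ℂ, exp_two_pi_eq] at h6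
  have habs : |ξ.im| + |x.im| < τ.im :=
    (add_le_add le_rfl (Complex.abs_im_le_norm x)).trans_lt h
  have hp : Summable fun p : ℕ × ℕ =>
      ee ((p.1 + 1) * (p.2 + 1) * τ + (p.1 + 1) * ξ + (p.2 + 1) * x) :=
    summable_ee_succ le_rfl habs fun p => by simp
  have hm : Summable fun p : ℕ × ℕ =>
      ee ((p.1 + 1) * (p.2 + 1) * τ - (p.1 + 1) * ξ - (p.2 + 1) * x) :=
    summable_ee_succ (x := -ξ.im) (y := -x.im) (by simp) habs fun p => by simp; ring
  have h5 : lam τ ξ x =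
      ∑' p : ℕ × ℕ, ee ((p.1 + 1) * (p.2 + 1) * τ + (p.1 + 1) * ξ + (p.2 + 1) * x) -
      ∑' p : ℕ × ℕ, ee ((p.1 + 1) * (p.2 + 1) * τ - (p.1 + 1) * ξ - (p.2 + 1) * x) :=
    hp.tsum_sub hm
  rw [h5, mul_add, mul_sub, mul_comm (ee (ρ * x)) (ee ξ / (1 - ee ξ))]
  refine (h3.add (h1.sub h2)).congr_fun fun j => ?_
  rw [lamCoeff]
  simp only [mul_pow]
  ring

/-- Near `α = 0`, Kronecker's expansion splits `α Ω` into `e(ρα)` times the Todd function,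
contributing `beta`, and `-2πi α` times an analytic function with Taylor coefficients given by
`lamCoeff`. The extra factor `α` turns index `n` into `n + 1`. -/
theorem omega_succ (n : ℕ) (hξ : 0 ≤ ξ.im) (hz : ee ξ ≠ 1) (h : ξ.im < τ.im) :
    omega (n + 1) ξ τ = 2 * π * I * (beta (n + 1) ((ξ.im / τ.im : ℝ) : ℂ) -
      lamCoeff τ ξ ((ξ.im / τ.im : ℝ) : ℂ) n / n.factorial) := by
  set ρ : ℝ := ξ.im / τ.im with hρ
  have hpi : (2 * π * I : ℂ) ≠ 0 := by simp [Real.pi_ne_zero]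
  set P : ℂ → ℂ := fun x => ee (ρ * x) * (ee ξ / (1 - ee ξ) + lam τ ξ x) with hP
  set a : ℕ → ℂ := fun j => (2 * π * I) ^ j / (j.factorial : ℂ) * lamCoeff τ ξ ρ j with ha
  have hδ : 0 < τ.im - ξ.im := by linarith
  have hPs : ∀ x : ℂ, ‖x‖ < τ.im - ξ.im → HasSum (fun j => a j * x ^ j) (P x) := fun x hx =>
    hasSum_lamCoeff (by rw [abs_of_nonneg hξ]; linarith)
  have hPs' : ∀ x : ℂ, ‖x‖ < τ.im - ξ.im →
      HasSum (fun j => (if j = 0 then 0 else a (j - 1)) * x ^ j) (x * P x) := by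
    intro x hx
    rw [← hasSum_nat_add_iff' 1]
    simp only [Finset.range_one, Finset.sum_singleton, zero_mul, sub_zero, if_true,
      Nat.succ_ne_zero, if_false, Nat.add_sub_cancel]
    refine ((hPs x hx).mul_left x).congr_fun fun j => ?_
    rw [pow_succ]; ring
  have hder := iteratedDeriv_eq_of_hasSum hδ hPs' (n + 1)
  have hPan : AnalyticAt ℂ (fun x => x * P x) 0 := by
    have hd : DifferentiableOn ℂ (fun x => x * P x) {z : ℂ | |z.im| < τ.im - ξ.im} := by
      intro x hx
      have h1 := differentiableAt_lam (τ := τ) (ξ := ξ) (α := x) (by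
        rw [abs_of_nonneg hξ]
        have : |x.im| < τ.im - ξ.im := hx
        linarith)
      have h2 : DifferentiableAt ℂ (fun x => ee (ρ * x)) x := by unfold ee; fun_prop
      simp only [hP]
      exact (by fun_prop : DifferentiableAt ℂ _ x).differentiableWithinAt
    exact hd.analyticAt (eventually_abs_im_lt hδ)
  have hev : Function.update (fun α : ℂ => α * Omega ξ α τ) 0 1 =ᶠ[𝓝 0]
      fun α => ee (ρ * α) * todd α - 2 * π * I * (α * P α) := by
    have h1 := kronecker_eventuallyEq hξ hz h
    have h2 := eventually_ee_ne_one
    rw [eventually_nhdsWithin_iff] at h1 h2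
    filter_upwards [h1, h2] with α h3 h4
    by_cases hα : α = 0
    · simp [hα, todd_zero, ee_zero]
    · have h5 := h4 hα
      rw [Function.update_of_ne hα, Omega, h3 hα, todd_of_ne hα, exp_two_pi_eq]
      simp only [hP]
      have h6 : 1 - ee α ≠ 0 := sub_ne_zero.mpr h5.symm
      have h7 : ee α - 1 ≠ 0 := sub_ne_zero.mpr h5
      rw [show 1 - ee α = -(ee α - 1) by ring]
      field_simp
      ring
  have hA : AnalyticAt ℂ (fun α => ee (ρ * α) * todd α) 0 := by
    have : AnalyticAt ℂ (fun α : ℂ => ee (ρ * α)) 0 := by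
      unfold ee; fun_prop
    exact this.mul analyticAt_todd
  rw [omega, hev.iteratedDeriv_eq, iteratedDeriv_fun_sub hA.contDiffAt
    (contDiffAt_const.mul hPan.contDiffAt), iteratedDeriv_const_mul_field, hder, beta]
  simp only [ha, Nat.factorial_succ, pow_succ, Nat.succ_ne_zero, if_false, Nat.add_sub_cancel]
  have hn : (n.factorial : ℂ) ≠ 0 := by exact_mod_cast n.factorial_ne_zero
  have hn1 : ((n : ℂ) + 1) ≠ 0 := by exact_mod_cast n.succ_ne_zero
  push_cast
  field_simp

/-! ### Exponentially small functions -/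

theorem eventually_one_le_im : ∀ᶠ τ : ℂ in comap Complex.im atTop, 1 ≤ τ.im :=
  tendsto_comap.eventually (eventually_ge_atTop (1 : ℝ))

theorem one_le_norm_of_im {τ : ℂ} (h : 1 ≤ τ.im) : 1 ≤ ‖τ‖ :=
  h.trans ((le_abs_self _).trans (Complex.abs_im_le_norm τ))

theorem isBigO_zpow_mul {M : ℤ} {N : ℕ} (h : M ≤ N) (g : ℂ → ℂ) :
    (fun τ : ℂ => τ ^ M * g τ) =O[comap Complex.im atTop] fun τ : ℂ => τ ^ N * g τ := by
  refine IsBigO.of_bound 1 ?_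
  filter_upwards [eventually_one_le_im] with τ hτ
  rw [norm_mul, norm_mul, one_mul, norm_zpow, norm_pow, ← zpow_natCast]
  gcongr
  exact one_le_norm_of_im hτ

theorem IsExpSmall.zpow_mul {R : ℂ → ℂ} (h : IsExpSmall R) (M : ℤ) :
    IsExpSmall fun τ => τ ^ M * R τ := by
  obtain ⟨N, hN⟩ := h
  refine ⟨(M + N).toNat, ?_⟩
  have h1 : (fun τ : ℂ => τ ^ M * R τ) =O[comap Complex.im atTop]
      fun τ : ℂ => τ ^ M * (τ ^ N * cexp (2 * π * I * τ)) := (isBigO_refl _ _).mul hN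
  refine h1.trans ((EventuallyEq.isBigO ?_).trans
    (isBigO_zpow_mul (M := M + N) (Int.self_le_toNat _) fun τ => cexp (2 * π * I * τ)))
  filter_upwards [eventually_one_le_im] with τ hτ
  have : τ ≠ 0 := norm_pos_iff.mp (zero_lt_one.trans_le (one_le_norm_of_im hτ))
  rw [zpow_add₀ this, zpow_natCast]
  ring

theorem IsExpSmall.add {R S : ℂ → ℂ} (hR : IsExpSmall R) (hS : IsExpSmall S) :
    IsExpSmall fun τ => R τ + S τ := by
  obtain ⟨N, hN⟩ := hR
  obtain ⟨M, hM⟩ := hS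
  refine ⟨max N M, IsBigO.add (hN.trans ?_) (hM.trans ?_)⟩
  · simpa using isBigO_zpow_mul (M := N) (N := max N M) (by simp) fun τ => cexp (2 * π * I * τ)
  · simpa using isBigO_zpow_mul (M := M) (N := max N M) (by simp) fun τ => cexp (2 * π * I * τ)

theorem IsExpSmall.const_mul {R : ℂ → ℂ} (hR : IsExpSmall R) (c : ℂ) :
    IsExpSmall fun τ => c * R τ := by
  obtain ⟨N, hN⟩ := hR
  exact ⟨N, hN.const_mul_left c⟩

theorem isExpSmall_zero : IsExpSmall fun _ => 0 := ⟨0, isBigO_zero _ _⟩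

theorem IsExpSmall.congr {R S : ℂ → ℂ} (hR : IsExpSmall R) (h : ∀ τ : ℂ, 0 < τ.im → R τ = S τ) :
    IsExpSmall S := by
  obtain ⟨N, hN⟩ := hR
  refine ⟨N, hN.congr' ?_ EventuallyEq.rfl⟩
  filter_upwards [eventually_one_le_im] with τ hτ
  exact h τ (by linarith)

theorem IsExpSmall.sum {ι : Type*} (s : Finset ι) {R : ι → ℂ → ℂ}
    (h : ∀ i ∈ s, IsExpSmall (R i)) : IsExpSmall fun τ => ∑ i ∈ s, R i τ := by
  classical
  induction s using Finset.induction_on with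
  | empty => simpa using isExpSmall_zero
  | insert a s ha ih =>
    simp only [Finset.sum_insert ha]
    exact (h a (Finset.mem_insert_self _ _)).add
      (ih fun i hi => h i (Finset.mem_insert_of_mem hi))

/-! ### Uniqueness of the splitting -/

/-- If `d` is the largest exponent with non-zero coefficient, multiplication by `y^(-d)` leaves that
coefficient in the limit, contradicting the limit `0`. -/
theorem eq_zero_of_tendsto_laurent {s : Finset ℤ} {a : ℤ → ℂ}
    (h : ∀ k : ℤ, Tendsto (fun y : ℝ => (y : ℂ) ^ k * ∑ i ∈ s, a i * (y : ℂ) ^ i) atTop (𝓝 0)) :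
    ∀ i ∈ s, a i = 0 := by
  by_contra! hne
  obtain ⟨i, his, hi⟩ := hne
  have hn : (s.filter fun i => a i ≠ 0).Nonempty := ⟨i, Finset.mem_filter.mpr ⟨his, hi⟩⟩
  set d := (s.filter fun i => a i ≠ 0).max' hn with hd
  have hmem := Finset.mem_filter.mp (Finset.max'_mem _ hn)
  rw [← hd] at hmem
  have hle : ∀ i ∈ s, a i ≠ 0 → i ≤ d := fun i his hi =>
    Finset.le_max' _ _ (Finset.mem_filter.mpr ⟨his, hi⟩)
  have h1 : Tendsto (fun y : ℝ => ∑ i ∈ s, a i * (y : ℂ) ^ (i - d)) atTop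
      (𝓝 (∑ i ∈ s, if i = d then a d else 0)) := by
    refine tendsto_finsetSum _ fun i his => ?_
    split_ifs with hid
    · simp [hid]
    · by_cases hi : a i = 0
      · simp [hi]
      · have hlt : i - d < 0 := by have := hle i his hi; omega
        rw [show (0 : ℂ) = a i * 0 by simp]
        refine Tendsto.const_mul _ ?_
        rw [tendsto_zero_iff_norm_tendsto_zero]
        have h2 := tendsto_zpow_atTop_zero (𝕜 := ℝ) hlt
        refine h2.congr' ?_
        filter_upwards [eventually_gt_atTop (0 : ℝ)] with y hy
        rw [norm_zpow, Complex.norm_real, Real.norm_of_nonneg hy.le]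
  have h2 := h (-d)
  have h3 : (fun y : ℝ => ∑ i ∈ s, a i * (y : ℂ) ^ (i - d)) =ᶠ[atTop]
      fun y : ℝ => (y : ℂ) ^ (-d) * ∑ i ∈ s, a i * (y : ℂ) ^ i := by
    filter_upwards [eventually_gt_atTop (0 : ℝ)] with y hy
    rw [Finset.mul_sum]
    refine Finset.sum_congr rfl fun i _ => ?_
    rw [sub_eq_neg_add, zpow_add₀ (by exact_mod_cast hy.ne')]
    ring
  have h4 := tendsto_nhds_unique (h1.congr' h3) h2
  rw [Finset.sum_ite_eq' s d, if_pos hmem.1] at h4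
  exact hmem.2 h4

theorem IsExpSmall.tendsto {R : ℂ → ℂ} (h : IsExpSmall R) (k : ℤ) :
    Tendsto (fun y : ℝ => (y : ℂ) ^ k * R (y * I)) atTop (𝓝 0) := by
  have htop : Tendsto (fun y : ℝ => (y : ℂ) * I) atTop (comap Complex.im atTop) := by
    rw [tendsto_comap_iff]
    refine tendsto_id.congr fun y => ?_
    simp
  obtain ⟨N, hN⟩ := h.zpow_mul k
  have h1 := hN.comp_tendsto htop
  have h2 : Tendsto (fun y : ℝ => y ^ N * Real.exp (-(2 * π) * y)) atTop (𝓝 0) := by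
    have h := tendsto_rpow_mul_exp_neg_mul_atTop_nhds_zero N (2 * π) (by positivity)
    simpa using h
  have h3 := h1.trans_tendsto (by
    rw [tendsto_zero_iff_norm_tendsto_zero]
    refine h2.congr' ?_
    filter_upwards [eventually_gt_atTop (0 : ℝ)] with y hy
    simp only [Function.comp, norm_mul, norm_pow, Complex.norm_real, Complex.norm_I, mul_one,
      Real.norm_of_nonneg hy.le, Complex.norm_exp]
    congr 2
    simp)
  have h4 := h3.const_mul (I ^ (-k))
  rw [mul_zero] at h4
  refine h4.congr fun y => ?_
  simp only [Function.comp, mul_zpow]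
  have : I ^ (-k) * I ^ k = 1 := by rw [← zpow_add₀ I_ne_zero]; simp
  linear_combination (y : ℂ) ^ k * R (y * I) * this

/-- Subtracting the values at `iy` and `2iy` replaces the logarithm by the constant `c log 2` and
multiplies the coefficient of exponent `i` by `2^i - 1`, which vanishes for `i = 0`. The constant
term of the difference is therefore exactly `c log 2`, and `c = 0` follows. -/
theorem laurentLog_eq_zero {p : ℤ →₀ ℂ} {c : ℂ} (h : IsExpSmall (laurentLog p c)) :
    p = 0 ∧ c = 0 := by
  have h1 := h.tendsto
  have h2 : ∀ k : ℤ, Tendsto (fun y : ℝ => (y : ℂ) ^ k * laurentLog p c (((2 * y : ℝ) : ℂ) * I))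
      atTop (𝓝 0) := by
    intro k
    have h3 : Tendsto (fun y : ℝ => 2 * y) atTop atTop :=
      tendsto_id.const_mul_atTop two_pos
    have h4 := ((h1 k).comp h3).const_mul ((2 : ℂ) ^ (-k))
    rw [mul_zero] at h4
    refine h4.congr fun y => ?_
    have : (2 : ℂ) ^ (-k) * 2 ^ k = 1 := by rw [← zpow_add₀ two_ne_zero]; simp
    simp only [Function.comp]
    rw [show (((2 * y : ℝ) : ℂ)) ^ k = 2 ^ k * (y : ℂ) ^ k by push_cast; rw [mul_zpow]]
    linear_combination (y : ℂ) ^ k * laurentLog p c (((2 * y : ℝ) : ℂ) * I) * this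
  have hc : c = 0 := by
    have h3 := eq_zero_of_tendsto_laurent (s := insert 0 p.support)
      (a := fun i => p i * I ^ i * (2 ^ i - 1) + if i = 0 then c * Real.log 2 else 0) (by
        intro k
        have h4 := (h2 k).sub (h1 k)
        rw [sub_zero] at h4
        refine h4.congr' ?_
        filter_upwards [eventually_gt_atTop (0 : ℝ)] with y hy
        rw [← mul_sub]
        congr 1
        have hy' : (y : ℂ) * I ≠ 0 := mul_ne_zero (by exact_mod_cast hy.ne') I_ne_zero
        have hlog : Complex.log (((2 * y : ℝ) : ℂ) * I) =
            Real.log 2 + Complex.log (y * I) := by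
          rw [← Complex.log_ofReal_mul two_pos hy']
          push_cast; ring_nf
        simp only [laurentLog, hlog, add_mul, Finset.sum_add_distrib]
        rw [Finsupp.sum_of_support_subset p (Finset.subset_insert 0 p.support) _ (by simp),
          Finsupp.sum_of_support_subset p (Finset.subset_insert 0 p.support) _ (by simp)]
        have h5 : ∑ i ∈ insert 0 p.support, (if i = 0 then c * (Real.log 2 : ℂ) else 0) *
            (y : ℂ) ^ i = c * Real.log 2 := by
          rw [Finset.sum_eq_single (0 : ℤ)]
          · simp
          · intro b _ hb; simp [hb]
          · intro h; exact absurd (Finset.mem_insert_self _ _) h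
        have h6 : ∑ i ∈ insert 0 p.support, p i * I ^ i * (2 ^ i - 1) * (y : ℂ) ^ i =
            ∑ i ∈ insert 0 p.support, p i * (((2 * y : ℝ) : ℂ) * I) ^ i -
              ∑ i ∈ insert 0 p.support, p i * ((y : ℂ) * I) ^ i := by
          rw [← Finset.sum_sub_distrib]
          refine Finset.sum_congr rfl fun i _ => ?_
          push_cast
          rw [mul_zpow, mul_zpow, mul_zpow]
          ring
        rw [h5, h6]
        ring) 0 (Finset.mem_insert_self _ _)
    have hl : (Real.log 2 : ℂ) ≠ 0 := by exact_mod_cast (Real.log_pos one_lt_two).ne'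
    have h4 : c * (Real.log 2 : ℂ) = 0 := by simpa [-mul_eq_zero] using h3
    exact (mul_eq_zero.mp h4).resolve_right hl
  refine ⟨?_, hc⟩
  have h3 := eq_zero_of_tendsto_laurent (s := p.support) (a := fun i => p i * I ^ i) (by
    intro k
    refine (h1 k).congr fun y => ?_
    simp only [laurentLog, hc, zero_mul, add_zero, Finsupp.sum]
    congr 1
    refine Finset.sum_congr rfl fun i _ => ?_
    rw [mul_zpow]; ring)
  ext i
  by_contra hi
  have := h3 i (Finsupp.mem_support_iff.mpr hi)
  exact hi (by simpa [zpow_ne_zero] using this)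

theorem laurentLog_sub (p p' : ℤ →₀ ℂ) (c c' : ℂ) (τ : ℂ) :
    laurentLog (p - p') (c - c') τ = laurentLog p c τ - laurentLog p' c' τ := by
  simp only [laurentLog]
  rw [Finsupp.sum_sub_index (by intros; ring)]
  ring

theorem IsSplitting.unique {f : ℂ → ℂ} {p p' : ℤ →₀ ℂ} {c c' : ℂ} (h : IsSplitting f p c)
    (h' : IsSplitting f p' c') : p = p' ∧ c = c' := by
  have h1 : IsExpSmall (laurentLog (p - p') (c - c')) := by
    refine (h'.add (h.const_mul (-1))).congr fun τ _ => ?_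
    rw [laurentLog_sub]; ring
  obtain ⟨h2, h3⟩ := laurentLog_eq_zero h1
  exact ⟨sub_eq_zero.mp h2, sub_eq_zero.mp h3⟩

theorem IsSplitting.infPart_eq {f : ℂ → ℂ} {p : ℤ →₀ ℂ} {c : ℂ} (h : IsSplitting f p c) :
    infPart f = laurentLog p c := by
  have hex : ∃ x : (ℤ →₀ ℂ) × ℂ, IsSplitting f x.1 x.2 := ⟨(p, c), h⟩
  rw [infPart, dif_pos hex]
  obtain ⟨h1, h2⟩ := hex.choose_spec.unique h
  rw [h1, h2]

theorem isSplitting_of_eq {f R : ℂ → ℂ} {p : ℤ →₀ ℂ} {c : ℂ}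
    (h : ∀ τ : ℂ, 0 < τ.im → f τ = laurentLog p c τ + R τ) (hR : IsExpSmall R) :
    IsSplitting f p c :=
  hR.congr fun τ hτ => by rw [h τ hτ]; ring

theorem expPart_eq_of_eq {f R : ℂ → ℂ} {p : ℤ →₀ ℂ} {c : ℂ}
    (h : ∀ τ : ℂ, 0 < τ.im → f τ = laurentLog p c τ + R τ) (hR : IsExpSmall R)
    (hτ : 0 < τ.im) : expPart f τ = R τ := by
  rw [expPart, (isSplitting_of_eq h hR).infPart_eq, h τ hτ]; ring

/-! ### Double `q`-series -/

/-- The series `∑_{m,k ≥ 1} c(m,k) q^(mk)`. -/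
noncomputable def qser (c : ℕ × ℕ → ℂ) (τ : ℂ) : ℂ :=
  ∑' p : ℕ × ℕ, c p * ee ((p.1 + 1) * (p.2 + 1) * τ)

/-- Coefficients of polynomial growth. -/
def PolyBounded (c : ℕ × ℕ → ℂ) : Prop :=
  ∃ (C : ℝ) (a : ℕ), ∀ p, ‖c p‖ ≤ C * (((p.1 + 1) * (p.2 + 1) : ℕ) : ℝ) ^ a

theorem summable_pow_mul_pow_succ_mul_succ {r : ℝ} (h0 : 0 ≤ r) (h1 : r < 1) (a : ℕ) :
    Summable fun p : ℕ × ℕ =>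
      (((p.1 + 1) * (p.2 + 1) : ℕ) : ℝ) ^ a * r ^ ((p.1 + 1) * (p.2 + 1)) := by
  -- With `r < s < 1`, the sequence `n^a (r/s)^n` is bounded, so polynomial growth is absorbed by
  -- passing from ratio `r` to ratio `s`.
  obtain ⟨s, hs1, hs2⟩ := exists_between h1
  have hs0 : 0 < s := h0.trans_lt hs1
  have hrs : |r / s| < 1 := by
    rw [abs_of_nonneg (by positivity), div_lt_one hs0]; exact hs1
  have ht := tendsto_pow_const_mul_const_pow_of_abs_lt_one a hrs
  obtain ⟨C, hC⟩ := ht.bddAbove_range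
  refine Summable.of_nonneg_of_le (fun p => by positivity) (fun p => ?_)
    ((summable_pow_succ_mul_succ hs0.le hs2).mul_left C)
  have h2 := hC ⟨(p.1 + 1) * (p.2 + 1), rfl⟩
  simp only at h2
  rw [div_pow, ← mul_div_assoc, div_le_iff₀ (by positivity)] at h2
  exact h2

theorem norm_ee_mul (p : ℕ × ℕ) (τ : ℂ) : ‖ee ((p.1 + 1) * (p.2 + 1) * τ)‖ =
    Real.exp (-(2 * π * τ.im)) ^ ((p.1 + 1) * (p.2 + 1)) := by
  rw [norm_ee, ← Real.exp_nat_mul]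
  congr 1
  simp
  ring

theorem exp_neg_im_lt_one (hτ : 0 < τ.im) : Real.exp (-(2 * π * τ.im)) < 1 := by
  rw [Real.exp_lt_one_iff]
  have : 0 < 2 * π * τ.im := by positivity
  linarith

theorem PolyBounded.summable {c : ℕ × ℕ → ℂ} (hc : PolyBounded c) (hτ : 0 < τ.im) :
    Summable fun p => c p * ee ((p.1 + 1) * (p.2 + 1) * τ) := by
  obtain ⟨C, a, h⟩ := hc
  refine Summable.of_norm_bounded ((summable_pow_mul_pow_succ_mul_succ
    (Real.exp_pos (-(2 * π * τ.im))).le (exp_neg_im_lt_one hτ) a).mul_left C) fun p => ?_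
  rw [norm_mul, norm_ee_mul, ← mul_assoc]
  gcongr
  exact h p

theorem PolyBounded.isExpSmall {c : ℕ × ℕ → ℂ} (hc : PolyBounded c) : IsExpSmall (qser c) := by
  obtain ⟨C, a, h⟩ := hc
  refine ⟨0, ?_⟩
  set r := Real.exp (-(2 * π * (1 : ℝ))) with hr
  have hr0 : 0 < r := Real.exp_pos _
  have hr1 : r < 1 := by
    have := exp_neg_im_lt_one (τ := I) (by simp)
    rwa [Complex.I_im] at this
  have hs := (summable_pow_mul_pow_succ_mul_succ hr0.le hr1 a).mul_left (C * r⁻¹)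
  refine IsBigO.of_bound (∑' p : ℕ × ℕ, C * r⁻¹ * ((((p.1 + 1) * (p.2 + 1) : ℕ) : ℝ) ^ a *
    r ^ ((p.1 + 1) * (p.2 + 1)))) ?_
  filter_upwards [eventually_one_le_im] with τ hτ
  rw [pow_zero, one_mul]
  have hq : ‖cexp (2 * π * I * τ)‖ = Real.exp (-(2 * π * τ.im)) := norm_ee τ
  rw [hq, ← tsum_mul_right]
  refine tsum_of_norm_bounded (hs.mul_right _).hasSum fun p => ?_
  rw [norm_mul, norm_ee_mul]
  set x := Real.exp (-(2 * π * τ.im)) with hx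
  have hxr : x ≤ r := by
    rw [hx, hr]
    apply Real.exp_le_exp.mpr
    have := mul_le_mul_of_nonneg_left hτ (by positivity : 0 ≤ 2 * π)
    linarith
  have hx0 : 0 ≤ x := (Real.exp_pos _).le
  obtain ⟨M, hM⟩ : ∃ M, (p.1 + 1) * (p.2 + 1) = M + 1 :=
    ⟨(p.1 + 1) * (p.2 + 1) - 1, (Nat.succ_pred_eq_of_pos (by positivity)).symm⟩
  have hp := h p
  rw [hM] at hp ⊢
  -- One factor `x = |q|` is kept as the asserted rate; the other `M` are bounded by `r`, the value
  -- at `Im τ = 1`. This accounts for `r⁻¹` in the constant.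
  calc ‖c p‖ * x ^ (M + 1) ≤ (C * ((M + 1 : ℕ) : ℝ) ^ a) * (r ^ M * x) := by
        rw [pow_succ]
        gcongr
        exact (norm_nonneg _).trans hp
    _ = _ := by rw [pow_succ]; field_simp

theorem qser_const_mul (a : ℂ) (c : ℕ × ℕ → ℂ) (τ : ℂ) :
    qser (fun p => a * c p) τ = a * qser c τ := by
  rw [qser, qser, ← tsum_mul_left]
  exact tsum_congr fun p => by ring

theorem PolyBounded.const_mul {c : ℕ × ℕ → ℂ} (hc : PolyBounded c) (x : ℂ) :
    PolyBounded fun p => x * c p := by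
  obtain ⟨C, a, h⟩ := hc
  refine ⟨‖x‖ * C, a, fun p => ?_⟩
  rw [norm_mul, mul_assoc]
  gcongr
  exact h p

theorem PolyBounded.add {c d : ℕ × ℕ → ℂ} (hc : PolyBounded c) (hd : PolyBounded d) :
    PolyBounded fun p => c p + d p := by
  obtain ⟨C, a, h⟩ := hc
  obtain ⟨D, b, h'⟩ := hd
  refine ⟨|C| + |D|, max a b, fun p => ?_⟩
  have h1 : (1 : ℝ) ≤ (((p.1 + 1) * (p.2 + 1) : ℕ) : ℝ) := by
    exact_mod_cast Nat.succ_le_of_lt (by positivity)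
  refine (norm_add_le _ _).trans ?_
  rw [add_mul]
  refine add_le_add ((h p).trans ?_) ((h' p).trans ?_)
  · exact mul_le_mul (le_abs_self C) (pow_le_pow_right₀ h1 (le_max_left _ _)) (by positivity)
      (abs_nonneg _)
  · exact mul_le_mul (le_abs_self D) (pow_le_pow_right₀ h1 (le_max_right _ _)) (by positivity)
      (abs_nonneg _)

theorem polyBounded_zero : PolyBounded fun _ => 0 := ⟨0, 0, fun p => by simp⟩

theorem PolyBounded.sum {ι : Type*} (s : Finset ι) {c : ι → ℕ × ℕ → ℂ}
    (h : ∀ i ∈ s, PolyBounded (c i)) : PolyBounded fun p => ∑ i ∈ s, c i p := by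
  classical
  induction s using Finset.induction_on with
  | empty => simpa using polyBounded_zero
  | insert a s ha ih =>
    simp only [Finset.sum_insert ha]
    exact (h a (Finset.mem_insert_self _ _)).add
      (ih fun i hi => h i (Finset.mem_insert_of_mem hi))

theorem qser_add {c d : ℕ × ℕ → ℂ} (hc : PolyBounded c) (hd : PolyBounded d) (hτ : 0 < τ.im) :
    qser (fun p => c p + d p) τ = qser c τ + qser d τ := by
  rw [qser, qser, qser, ← (hc.summable hτ).tsum_add (hd.summable hτ)]
  exact tsum_congr fun p => by ring

theorem qser_sum {ι : Type*} (s : Finset ι) {c : ι → ℕ × ℕ → ℂ}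
    (h : ∀ i ∈ s, PolyBounded (c i)) (hτ : 0 < τ.im) :
    qser (fun p => ∑ i ∈ s, c i p) τ = ∑ i ∈ s, qser (c i) τ := by
  classical
  induction s using Finset.induction_on with
  | empty => simp [qser]
  | insert a s ha ih =>
    simp only [Finset.sum_insert ha]
    rw [qser_add (h a (Finset.mem_insert_self _ _))
      (PolyBounded.sum s fun i hi => h i (Finset.mem_insert_of_mem hi)) hτ,
      ih fun i hi => h i (Finset.mem_insert_of_mem hi)]

/-- The coefficients `k^a m^(-b)`. -/
noncomputable def sCoeff (a b : ℕ) (p : ℕ × ℕ) : ℂ := ((p.2 : ℂ) + 1) ^ a / ((p.1 : ℂ) + 1) ^ b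

theorem polyBounded_sCoeff (a b : ℕ) : PolyBounded (sCoeff a b) := by
  refine ⟨1, a, fun p => ?_⟩
  have h1 : ∀ n : ℕ, ‖(n : ℂ) + 1‖ = n + 1 := fun n => by
    rw [← Nat.cast_add_one, Complex.norm_natCast]; push_cast; rfl
  rw [sCoeff, norm_div, norm_pow, norm_pow, h1, h1, one_mul]
  push_cast
  rw [mul_pow]
  have h2 : (1 : ℝ) ≤ (p.1 + 1 : ℝ) := by
    have : (0 : ℝ) ≤ p.1 := Nat.cast_nonneg _
    linarith
  calc ((p.2 : ℝ) + 1) ^ a / ((p.1 : ℝ) + 1) ^ b ≤ ((p.2 : ℝ) + 1) ^ a :=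
        div_le_self (by positivity) (one_le_pow₀ h2)
    _ ≤ ((p.1 : ℝ) + 1) ^ a * ((p.2 : ℝ) + 1) ^ a :=
        le_mul_of_one_le_left (by positivity) (one_le_pow₀ h2)

/-- The series `S_{a,b}(τ) = ∑_{m,k ≥ 1} k^a m^(-b) q^(mk)`. -/
noncomputable def sSer (a b : ℕ) : ℂ → ℂ := qser (sCoeff a b)

theorem isExpSmall_sSer (a b : ℕ) : IsExpSmall (sSer a b) := (polyBounded_sCoeff a b).isExpSmall

/-! ### Uniqueness of regularized values -/

theorem log_neg_two_pi_I_mul {ε : ℝ} (hε : 0 < ε) :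
    Complex.log (-2 * π * I * ε) = Real.log ε + Complex.log (-(2 * π * I)) := by
  rw [← Complex.log_ofReal_mul hε (by simp [Real.pi_ne_zero])]
  congr 1; ring

theorem tendsto_norm_log_atTop :
    Tendsto (fun ε : ℝ => ‖Complex.log (-2 * π * I * ε)‖) (𝓝[>] 0) atTop := by
  have h1 : Tendsto (fun ε : ℝ => -Real.log ε - ‖Complex.log (-(2 * π * I))‖) (𝓝[>] 0) atTop :=
    tendsto_atTop_add_const_right _ _ (tendsto_neg_atBot_atTop.comp Real.tendsto_log_nhdsGT_zero)
  refine tendsto_atTop_mono' _ ?_ h1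
  filter_upwards [self_mem_nhdsWithin] with ε hε
  rw [log_neg_two_pi_I_mul hε]
  have h2 := norm_sub_norm_le (Real.log ε : ℂ) (-Complex.log (-(2 * π * I)))
  rw [norm_neg, sub_neg_eq_add, Complex.norm_real] at h2
  have := neg_le_abs (Real.log ε)
  rw [← Real.norm_eq_abs] at this
  linarith

theorem tendsto_rpow_nhdsGT_zero {ν : ℝ} (hν : 0 < ν) :
    Tendsto (fun ε : ℝ => ε ^ ν) (𝓝[>] 0) (𝓝 0) := by
  have := (Real.continuousAt_rpow_const 0 ν (Or.inr hν.le)).tendsto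
  rw [Real.zero_rpow hν.ne'] at this
  exact this.mono_left nhdsWithin_le_nhds

/-- The difference of two expansions is a polynomial in `log(-2πiε)` that tends to `0` while its
argument is unbounded in norm. Such a polynomial is constant, hence zero. -/
theorem IsRegValue.unique {r : ℕ} {J : ℝ → ℂ} {a b : ℂ} (ha : IsRegValue r J a)
    (hb : IsRegValue r J b) : a = b := by
  obtain ⟨c, hc, ν, hν, h⟩ := ha
  obtain ⟨d, hd, μ, hμ, h'⟩ := hb
  have h0 := (h'.trans_tendsto (tendsto_rpow_nhdsGT_zero hμ)).sub
    (h.trans_tendsto (tendsto_rpow_nhdsGT_zero hν))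
  rw [sub_zero] at h0
  set P : Polynomial ℂ := ∑ k ∈ Finset.range (r + 1), Polynomial.C (c k - d k) * Polynomial.X ^ k
    with hP
  have hev : ∀ x, P.eval x = ∑ k ∈ Finset.range (r + 1), (c k - d k) * x ^ k := by
    intro x; rw [hP, Polynomial.eval_finsetSum]; simp
  have h1 : Tendsto (fun ε : ℝ => P.eval (Complex.log (-2 * π * I * ε))) (𝓝[>] 0) (𝓝 0) := by
    refine h0.congr fun ε => ?_
    rw [hev]
    simp only [sub_mul, Finset.sum_sub_distrib]
    ring
  have hcoeff : P.coeff 0 = a - b := by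
    rw [hP, Polynomial.finsetSum_coeff]
    simp [Polynomial.coeff_X_pow, hc, hd]
  have hdeg : P.degree ≤ 0 := by
    by_contra hd
    have := P.tendsto_norm_atTop (not_le.mp hd) tendsto_norm_log_atTop
    exact not_tendsto_nhds_of_tendsto_atTop this _ h1.norm
  rw [Polynomial.eq_C_of_degree_le_zero hdeg] at h1
  simp only [Polynomial.eval_C] at h1
  have := tendsto_nhds_unique h1 tendsto_const_nhds
  rw [hcoeff] at this
  exact sub_eq_zero.mp this.symm

theorem IsRegValue.regValue_eq {r : ℕ} {J : ℝ → ℂ} {a : ℂ} (ha : IsRegValue r J a) :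
    regValue r J = a := by
  have h : ∃ a, IsRegValue r J a := ⟨a, ha⟩
  rw [regValue, dif_pos h]
  exact h.choose_spec.unique ha

/-! ### Logarithmic asymptotics -/

/-- `J(ε) = c₀ + c₁ log ε + O(ε^(1/2))` as `ε → 0⁺`. -/
def LogAsymp (J : ℝ → ℂ) (c₀ c₁ : ℂ) : Prop :=
  (fun ε => J ε - (c₀ + c₁ * Real.log ε)) =O[𝓝[>] 0] fun ε : ℝ => ε ^ (1 / 2 : ℝ)

theorem LogAsymp.add {J K : ℝ → ℂ} {a b c d : ℂ} (h : LogAsymp J a b) (h' : LogAsymp K c d) :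
    LogAsymp (fun ε => J ε + K ε) (a + c) (b + d) :=
  (IsBigO.add h h').congr_left fun ε => by ring

theorem LogAsymp.const_mul {J : ℝ → ℂ} {a b : ℂ} (h : LogAsymp J a b) (x : ℂ) :
    LogAsymp (fun ε => x * J ε) (x * a) (x * b) :=
  (h.const_mul_left x).congr_left fun ε => by ring

theorem LogAsymp.congr {J K : ℝ → ℂ} {a b : ℂ} (h : LogAsymp J a b)
    (hJK : ∀ ε : ℝ, 0 < ε → ε < 1 / 2 → J ε = K ε) : LogAsymp K a b := by
  refine h.congr' ?_ EventuallyEq.rfl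
  filter_upwards [Ioo_mem_nhdsGT (show (0 : ℝ) < 1 / 2 by norm_num)] with ε hε
  rw [hJK ε hε.1 hε.2]

theorem isBigO_id_sqrt : (fun ε : ℝ => ε) =O[𝓝[>] 0] fun ε : ℝ => ε ^ (1 / 2 : ℝ) := by
  refine IsBigO.of_bound 1 ?_
  filter_upwards [Ioo_mem_nhdsGT (show (0 : ℝ) < 1 by norm_num)] with ε hε
  rw [one_mul, Real.norm_of_nonneg hε.1.le, Real.norm_of_nonneg (Real.rpow_nonneg hε.1.le _)]
  simpa using Real.rpow_le_rpow_of_exponent_ge hε.1 hε.2.le (show (1 / 2 : ℝ) ≤ 1 by norm_num)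

/-- Substitution of `log ε = log(-2πiε) - log(-2πi)`. In depth one only the first power of the
logarithm occurs, whatever the length `r` is. -/
theorem LogAsymp.isRegValue {J : ℝ → ℂ} {a b : ℂ} (h : LogAsymp J a b) {r : ℕ} (hr : 1 ≤ r) :
    IsRegValue r J (a - b * Complex.log (-(2 * π * I))) := by
  refine ⟨fun k => if k = 0 then a - b * Complex.log (-(2 * π * I)) else if k = 1 then b else 0,
    rfl, 1 / 2, by norm_num, ?_⟩
  refine h.congr' ?_ EventuallyEq.rfl
  filter_upwards [self_mem_nhdsWithin] with ε hε
  have h1 : Finset.range 2 ⊆ Finset.range (r + 1) := Finset.range_subset_range.mpr (by omega)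
  rw [← Finset.sum_subset h1, Finset.sum_range_succ, Finset.sum_range_one, log_neg_two_pi_I_mul hε]
  · simp only [if_true, one_ne_zero, if_false, pow_zero, pow_one]
    ring
  · intro k _ hk
    have : 1 < k := by simpa using hk
    simp [show k ≠ 0 by omega, show k ≠ 1 by omega]

theorem integrableOn_of_continuousOn_bounded {g : ℝ → ℂ} {M : ℝ}
    (hg : ContinuousOn g (Set.Ioo 0 1)) (hM : ∀ t ∈ Set.Ioo (0 : ℝ) 1, ‖g t‖ ≤ M) :
    IntervalIntegrable g MeasureTheory.volume 0 1 := by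
  rw [intervalIntegrable_iff_integrableOn_Ioo_of_le zero_le_one]
  exact MeasureTheory.IntegrableOn.of_bound (by simp) (hg.aestronglyMeasurable measurableSet_Ioo) M
    ((MeasureTheory.ae_restrict_mem measurableSet_Ioo).mono hM)

theorem logAsymp_of_bounded {g : ℝ → ℂ} {M : ℝ} (hg : ContinuousOn g (Set.Ioo 0 1))
    (hM : ∀ t ∈ Set.Ioo (0 : ℝ) 1, ‖g t‖ ≤ M) :
    LogAsymp (fun ε => ∫ t in ε..1 - ε, g t) (∫ t in (0 : ℝ)..1, g t) 0 := by
  refine IsBigO.trans ?_ isBigO_id_sqrt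
  refine IsBigO.of_bound (2 * M) ?_
  filter_upwards [Ioo_mem_nhdsGT (show (0 : ℝ) < 1 / 2 by norm_num)] with ε hε
  obtain ⟨h0, h1⟩ := hε
  have hi := integrableOn_of_continuousOn_bounded hg hM
  have hsub : ∀ a b : ℝ, a ∈ Set.Icc (0 : ℝ) 1 → b ∈ Set.Icc (0 : ℝ) 1 →
      IntervalIntegrable g MeasureTheory.volume a b := fun a b ha hb =>
    hi.mono_set (by
      rw [Set.uIcc_of_le (zero_le_one' ℝ)]
      exact Set.uIcc_subset_Icc ha hb)
  have m0 : (0 : ℝ) ∈ Set.Icc (0 : ℝ) 1 := by simp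
  have m1 : (1 : ℝ) ∈ Set.Icc (0 : ℝ) 1 := by simp
  have me : ε ∈ Set.Icc (0 : ℝ) 1 := ⟨by linarith, by linarith⟩
  have me' : 1 - ε ∈ Set.Icc (0 : ℝ) 1 := ⟨by linarith, by linarith⟩
  have e1 := intervalIntegral.integral_add_adjacent_intervals (hsub _ _ m0 me) (hsub _ _ me me')
  have e2 := intervalIntegral.integral_add_adjacent_intervals (hsub _ _ m0 me') (hsub _ _ me' m1)
  -- The bound on `g` holds on the open interval only, so the endpoint of `(1-ε, 1]` has to be
  -- discarded as a null set.
  have hne : ∀ᵐ t : ℝ, t ≠ 1 := by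
    simp [MeasureTheory.ae_iff]
  have b1 : ‖∫ t in (0 : ℝ)..ε, g t‖ ≤ M * |ε - 0| := by
    refine intervalIntegral.norm_integral_le_of_norm_le_const fun t ht => ?_
    rw [Set.uIoc_of_le h0.le] at ht
    exact hM t ⟨ht.1, by linarith [ht.2]⟩
  have b2 : ‖∫ t in (1 - ε)..1, g t‖ ≤ M * |1 - (1 - ε)| := by
    refine intervalIntegral.norm_integral_le_of_norm_le_const_ae ?_
    filter_upwards [hne] with t ht1 ht
    rw [Set.uIoc_of_le (by linarith)] at ht
    exact hM t ⟨by linarith [ht.1], lt_of_le_of_ne ht.2 ht1⟩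
  rw [sub_zero, abs_of_pos h0] at b1
  rw [sub_sub_cancel, abs_of_pos h0] at b2
  rw [Real.norm_of_nonneg h0.le, zero_mul, add_zero, ← e2, ← e1]
  rw [show (∫ t in ε..1 - ε, g t) - ((∫ t in (0 : ℝ)..ε, g t) + (∫ t in ε..1 - ε, g t) +
    ∫ t in (1 - ε)..1, g t) = -((∫ t in (0 : ℝ)..ε, g t) + ∫ t in (1 - ε)..1, g t) by ring, norm_neg]
  refine (norm_add_le _ _).trans ?_
  linarith

theorem integral_one_div_trunc {ε : ℝ} (h0 : 0 < ε) (h1 : ε < 1 / 2) :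
    ∫ t in ε..1 - ε, (1 / t : ℝ) = Real.log (1 - ε) - Real.log ε := by
  rw [integral_one_div_of_pos h0 (by linarith), Real.log_div (by linarith) h0.ne']

theorem integral_one_div_one_sub_trunc {ε : ℝ} (h0 : 0 < ε) (h1 : ε < 1 / 2) :
    ∫ t in ε..1 - ε, (1 / (1 - t) : ℝ) = Real.log (1 - ε) - Real.log ε := by
  rw [intervalIntegral.integral_comp_sub_left (fun t : ℝ => 1 / t) 1, sub_sub_cancel,
    integral_one_div_trunc h0 h1]

theorem logAsymp_log_one_sub :
    LogAsymp (fun ε => ((Real.log (1 - ε) - Real.log ε : ℝ) : ℂ)) 0 (-1) := by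
  refine IsBigO.trans ?_ isBigO_id_sqrt
  refine IsBigO.of_bound 2 ?_
  filter_upwards [Ioo_mem_nhdsGT (show (0 : ℝ) < 1 / 2 by norm_num)] with ε hε
  obtain ⟨h0, h1⟩ := hε
  have : ((Real.log (1 - ε) - Real.log ε : ℝ) : ℂ) - (0 + -1 * (Real.log ε : ℂ)) =
      (Real.log (1 - ε) : ℂ) := by push_cast; ring
  rw [this, Complex.norm_real, Real.norm_of_nonneg h0.le, Real.norm_eq_abs, abs_le]
  constructor
  · have := Real.one_sub_inv_le_log_of_pos (show 0 < 1 - ε by linarith)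
    have h2 : (1 - ε)⁻¹ ≤ 1 + 2 * ε := by
      rw [inv_le_iff_one_le_mul₀ (by linarith)]
      nlinarith
    linarith
  · have := Real.log_nonpos (show 0 ≤ 1 - ε by linarith) (by linarith)
    linarith

theorem logAsymp_inv : LogAsymp (fun ε => ∫ t in ε..1 - ε, (1 / t : ℂ)) 0 (-1) :=
  logAsymp_log_one_sub.congr fun ε h0 h1 => by
    rw [← integral_one_div_trunc h0 h1, ← intervalIntegral.integral_ofReal]
    simp

theorem logAsymp_inv_one_sub : LogAsymp (fun ε => ∫ t in ε..1 - ε, (1 / (1 - t) : ℂ)) 0 (-1) :=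
  logAsymp_log_one_sub.congr fun ε h0 h1 => by
    rw [← integral_one_div_one_sub_trunc h0 h1, ← intervalIntegral.integral_ofReal]
    simp

/-! ### Truncated iterated integrals of depth one -/

/-- The inner integrations of the constant `ω_0` produce the volume of a simplex, whose lower vertex
still depends on the cutoff. -/
theorem iterInt_replicate (c : ℂ) (m : ℕ) (a t : ℝ) :
    iterInt (List.replicate m fun _ => c) a t = c ^ m * ((t : ℂ) - a) ^ m / m.factorial := by
  induction m generalizing t with
  | zero => simp [iterInt]
  | succ m ih =>
    rw [List.replicate_succ, iterInt]
    simp only [ih]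
    have h1 : ∀ x : ℝ, c * (c ^ m * ((x : ℂ) - a) ^ m / (m.factorial : ℂ)) =
        c ^ (m + 1) / m.factorial * (((x - a : ℝ) : ℂ) ^ m) := by
      intro x; push_cast; ring
    simp only [h1]
    rw [intervalIntegral.integral_const_mul,
      intervalIntegral.integral_comp_sub_right (fun x : ℝ => (x : ℂ) ^ m) a, sub_self]
    have h2 : ∫ x in (0 : ℝ)..t - a, (x : ℂ) ^ m = ((t : ℂ) - a) ^ (m + 1) / (m + 1) := by
      have := integral_pow (a := 0) (b := t - a) m
      have h3 : ∫ x in (0 : ℝ)..t - a, (x : ℂ) ^ m = ((∫ x in (0 : ℝ)..t - a, x ^ m : ℝ) : ℂ) := by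
        rw [← intervalIntegral.integral_ofReal]; simp
      rw [h3, this]
      push_cast
      simp
    rw [h2, Nat.factorial_succ]
    have hm : (m.factorial : ℂ) ≠ 0 := by exact_mod_cast m.factorial_ne_zero
    have hm1 : (m : ℂ) + 1 ≠ 0 := by exact_mod_cast m.succ_ne_zero
    push_cast
    field_simp

theorem norm_sub_pow_sub_pow_le {ε t : ℝ} (h0 : 0 ≤ ε) (ht : ε ≤ t) (h1 : t ≤ 1) (m : ℕ) :
    ‖((t : ℂ) - ε) ^ m - (t : ℂ) ^ m‖ ≤ m * ε := by
  have hn1 : ‖(t : ℂ) - ε‖ ≤ 1 := by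
    rw [← Complex.ofReal_sub, Complex.norm_real, Real.norm_of_nonneg (by linarith)]; linarith
  have hn2 : ‖(t : ℂ)‖ ≤ 1 := by
    rw [Complex.norm_real, Real.norm_of_nonneg (by linarith)]; linarith
  induction m with
  | zero => simp
  | succ m ih =>
    have : ((t : ℂ) - ε) ^ (m + 1) - (t : ℂ) ^ (m + 1) =
        (((t : ℂ) - ε) ^ m - (t : ℂ) ^ m) * ((t : ℂ) - ε) - (t : ℂ) ^ m * ε := by ring
    rw [this]
    refine (norm_sub_le _ _).trans ?_
    rw [norm_mul, norm_mul, norm_pow, Complex.norm_real ε, Real.norm_of_nonneg h0]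
    have h2 : ‖((t : ℂ) - ε) ^ m - (t : ℂ) ^ m‖ * ‖(t : ℂ) - ε‖ ≤ m * ε * 1 :=
      mul_le_mul ih hn1 (norm_nonneg _) (by positivity)
    have h3 : ‖(t : ℂ)‖ ^ m * ε ≤ 1 * ε :=
      mul_le_mul_of_nonneg_right (pow_le_one₀ (norm_nonneg _) hn2) h0
    push_cast
    linarith

/-- Errors of size `ε log(1/ε)` arise from the cutoff inside the weight; bounding them by a multiple
of `ε^(1/2)` is the reason for the exponent chosen in `LogAsymp`. -/
theorem log_le_inv_sqrt {ε : ℝ} (h0 : 0 < ε) (h1 : ε < 1 / 2) :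
    ε * (Real.log (1 - ε) - Real.log ε) ≤ 2 * ε ^ (1 / 2 : ℝ) := by
  have h2 : Real.log (1 - ε) ≤ 0 := Real.log_nonpos (by linarith) (by linarith)
  have h3 := Real.log_le_rpow_div (x := ε⁻¹) (by positivity) (show (0 : ℝ) < 1 / 2 by norm_num)
  rw [Real.log_inv, Real.inv_rpow h0.le] at h3
  have h4 : ε * (ε ^ (1 / 2 : ℝ))⁻¹ = ε ^ (1 / 2 : ℝ) := by
    rw [← Real.rpow_neg h0.le]
    nth_rewrite 1 [← Real.rpow_one ε]
    rw [← Real.rpow_add h0]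
    norm_num
  have h5 : ε * (Real.log (1 - ε) - Real.log ε) ≤ ε * ((ε ^ (1 / 2 : ℝ))⁻¹ / (1 / 2)) := by
    apply mul_le_mul_of_nonneg_left _ h0.le
    linarith
  calc _ ≤ _ := h5
    _ = 2 * (ε * (ε ^ (1 / 2 : ℝ))⁻¹) := by ring
    _ = _ := by rw [h4]

/-- In the truncated integral the weight `(t - ε)^m` may be replaced by `t^m`. -/
theorem logAsymp_shift {h : ℝ → ℂ} {C : ℝ} {m : ℕ} {c₀ c₁ : ℂ}
    (hc : ContinuousOn h (Set.Ioo 0 1))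
    (hC : ∀ t ∈ Set.Ioo (0 : ℝ) 1, ‖h t‖ ≤ C * (1 / t + 1 / (1 - t)))
    (H : LogAsymp (fun ε => ∫ t in ε..1 - ε, h t * (t : ℂ) ^ m) c₀ c₁) :
    LogAsymp (fun ε => ∫ t in ε..1 - ε, h t * ((t : ℂ) - ε) ^ m) c₀ c₁ := by
  have hd : (fun ε : ℝ => (∫ t in ε..1 - ε, h t * ((t : ℂ) - ε) ^ m) -
      ∫ t in ε..1 - ε, h t * (t : ℂ) ^ m) =O[𝓝[>] 0] fun ε : ℝ => ε ^ (1 / 2 : ℝ) := by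
    -- Each of the two poles integrates to `log(1-ε) - log ε`, and `ε` times this is at most `2
    -- ε^(1/2)`.
    refine IsBigO.of_bound (4 * (C * m)) ?_
    filter_upwards [Ioo_mem_nhdsGT (show (0 : ℝ) < 1 / 2 by norm_num)] with ε hε
    obtain ⟨h0, h1⟩ := hε
    have hle : ε ≤ 1 - ε := by linarith
    have hsub : Set.uIcc ε (1 - ε) ⊆ Set.Ioo 0 1 := by
      rw [Set.uIcc_of_le hle]
      exact fun t ht => ⟨by linarith [ht.1], by linarith [ht.2]⟩
    have hc' := hc.mono hsub
    have hcR : ContinuousOn (fun t : ℝ => 1 / t) (Set.uIcc ε (1 - ε)) :=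
      continuousOn_const.div continuousOn_id fun t ht => (hsub ht).1.ne'
    have hcR' : ContinuousOn (fun t : ℝ => 1 / (1 - t)) (Set.uIcc ε (1 - ε)) :=
      continuousOn_const.div (by fun_prop) fun t ht => (sub_pos.mpr (hsub ht).2).ne'
    rw [← intervalIntegral.integral_sub]
    · have hb : ‖∫ t in ε..1 - ε, (h t * ((t : ℂ) - ε) ^ m - h t * (t : ℂ) ^ m)‖ ≤
          ∫ t in ε..1 - ε, C * m * ε * (1 / t + 1 / (1 - t)) := by
        refine intervalIntegral.norm_integral_le_of_norm_le hle ?_ ?_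
        · refine Filter.Eventually.of_forall fun t ht => ?_
          have ht' : t ∈ Set.Ioo (0 : ℝ) 1 := ⟨by linarith [ht.1], by linarith [ht.2]⟩
          rw [← mul_sub, norm_mul]
          have := mul_le_mul (hC t ht') (norm_sub_pow_sub_pow_le h0.le ht.1.le ht'.2.le m)
            (norm_nonneg _) ((norm_nonneg _).trans (hC t ht'))
          linarith
        · exact ((hcR.add hcR').const_smul (C * m * ε)).intervalIntegrable
      refine hb.trans ?_
      rw [intervalIntegral.integral_const_mul, intervalIntegral.integral_add
        hcR.intervalIntegrable hcR'.intervalIntegrable, integral_one_div_trunc h0 h1,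
        integral_one_div_one_sub_trunc h0 h1, Real.norm_of_nonneg (Real.rpow_nonneg h0.le _)]
      have hC0 : 0 ≤ C := by
        have h2 := (norm_nonneg _).trans (hC (1 / 2) ⟨by norm_num, by norm_num⟩)
        norm_num at h2
        linarith
      have h2 := mul_le_mul_of_nonneg_left (log_le_inv_sqrt h0 h1)
        (mul_nonneg hC0 (Nat.cast_nonneg m) : 0 ≤ C * (m : ℝ))
      linarith
    · exact (hc'.mul (by fun_prop)).intervalIntegrable
    · exact (hc'.mul (by fun_prop)).intervalIntegrable
  exact (IsBigO.add hd H).congr_left fun ε => by ring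

/-- Regularized values of depth-one truncated iterated integrals. -/
theorem isRegValue_iterInt {f h : ℝ → ℂ} {C : ℝ} {m : ℕ} {c c₀ c₁ : ℂ}
    (hf : ∀ t ∈ Set.Ioo (0 : ℝ) 1, f t = h t)
    (hc : ContinuousOn h (Set.Ioo 0 1))
    (hC : ∀ t ∈ Set.Ioo (0 : ℝ) 1, ‖h t‖ ≤ C * (1 / t + 1 / (1 - t)))
    (H : LogAsymp (fun ε => ∫ t in ε..1 - ε, h t * (t : ℂ) ^ m) c₀ c₁) (x : ℂ) :
    IsRegValue (m + 1)
      (fun ε => x * iterInt (f :: List.replicate m fun _ => c) ε (1 - ε))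
      (x * c ^ m / m.factorial * (c₀ - c₁ * Complex.log (-(2 * π * I)))) := by
  have h1 := ((logAsymp_shift hc hC H).const_mul (x * c ^ m / m.factorial)).congr
    (K := fun ε => x * iterInt (f :: List.replicate m fun _ => c) ε (1 - ε)) (by
      intro ε h0 h1
      rw [iterInt, mul_div_assoc, mul_assoc, ← intervalIntegral.integral_const_mul]
      congr 1
      refine intervalIntegral.integral_congr fun t ht => ?_
      rw [Set.uIcc_of_le (by linarith)] at ht
      simp only [iterInt_replicate]
      rw [hf t ⟨by linarith [ht.1], by linarith [ht.2]⟩]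
      ring)
  convert h1.isRegValue (Nat.le_add_left 1 m) using 1
  ring

/-! ### Elementary integrals -/

/-- The boundary contribution at `1` in the integration by parts of `∫₀¹ t^m e^(ct) dt`. -/
noncomputable def bdry (m : ℕ) (c : ℂ) : ℂ :=
  ∑ s ∈ Finset.range (m + 1), (m.descFactorial s : ℂ) * (-1) ^ s / c ^ (s + 1)

theorem bdry_succ (m : ℕ) (c : ℂ) : bdry (m + 1) c = 1 / c - (m + 1) / c * bdry m c := by
  rw [bdry, Finset.sum_range_succ', bdry, Finset.mul_sum]
  rw [add_comm, sub_eq_add_neg, ← Finset.sum_neg_distrib]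
  congr 1
  · simp
  · refine Finset.sum_congr rfl fun s _ => ?_
    rw [Nat.succ_descFactorial_succ]
    push_cast
    rw [pow_succ _ (s + 1)]
    field_simp
    ring

theorem integral_pow_mul_cexp (m : ℕ) {c : ℂ} (hc : c ≠ 0) :
    ∫ t in (0 : ℝ)..1, (t : ℂ) ^ m * cexp (c * t) =
      cexp c * bdry m c - (-1) ^ m * m.factorial / c ^ (m + 1) := by
  induction m with
  | zero =>
    have := integral_exp_mul_complex (a := 0) (b := 1) hc
    simp only [pow_zero, one_mul]
    rw [this]
    simp [bdry]
    ring
  | succ m ih =>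
    have hu : ∀ x ∈ Set.uIcc (0 : ℝ) 1, HasDerivAt (fun t : ℝ => (t : ℂ) ^ (m + 1))
        ((m + 1) * (x : ℂ) ^ m) x := by
      intro x _
      have := (hasDerivAt_pow (m + 1) (x : ℂ)).comp_ofReal
      simpa using this
    have hv : ∀ x ∈ Set.uIcc (0 : ℝ) 1, HasDerivAt (fun t : ℝ => cexp (c * t) / c)
        (cexp (c * x)) x := by
      intro x _
      have h1 := (((hasDerivAt_id (x : ℂ)).const_mul c).cexp.div_const c).comp_ofReal
      simp only [mul_one] at h1
      rw [mul_div_assoc, div_self hc, mul_one] at h1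
      exact h1
    have := intervalIntegral.integral_mul_deriv_eq_deriv_mul hu hv
      (by apply Continuous.intervalIntegrable; fun_prop)
      (by apply Continuous.intervalIntegrable; fun_prop)
    rw [this]
    have h2 : ∀ x : ℝ, ((m : ℂ) + 1) * (x : ℂ) ^ m * (cexp (c * x) / c) =
        (m + 1) / c * ((x : ℂ) ^ m * cexp (c * x)) := by intro x; ring
    simp only [h2]
    rw [intervalIntegral.integral_const_mul, ih, bdry_succ, Nat.factorial_succ]
    push_cast
    simp
    field_simp
    ring

/-! ### Boundedness on the unit interval -/

theorem bounded_of_bounded_near {g : ℝ → ℂ} (hg : ContinuousOn g (Set.Ioo 0 1)) {δ M : ℝ}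
    (hδ : 0 < δ) (h0 : ∀ t : ℝ, 0 < t → t < δ → ‖g t‖ ≤ M)
    (h1 : ∀ t : ℝ, 1 - δ < t → t < 1 → ‖g t‖ ≤ M) :
    ∃ M', ∀ t ∈ Set.Ioo (0 : ℝ) 1, ‖g t‖ ≤ M' := by
  set d := min (δ / 2) (1 / 4) with hd
  have hd0 : 0 < d := by simp only [hd, lt_min_iff]; exact ⟨by linarith, by norm_num⟩
  have hd1 : d ≤ δ / 2 := min_le_left _ _
  have hd2 : d ≤ 1 / 4 := min_le_right _ _
  have hsub : Set.Icc d (1 - d) ⊆ Set.Ioo (0 : ℝ) 1 :=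
    fun t ht => ⟨by linarith [ht.1], by linarith [ht.2]⟩
  obtain ⟨C, hC⟩ := isCompact_Icc.exists_bound_of_continuousOn (hg.mono hsub)
  refine ⟨max M C, fun t ht => ?_⟩
  by_cases h2 : t < d
  · exact (h0 t ht.1 (by linarith)).trans (le_max_left _ _)
  · by_cases h3 : 1 - d < t
    · exact (h1 t (by linarith) ht.2).trans (le_max_left _ _)
    · exact (hC t ⟨not_lt.mp h2, not_lt.mp h3⟩).trans (le_max_right _ _)

/-- Up to the factor `-1/(2πi)` this is the difference quotient of `todd` at `0`, which extends
continuously because `todd` is analytic. -/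
theorem one_div_one_sub_ee_bounded : ∃ δ > (0 : ℝ), ∃ M : ℝ, ∀ α : ℂ, α ≠ 0 → ‖α‖ < δ →
    ‖1 / (1 - ee α) + 1 / (2 * π * I * α)‖ ≤ M := by
  have hpi : (2 * π * I : ℂ) ≠ 0 := by simp [Real.pi_ne_zero]
  have hc : ContinuousAt (dslope todd 0) 0 :=
    continuousAt_dslope_same.mpr analyticAt_todd.differentiableAt
  have hb : ∀ᶠ α in 𝓝 (0 : ℂ), ‖dslope todd 0 α‖ < ‖dslope todd 0 0‖ + 1 :=
    hc.norm.eventually_lt_const (lt_add_one _)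
  have h2 := eventually_ee_ne_one
  rw [eventually_nhdsWithin_iff] at h2
  obtain ⟨δ, hδ, h⟩ := Metric.eventually_nhds_iff.mp (hb.and h2)
  refine ⟨δ, hδ, (‖dslope todd 0 0‖ + 1) / ‖2 * (π : ℂ) * I‖, fun α hα0 hα => ?_⟩
  obtain ⟨h3, h4⟩ := h (by simpa using hα)
  have h5 : 1 - ee α ≠ 0 := sub_ne_zero.mpr (h4 hα0).symm
  have h7 : ee α - 1 ≠ 0 := sub_ne_zero.mpr (h4 hα0)
  have h6 : 1 / (1 - ee α) + 1 / (2 * π * I * α) = -(dslope todd 0 α / (2 * π * I)) := by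
    rw [dslope_of_ne _ hα0, slope_def_field, todd_zero, todd_of_ne hα0,
      show 1 - ee α = -(ee α - 1) by ring]
    field_simp
    ring
  rw [h6, norm_neg, norm_div]
  gcongr

theorem one_le_inv_add_inv {t : ℝ} (ht : t ∈ Set.Ioo (0 : ℝ) 1) : 1 ≤ 1 / t + 1 / (1 - t) := by
  have h1 : 1 ≤ 1 / t := by rw [le_div_iff₀ ht.1]; linarith [ht.2]
  have h2 : 0 ≤ 1 / (1 - t) := by
    have := sub_pos.mpr ht.2
    positivity
  linarith

theorem norm_le_of_poles {g : ℝ → ℂ} {M : ℝ} (a b : ℂ)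
    (hM : ∀ t ∈ Set.Ioo (0 : ℝ) 1, ‖g t‖ ≤ M) :
    ∀ t ∈ Set.Ioo (0 : ℝ) 1, ‖g t + a * (1 / t) + b * (1 / (1 - t))‖ ≤
      (M + ‖a‖ + ‖b‖) * (1 / t + 1 / (1 - t)) := by
  intro t ht
  have h0 := ht.1
  have h1 := sub_pos.mpr ht.2
  have e1 : ‖(1 / t : ℂ)‖ = 1 / t := by
    rw [norm_div, norm_one, Complex.norm_real, Real.norm_of_nonneg h0.le]
  have e2 : ‖(1 / (1 - t) : ℂ)‖ = 1 / (1 - t) := by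
    rw [norm_div, norm_one, ← Complex.ofReal_one, ← Complex.ofReal_sub, Complex.norm_real,
      Real.norm_of_nonneg h1.le]
  have h2 := one_le_inv_add_inv ht
  have hM0 : 0 ≤ M := (norm_nonneg _).trans (hM t ht)
  have p0 : 0 ≤ 1 / t := by positivity
  have p1 : 0 ≤ 1 / (1 - t) := by positivity
  calc _ ≤ ‖g t‖ + ‖a‖ * (1 / t) + ‖b‖ * (1 / (1 - t)) := by
        refine (norm_add_le _ _).trans (add_le_add ((norm_add_le _ _).trans ?_) ?_)
        · rw [norm_mul, e1]
        · rw [norm_mul, e2]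
    _ ≤ M * (1 / t + 1 / (1 - t)) + ‖a‖ * (1 / t + 1 / (1 - t)) +
        ‖b‖ * (1 / t + 1 / (1 - t)) := by
      have := le_mul_of_one_le_right hM0 h2
      gcongr
      · exact (hM t ht).trans this
      · linarith
      · linarith
    _ = _ := by ring

theorem ee_ofReal_ne_one {t : ℝ} (ht : t ∈ Set.Ioo (0 : ℝ) 1) : ee t ≠ 1 := by
  intro h
  rw [ee, Complex.exp_eq_one_iff] at h
  obtain ⟨n, hn⟩ := h
  have hpi : (2 * π * I : ℂ) ≠ 0 := by simp [Real.pi_ne_zero]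
  rw [mul_comm] at hn
  have h1 : (t : ℂ) = n := mul_right_cancel₀ hpi hn
  have h2 : t = n := by exact_mod_cast h1
  have h3 : (0 : ℝ) < n := h2 ▸ ht.1
  have h4 : (n : ℝ) < 1 := h2 ▸ ht.2
  have h5 : (0 : ℤ) < n := by exact_mod_cast h3
  have h6 : n < (1 : ℤ) := by exact_mod_cast h4
  omega

/-- The cotangent-like kernel minus its poles at the two ends of the unit interval is bounded. -/
theorem cot_kernel_bounded : ∃ M : ℝ, ∀ t ∈ Set.Ioo (0 : ℝ) 1,
    ‖ee t / (1 - ee t) + 1 / (2 * π * I) * (1 / t) - 1 / (2 * π * I) * (1 / (1 - t))‖ ≤ M := by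
  have hpi : (2 * π * I : ℂ) ≠ 0 := by simp [Real.pi_ne_zero]
  obtain ⟨δ, hδ, M, hM⟩ := one_div_one_sub_ee_bounded
  have hM0 : 0 ≤ M := (norm_nonneg _).trans (hM (δ / 2 : ℝ) (by exact_mod_cast (half_pos hδ).ne')
    (by rw [Complex.norm_real, Real.norm_of_nonneg (half_pos hδ).le]; linarith))
  set d := min δ (1 / 2) with hd
  have hd0 : 0 < d := lt_min hδ (by norm_num)
  have hd1 : d ≤ δ := min_le_left _ _
  have hd2 : d ≤ 1 / 2 := min_le_right _ _
  have hk : ‖(1 / (2 * π * I) : ℂ)‖ ≤ 1 := by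
    rw [norm_div, norm_one, norm_mul, norm_mul, Complex.norm_I, Complex.norm_real,
      Real.norm_of_nonneg Real.pi_pos.le, Complex.norm_ofNat, mul_one,
      div_le_one (by positivity)]
    linarith [Real.pi_gt_three]
  have hend : ∀ t : ℝ, t ≤ 1 / 2 → ‖(1 / (2 * π * I) * (1 / (1 - t)) : ℂ)‖ ≤ 2 := by
    intro t ht
    rw [norm_mul]
    have : ‖(1 / (1 - t) : ℂ)‖ ≤ 2 := by
      rw [norm_div, norm_one, ← Complex.ofReal_one, ← Complex.ofReal_sub, Complex.norm_real,
        Real.norm_of_nonneg (by linarith), div_le_iff₀ (by linarith)]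
      linarith
    calc _ ≤ (1 : ℝ) * 2 := by gcongr
      _ = 2 := by norm_num
  refine bounded_of_bounded_near (M := M + 3) ?_ hd0 ?_ ?_
  · have h1 : ContinuousOn (fun t : ℝ => ee t / (1 - ee t)) (Set.Ioo 0 1) := by
      have := continuous_ee
      refine ContinuousOn.div (by fun_prop) (by fun_prop) fun t ht => ?_
      exact sub_ne_zero.mpr (ee_ofReal_ne_one ht).symm
    have h2 : ContinuousOn (fun t : ℝ => (1 / t : ℂ)) (Set.Ioo 0 1) :=
      ContinuousOn.div (by fun_prop) (by fun_prop) fun t ht => by exact_mod_cast ht.1.ne'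
    have h3 : ContinuousOn (fun t : ℝ => (1 / (1 - t) : ℂ)) (Set.Ioo 0 1) :=
      ContinuousOn.div (by fun_prop) (by fun_prop) fun t ht => by
        exact_mod_cast (sub_pos.mpr ht.2).ne'
    fun_prop
  · intro t ht0 ht1
    have h1 := hM t (by exact_mod_cast ht0.ne')
      (by rw [Complex.norm_real, Real.norm_of_nonneg ht0.le]; linarith)
    have h2 : 1 - ee t ≠ 0 := sub_ne_zero.mpr
      (ee_ofReal_ne_one ⟨ht0, by linarith⟩).symm
    have h3 : ee t / (1 - ee t) + 1 / (2 * π * I) * (1 / t) - 1 / (2 * π * I) * (1 / (1 - t)) =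
        (1 / (1 - ee t) + 1 / (2 * π * I * t)) - 1 - 1 / (2 * π * I) * (1 / (1 - t)) := by
      rw [show ee t / (1 - ee t) = 1 / (1 - ee t) - 1 by field_simp; ring]
      ring
    rw [h3]
    have h4 := hend t (by linarith)
    refine (norm_sub_le _ _).trans ((add_le_add (norm_sub_le _ _) h4).trans ?_)
    rw [norm_one]
    linarith
  · intro t ht0 ht1
    have ht2 : 0 < 1 - t := by linarith
    have h1 := hM ((1 - t : ℝ) : ℂ) (by exact_mod_cast ht2.ne')
      (by rw [Complex.norm_real, Real.norm_of_nonneg ht2.le]; linarith)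
    have h2 : 1 - ee t ≠ 0 := sub_ne_zero.mpr (ee_ofReal_ne_one ⟨by linarith, ht1⟩).symm
    have h5 : ee ((1 - t : ℝ) : ℂ) = (ee t)⁻¹ := by
      push_cast
      rw [sub_eq_add_neg, ee_add, ee_neg, show ee 1 = 1 by simpa using ee_int 1, one_mul]
    have h6 := ee_ne_zero t
    have h7 : ee t - 1 ≠ 0 := by rw [← neg_sub]; exact neg_ne_zero.mpr h2
    -- The end `t = 1` is reduced to the bound at `0` through `e(1-t) = e(t)⁻¹`.
    have h3 : ee t / (1 - ee t) + 1 / (2 * π * I) * (1 / t) - 1 / (2 * π * I) * (1 / (1 - t)) =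
        -(1 / (1 - ee ((1 - t : ℝ) : ℂ)) + 1 / (2 * π * I * ((1 - t : ℝ) : ℂ))) +
          1 / (2 * π * I) * (1 / (1 - ((1 - t : ℝ) : ℂ))) := by
      rw [h5, show 1 / (1 - (ee t)⁻¹) = -(ee t / (1 - ee t)) by
        rw [show 1 - ee t = -(ee t - 1) by ring]
        field_simp]
      push_cast
      rw [sub_sub_cancel, show (1 : ℂ) / (2 * π * I * (1 - t)) = 1 / (2 * π * I) * (1 / (1 - t)) by
        rw [div_mul_div_comm, one_mul]]
      ring
    rw [h3]
    have h4 := hend (1 - t) (by linarith)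
    refine (norm_add_le _ _).trans ((add_le_add (norm_neg _).le h4).trans ?_)
    linarith

theorem continuousOn_cot_kernel : ContinuousOn (fun t : ℝ => ee t / (1 - ee t)) (Set.Ioo 0 1) := by
  have := continuous_ee
  refine ContinuousOn.div (by fun_prop) (by fun_prop) fun t ht => ?_
  exact sub_ne_zero.mpr (ee_ofReal_ne_one ht).symm

theorem cot_kernel_norm_le : ∃ C : ℝ, ∀ t ∈ Set.Ioo (0 : ℝ) 1,
    ‖ee t / (1 - ee t)‖ ≤ C * (1 / t + 1 / (1 - t)) := by
  obtain ⟨M, hM⟩ := cot_kernel_bounded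
  refine ⟨M + ‖(-(1 / (2 * π * I)) : ℂ)‖ + ‖(1 / (2 * π * I) : ℂ)‖, fun t ht => ?_⟩
  have := norm_le_of_poles (-(1 / (2 * π * I))) (1 / (2 * π * I)) hM t ht
  convert this using 2
  ring

theorem continuousOn_inv_left : ContinuousOn (fun t : ℝ => (1 / t : ℂ)) (Set.Ioo 0 1) :=
  ContinuousOn.div (by fun_prop) (by fun_prop) fun t ht => by exact_mod_cast ht.1.ne'

theorem continuousOn_inv_right : ContinuousOn (fun t : ℝ => (1 / (1 - t) : ℂ)) (Set.Ioo 0 1) :=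
  ContinuousOn.div (by fun_prop) (by fun_prop) fun t ht => by
    exact_mod_cast (sub_pos.mpr ht.2).ne'

theorem trunc_intervalIntegrable {f : ℝ → ℂ} (hf : ContinuousOn f (Set.Ioo 0 1)) {ε : ℝ}
    (h0 : 0 < ε) (h1 : ε < 1 / 2) : IntervalIntegrable f MeasureTheory.volume ε (1 - ε) := by
  refine (hf.mono ?_).intervalIntegrable
  rw [Set.uIcc_of_le (by linarith)]
  exact fun t ht => ⟨by linarith [ht.1], by linarith [ht.2]⟩

theorem logAsymp_integral_add {f g : ℝ → ℂ} {a b c d : ℂ} (hf : ContinuousOn f (Set.Ioo 0 1))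
    (hg : ContinuousOn g (Set.Ioo 0 1)) (h : LogAsymp (fun ε => ∫ t in ε..1 - ε, f t) a b)
    (h' : LogAsymp (fun ε => ∫ t in ε..1 - ε, g t) c d) :
    LogAsymp (fun ε => ∫ t in ε..1 - ε, (f t + g t)) (a + c) (b + d) :=
  (h.add h').congr fun _ h0 h1 =>
    (intervalIntegral.integral_add (trunc_intervalIntegrable hf h0 h1)
      (trunc_intervalIntegrable hg h0 h1)).symm

theorem logAsymp_integral_const_mul {f : ℝ → ℂ} {a b : ℂ}
    (h : LogAsymp (fun ε => ∫ t in ε..1 - ε, f t) a b) (x : ℂ) :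
    LogAsymp (fun ε => ∫ t in ε..1 - ε, x * f t) (x * a) (x * b) :=
  (h.const_mul x).congr fun _ _ _ => (intervalIntegral.integral_const_mul _ _).symm

theorem logAsymp_integral_congr {f g : ℝ → ℂ} {a b : ℂ}
    (h : LogAsymp (fun ε => ∫ t in ε..1 - ε, f t) a b)
    (hfg : ∀ t ∈ Set.Ioo (0 : ℝ) 1, f t = g t) :
    LogAsymp (fun ε => ∫ t in ε..1 - ε, g t) a b :=
  h.congr fun ε h0 h1 => intervalIntegral.integral_congr fun t ht => by
    rw [Set.uIcc_of_le (by linarith)] at ht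
    exact hfg t ⟨by linarith [ht.1], by linarith [ht.2]⟩

theorem logAsymp_of_continuous {g : ℝ → ℂ} (hg : ContinuousOn g (Set.Icc 0 1)) :
    LogAsymp (fun ε => ∫ t in ε..1 - ε, g t) (∫ t in (0 : ℝ)..1, g t) 0 := by
  obtain ⟨C, hC⟩ := isCompact_Icc.exists_bound_of_continuousOn hg
  exact logAsymp_of_bounded (hg.mono Set.Ioo_subset_Icc_self)
    fun t ht => hC t (Set.Ioo_subset_Icc_self ht)

/-! ### Regularized moments of the endpoint poles and of the cotangent kernel -/

theorem exists_logAsymp_inv_mul_pow (m : ℕ) :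
    ∃ a b, LogAsymp (fun ε => ∫ t in ε..1 - ε, (1 / t : ℂ) * (t : ℂ) ^ m) a b := by
  cases m with
  | zero => exact ⟨_, _, by simpa using logAsymp_inv⟩
  | succ m =>
    refine ⟨_, _, logAsymp_integral_congr (logAsymp_of_continuous (g := fun t => (t : ℂ) ^ m)
      (by fun_prop)) fun t ht => ?_⟩
    have : (t : ℂ) ≠ 0 := by exact_mod_cast ht.1.ne'
    field_simp
    ring

theorem exists_logAsymp_inv_one_sub_mul_pow (m : ℕ) :
    ∃ a b, LogAsymp (fun ε => ∫ t in ε..1 - ε, (1 / (1 - t) : ℂ) * (t : ℂ) ^ m) a b := by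
  have h1 := logAsymp_integral_add continuousOn_inv_right
    (g := fun t => -∑ i ∈ Finset.range m, (t : ℂ) ^ i) (by fun_prop)
    logAsymp_inv_one_sub (logAsymp_of_continuous (by fun_prop))
  refine ⟨_, _, logAsymp_integral_congr h1 fun t ht => ?_⟩
  have h2 : (1 : ℂ) - t ≠ 0 := by exact_mod_cast (sub_pos.mpr ht.2).ne'
  have h3 := geom_sum_mul (t : ℂ) m
  have h4 : (t : ℂ) ^ m = 1 - (∑ i ∈ Finset.range m, (t : ℂ) ^ i) * (1 - t) := by
    linear_combination -h3
  rw [h4]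
  field_simp
  ring

/-- Subtracting the poles leaves a bounded function, and the poles have moments with logarithmic
asymptotics. The values are not needed: they do not involve `τ` and end up in the constant `A^∞`. -/
theorem exists_logAsymp_cot_kernel (m : ℕ) :
    ∃ a b, LogAsymp (fun ε => ∫ t in ε..1 - ε, ee t / (1 - ee t) * (t : ℂ) ^ m) a b := by
  obtain ⟨M, hM⟩ := cot_kernel_bounded
  obtain ⟨a, b, h1⟩ := exists_logAsymp_inv_mul_pow m
  obtain ⟨c, d, h2⟩ := exists_logAsymp_inv_one_sub_mul_pow m
  have hk := continuousOn_cot_kernel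
  have hl := continuousOn_inv_left
  have hr := continuousOn_inv_right
  have hp : ContinuousOn (fun t : ℝ => (t : ℂ) ^ m) (Set.Ioo 0 1) := by fun_prop
  have h3 := logAsymp_of_bounded (M := M) (g := fun t : ℝ => (ee t / (1 - ee t) +
    1 / (2 * π * I) * (1 / t) - 1 / (2 * π * I) * (1 / (1 - t))) * (t : ℂ) ^ m)
    (by fun_prop) (fun t ht => by
      rw [norm_mul, norm_pow, Complex.norm_real, Real.norm_of_nonneg ht.1.le]
      exact (mul_le_of_le_one_right (norm_nonneg _) (pow_le_one₀ ht.1.le ht.2.le)).trans (hM t ht))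
  have h4 := logAsymp_integral_add (by fun_prop) (by fun_prop) h3
    (logAsymp_integral_add (by fun_prop) (by fun_prop)
      (logAsymp_integral_const_mul h1 (-(1 / (2 * π * I))))
      (logAsymp_integral_const_mul h2 (1 / (2 * π * I))))
  exact ⟨_, _, logAsymp_integral_congr h4 fun t _ => by ring⟩

/-! ### Depth-one A-elliptic multiple zeta values -/

theorem two_pi_I_ne_zero' : (2 * π * I : ℂ) ≠ 0 := by simp [Real.pi_ne_zero]

/-- Since `e(M) = 1`, the boundary contribution at `0` cancels the term `s = m` of the one at `1`;
hence the range stops at `m - 1`. -/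
theorem integral_pow_mul_ee (m : ℕ) {M : ℤ} (hM : M ≠ 0) :
    ∫ t in (0 : ℝ)..1, (t : ℂ) ^ m * ee (M * t) =
      ∑ s ∈ Finset.range m, (m.descFactorial s : ℂ) * (-1) ^ s / (2 * π * I * M) ^ (s + 1) := by
  have hc : (2 * π * I * M : ℂ) ≠ 0 := mul_ne_zero two_pi_I_ne_zero' (by exact_mod_cast hM)
  have h := integral_pow_mul_cexp m hc
  have h1 : cexp (2 * π * I * M) = 1 := ee_int M
  simp only [ee, ← mul_assoc]
  rw [h, h1, bdry, Finset.sum_range_succ, Nat.descFactorial_self]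
  ring

/-- The terms of the `q`-series of `ω_{n+1}` on the real line. -/
noncomputable def vTerm (τ : ℂ) (n : ℕ) (p : ℕ × ℕ) (t : ℝ) : ℂ :=
  sCoeff n 0 p * ee ((p.1 + 1) * (p.2 + 1) * τ) *
    (ee (((p.1 + 1 : ℕ) : ℤ) * t) - (-1) ^ n * ee ((-((p.1 + 1 : ℕ) : ℤ) : ℤ) * t))

theorem norm_ee_ofReal (t : ℝ) : ‖ee t‖ = 1 := by rw [norm_ee]; simp

theorem norm_vTerm_le (τ : ℂ) (n : ℕ) (p : ℕ × ℕ) (t : ℝ) :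
    ‖vTerm τ n p t‖ ≤ 2 * ‖sCoeff n 0 p * ee ((p.1 + 1) * (p.2 + 1) * τ)‖ := by
  rw [vTerm, norm_mul, mul_comm 2]
  gcongr
  have h1 : ∀ M : ℤ, ‖ee (M * t)‖ = 1 := fun M => by
    have := norm_ee_ofReal (M * t)
    push_cast at this
    exact this
  refine (norm_sub_le _ _).trans ?_
  rw [norm_mul, h1, h1]
  simp
  norm_num

theorem continuous_vTerm (τ : ℂ) (n : ℕ) (p : ℕ × ℕ) : Continuous (vTerm τ n p) := by
  unfold vTerm ee
  fun_prop

theorem lamCoeff_ofReal (hτ : 0 < τ.im) (n : ℕ) (t : ℝ) :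
    lamCoeff τ t 0 n = ee t / (1 - ee t) * 0 ^ n + ∑' p, vTerm τ n p t := by
  rw [lamCoeff]
  congr 1
  have hs := (polyBounded_sCoeff n 0).summable hτ
  have h1 : ∀ p : ℕ × ℕ, sCoeff n 0 p = ((p.2 : ℂ) + 1) ^ n := fun p => by simp [sCoeff]
  have hs1 : Summable fun p : ℕ × ℕ =>
      ee ((p.1 + 1) * (p.2 + 1) * τ + (p.1 + 1) * t) * (0 + (p.2 + 1)) ^ n := by
    refine Summable.of_norm_bounded hs.norm fun p => ?_
    rw [norm_mul, norm_mul, h1, zero_add, mul_comm, norm_ee, norm_ee]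
    simp
  have hs2 : Summable fun p : ℕ × ℕ =>
      ee ((p.1 + 1) * (p.2 + 1) * τ - (p.1 + 1) * t) * (0 - (p.2 + 1)) ^ n := by
    refine Summable.of_norm_bounded hs.norm fun p => ?_
    rw [norm_mul, norm_mul, h1, zero_sub, neg_pow, norm_mul, mul_comm, norm_ee, norm_ee]
    simp
  rw [← hs1.tsum_sub hs2]
  refine tsum_congr fun p => ?_
  rw [vTerm, h1, zero_add, zero_sub, neg_pow, mul_sub, sub_eq_add_neg ((_ : ℂ) * τ), ee_add, ee_add]
  push_cast
  rw [neg_mul]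
  ring

theorem summable_norm_sCoeff (hτ : 0 < τ.im) (n : ℕ) : Summable fun p : ℕ × ℕ =>
    2 * ‖sCoeff n 0 p * ee ((p.1 + 1) * (p.2 + 1) * τ)‖ :=
  ((polyBounded_sCoeff n 0).summable hτ).norm.mul_left 2

theorem continuous_tsum_vTerm (hτ : 0 < τ.im) (n : ℕ) :
    Continuous fun t => ∑' p, vTerm τ n p t :=
  continuous_tsum (continuous_vTerm τ n) (summable_norm_sCoeff hτ n)
    fun p t => norm_vTerm_le τ n p t

/-- The exponentially small part of `A_{n+1,m+1}`, up to normalization. -/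
noncomputable def aSum (n m : ℕ) (τ : ℂ) : ℂ :=
  ∑ s ∈ Finset.range m, (m.descFactorial s : ℂ) * (-1) ^ s / (2 * π * I) ^ (s + 1) *
    (1 + (-1) ^ (n + s)) * sSer n (s + 1) τ

/-- The frequencies `M` and `-M` contribute multiples of `M^(-(s+1))` and `-(-1)^n (-M)^(-(s+1))`;
their sum is the origin of the parity factor `1 + (-1)^(n+s)`. -/
theorem integral_tsum_vTerm (hτ : 0 < τ.im) (n m : ℕ) :
    ∫ t in (0 : ℝ)..1, (∑' p, vTerm τ n p t) * (t : ℂ) ^ m = aSum n m τ := by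
  have h := hasSum_integral_unit (F := fun p t => vTerm τ n p t * (t : ℂ) ^ m)
    (fun p => by have := continuous_vTerm τ n p; fun_prop) (summable_norm_sCoeff hτ n)
    (fun p t ht => by
      rw [norm_mul, norm_pow, Complex.norm_real, Real.norm_of_nonneg ht.1]
      exact (mul_le_of_le_one_right (norm_nonneg _) (pow_le_one₀ ht.1 ht.2)).trans
        (norm_vTerm_le τ n p t))
  simp only [tsum_mul_right] at h
  rw [← h.tsum_eq, aSum]
  have hsum := qser_sum (τ := τ) (Finset.range m) (c := fun s p => ((m.descFactorial s : ℂ) *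
    (-1) ^ s / (2 * π * I) ^ (s + 1) * (1 + (-1) ^ (n + s))) * sCoeff n (s + 1) p)
    (fun s _ => (polyBounded_sCoeff n (s + 1)).const_mul _) hτ
  simp only [qser_const_mul] at hsum
  refine Eq.trans ?_ hsum
  rw [qser]
  refine tsum_congr fun p => ?_
  have hM : ((p.1 + 1 : ℕ) : ℤ) ≠ 0 := by positivity
  have hterm : ∀ t : ℝ, vTerm τ n p t * (t : ℂ) ^ m =
      sCoeff n 0 p * ee ((p.1 + 1) * (p.2 + 1) * τ) *
        ((t : ℂ) ^ m * ee (((p.1 + 1 : ℕ) : ℤ) * t) -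
          (-1) ^ n * ((t : ℂ) ^ m * ee ((-((p.1 + 1 : ℕ) : ℤ) : ℤ) * t))) := by
    intro t; rw [vTerm]; ring
  simp only [hterm]
  rw [intervalIntegral.integral_const_mul, intervalIntegral.integral_sub
    (by unfold ee; apply Continuous.intervalIntegrable; fun_prop)
    (by unfold ee; apply Continuous.intervalIntegrable; fun_prop),
    intervalIntegral.integral_const_mul, integral_pow_mul_ee m hM,
    integral_pow_mul_ee m (neg_ne_zero.mpr hM), Finset.mul_sum, ← Finset.sum_sub_distrib,
    Finset.mul_sum, Finset.sum_mul]
  refine Finset.sum_congr rfl fun s _ => ?_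
  have hp1 : ((p.1 : ℂ) + 1) ≠ 0 := by exact_mod_cast p.1.succ_ne_zero
  have hpi := two_pi_I_ne_zero'
  simp only [sCoeff, pow_zero, div_one]
  push_cast
  rw [mul_neg, neg_pow _ (s + 1), mul_pow]
  have h1 : ((-1 : ℂ)) ^ (s + 1) * (-1) ^ (s + 1) = 1 := by rw [← mul_pow]; simp
  have h2 : ((-1 : ℂ)) ^ (s + 1) ≠ 0 := pow_ne_zero _ (by norm_num)
  have h3 : ((-1 : ℂ)) ^ (s + 1) = -(-1) ^ s := by ring
  have h4 : ((-1 : ℂ)) ^ s * (-1) ^ s = 1 := by rw [← mul_pow]; simp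
  have h5 : ((-1 : ℂ)) ^ s ≠ 0 := pow_ne_zero _ (by norm_num)
  generalize (2 * π * I : ℂ) = w at *
  rw [pow_add (-1 : ℂ) n s, h3]
  field_simp
  linear_combination (-ee ((p.2 + 1) * (p.1 + 1) * τ) *
    (m.descFactorial s : ℂ) * (-1) ^ n) * h4

theorem truncA_depthOne (n m : ℕ) (τ : ℂ) : truncA (depthOne (n + 1) (m + 1)) τ =
    fun ε => 1 * iterInt ((fun t : ℝ => omega (n + 1) t τ) ::
      List.replicate m fun _ => 2 * π * I) ε (1 - ε) := by
  funext ε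
  simp [truncA, depthOne, omega_zero]

theorem omega_ofReal (hτ : 0 < τ.im) (n : ℕ) {t : ℝ} (ht : t ∈ Set.Ioo (0 : ℝ) 1) :
    omega (n + 1) t τ = 2 * π * I * (beta (n + 1) 0 - (ee t / (1 - ee t) * 0 ^ n +
      ∑' p, vTerm τ n p t) / n.factorial) := by
  have h := omega_succ (τ := τ) (ξ := t) n (by simp) (ee_ofReal_ne_one ht) (by simpa using hτ)
  simp only [Complex.ofReal_im, zero_div, Complex.ofReal_zero] at h
  rw [h, lamCoeff_ofReal hτ]

/-- The quantifier order matters: `a` serves all `τ`, because at `ρ = 0` the Bernoulli term and the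
cotangent kernel are free of `τ`. The pole enters with the factor `0 ^ n`, that is, only for `ω_1`.
-/
theorem exists_regValue_A (n m : ℕ) : ∃ a : ℂ, ∀ τ : ℂ, 0 < τ.im →
    IsRegValue (m + 1) (truncA (depthOne (n + 1) (m + 1)) τ)
      (a - (2 * π * I) ^ (m + 1) / (m.factorial * n.factorial) * aSum n m τ) := by
  obtain ⟨κ₀, κ₁, hκ⟩ := exists_logAsymp_cot_kernel m
  obtain ⟨C, hC⟩ := cot_kernel_norm_le
  obtain ⟨x, hx⟩ : ∃ x : ℂ, x = -(2 * π * I / n.factorial) := ⟨_, rfl⟩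
  obtain ⟨b, hb⟩ : ∃ b : ℂ, b = 2 * π * I * beta (n + 1) 0 := ⟨_, rfl⟩
  refine ⟨(2 * π * I) ^ m / m.factorial * ((x * 0 ^ n * κ₀ + b * ∫ t in (0 : ℝ)..1, (t : ℂ) ^ m) -
    x * 0 ^ n * κ₁ * Complex.log (-(2 * π * I))), fun τ hτ => ?_⟩
  obtain ⟨V, hVdef⟩ : ∃ V : ℝ → ℂ, V = fun t => ∑' p, vTerm τ n p t := ⟨_, rfl⟩
  have hV : Continuous V := hVdef ▸ continuous_tsum_vTerm hτ n
  have hVint : ∫ t in (0 : ℝ)..1, V t * (t : ℂ) ^ m = aSum n m τ := by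
    rw [hVdef, integral_tsum_vTerm hτ]
  have hk := continuousOn_cot_kernel
  obtain ⟨h, hh⟩ : ∃ h : ℝ → ℂ, h = fun t : ℝ => x * 0 ^ n * (ee t / (1 - ee t)) + (b + x * V t) := ⟨_, rfl⟩
  have hf : ∀ t ∈ Set.Ioo (0 : ℝ) 1, omega (n + 1) t τ = h t := by
    intro t ht
    rw [omega_ofReal hτ n ht]
    simp only [hh, hx, hb, hVdef]
    ring
  have hc : ContinuousOn h (Set.Ioo 0 1) := by rw [hh]; fun_prop
  obtain ⟨D, hD⟩ := isCompact_Icc.exists_bound_of_continuousOn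
    (f := fun t => b + x * V t) (s := Set.Icc (0 : ℝ) 1) (by fun_prop)
  have hbound : ∀ t ∈ Set.Ioo (0 : ℝ) 1,
      ‖h t‖ ≤ (‖x * 0 ^ n‖ * C + |D|) * (1 / t + 1 / (1 - t)) := by
    intro t ht
    rw [hh]
    refine (norm_add_le _ _).trans ?_
    rw [norm_mul, add_mul, mul_assoc]
    refine add_le_add (mul_le_mul_of_nonneg_left (hC t ht) (norm_nonneg _)) ?_
    exact ((hD t (Set.Ioo_subset_Icc_self ht)).trans (le_abs_self D)).trans
      (le_mul_of_one_le_right (abs_nonneg _) (one_le_inv_add_inv ht))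
  have H1 := logAsymp_integral_const_mul hκ (x * 0 ^ n)
  have H2 := logAsymp_of_continuous (g := fun t => (b + x * V t) * (t : ℂ) ^ m)
    (by fun_prop)
  have H : LogAsymp (fun ε => ∫ t in ε..1 - ε, h t * (t : ℂ) ^ m)
      (x * 0 ^ n * κ₀ + ((b * ∫ t in (0 : ℝ)..1, (t : ℂ) ^ m) + x * aSum n m τ))
      (x * 0 ^ n * κ₁ + 0) := by
    have H3 := logAsymp_integral_add (by fun_prop) (by fun_prop) H1 H2
    have e : ∫ t in (0 : ℝ)..1, (b + x * V t) * (t : ℂ) ^ m =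
        (b * ∫ t in (0 : ℝ)..1, (t : ℂ) ^ m) + x * aSum n m τ := by
      rw [← hVint, ← intervalIntegral.integral_const_mul,
        ← intervalIntegral.integral_const_mul, ← intervalIntegral.integral_add]
      · exact intervalIntegral.integral_congr fun t _ => by ring
      · apply Continuous.intervalIntegrable; fun_prop
      · apply Continuous.intervalIntegrable; fun_prop
    rw [e] at H3
    exact logAsymp_integral_congr H3 fun t _ => by simp only [hh]; ring
  rw [truncA_depthOne]
  convert isRegValue_iterInt hf hc hbound H 1 using 1
  rw [hx]
  have hn : (n.factorial : ℂ) ≠ 0 := by exact_mod_cast n.factorial_ne_zero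
  have hm : (m.factorial : ℂ) ≠ 0 := by exact_mod_cast m.factorial_ne_zero
  field_simp
  ring

/-- The exponentially small part of `A_{n+1,m+1}`. -/
noncomputable def aExp (n m : ℕ) (τ : ℂ) : ℂ :=
  -((2 * π * I) ^ (m + 1) / (m.factorial * n.factorial)) * aSum n m τ

theorem isExpSmall_aExp (n m : ℕ) : IsExpSmall (aExp n m) := by
  refine IsExpSmall.const_mul (IsExpSmall.sum _ fun s _ => ?_) _
  exact (isExpSmall_sSer n (s + 1)).const_mul _

theorem laurentLog_single (k : ℤ) (a c τ : ℂ) :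
    laurentLog (Finsupp.single k a) c τ = a * τ ^ k + c * Complex.log τ := by
  rw [laurentLog, Finsupp.sum_single_index (by simp)]

theorem exists_A_eq (n m : ℕ) : ∃ a : ℂ, ∀ τ : ℂ, 0 < τ.im →
    A (n + 1) (m + 1) τ = laurentLog (Finsupp.single 0 a) 0 τ + aExp n m τ := by
  obtain ⟨a, ha⟩ := exists_regValue_A n m
  refine ⟨a, fun τ hτ => ?_⟩
  rw [A, ellA, show (depthOne (n + 1) (m + 1)).length = m + 1 by simp [depthOne],
    (ha τ hτ).regValue_eq, laurentLog_single, aExp]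
  simp
  ring

theorem exists_isSplitting_A (n m : ℕ) :
    ∃ a : ℂ, IsSplitting (A (n + 1) (m + 1)) (Finsupp.single 0 a) 0 := by
  obtain ⟨a, ha⟩ := exists_A_eq n m
  exact ⟨a, isSplitting_of_eq ha (isExpSmall_aExp n m)⟩

theorem expPart_A (n m : ℕ) (hτ : 0 < τ.im) : expPart (A (n + 1) (m + 1)) τ = aExp n m τ := by
  obtain ⟨a, ha⟩ := exists_A_eq n m
  exact expPart_eq_of_eq ha (isExpSmall_aExp n m) hτ

/-! ### Regularized integrals of polynomials plus `q`-series -/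

theorem laurentLog_sum_single {ι : Type*} (s : Finset ι) (k : ι → ℤ) (a : ι → ℂ) (c τ : ℂ) :
    laurentLog (∑ i ∈ s, Finsupp.single (k i) (a i)) c τ =
      ∑ i ∈ s, a i * τ ^ k i + c * Complex.log τ := by
  rw [laurentLog, ← Finsupp.sum_finsetSum_index (by simp) (by intros; ring)]
  congr 1
  exact Finset.sum_congr rfl fun i _ => Finsupp.sum_single_index (by simp)

theorem exists_laurentLog_eq_eval (P : Polynomial ℂ) :
    ∃ p : ℤ →₀ ℂ, ∀ τ, laurentLog p 0 τ = P.eval τ := by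
  refine ⟨∑ i ∈ P.support, Finsupp.single (i : ℤ) (P.coeff i), fun τ => ?_⟩
  rw [laurentLog_sum_single, Polynomial.eval_eq_sum, Polynomial.sum]
  simp

theorem exists_integral_eval (P : Polynomial ℂ) :
    ∃ Q : Polynomial ℂ, ∀ τ : ℂ, ∫ t in (0 : ℝ)..1, P.eval (t * τ) * τ = Q.eval τ := by
  induction P using Polynomial.induction_on' with
  | add P Q hP hQ =>
    obtain ⟨P', hP'⟩ := hP
    obtain ⟨Q', hQ'⟩ := hQ
    refine ⟨P' + Q', fun τ => ?_⟩
    simp only [Polynomial.eval_add, add_mul]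
    rw [intervalIntegral.integral_add, hP', hQ']
    · apply Continuous.intervalIntegrable
      fun_prop
    · apply Continuous.intervalIntegrable
      fun_prop
  | monomial n a =>
    refine ⟨Polynomial.monomial (n + 1) (a * ∫ t in (0 : ℝ)..1, (t : ℂ) ^ n), fun τ => ?_⟩
    simp only [Polynomial.eval_monomial]
    rw [← intervalIntegral.integral_const_mul, ← intervalIntegral.integral_mul_const]
    exact intervalIntegral.integral_congr fun t _ => by ring

theorem norm_succ_mul_succ (p : ℕ × ℕ) : ‖((p.1 : ℂ) + 1) * (p.2 + 1)‖ = (p.1 + 1) * (p.2 + 1) := by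
  rw [← Nat.cast_add_one, ← Nat.cast_add_one, ← Nat.cast_mul, Complex.norm_natCast]
  push_cast; rfl

theorem PolyBounded.div {c : ℕ × ℕ → ℂ} (hc : PolyBounded c) :
    PolyBounded fun p => c p / ((p.1 + 1) * (p.2 + 1)) := by
  obtain ⟨C, a, h⟩ := hc
  refine ⟨C, a, fun p => ?_⟩
  rw [norm_div, norm_succ_mul_succ]
  refine (div_le_self (norm_nonneg _) ?_).trans (h p)
  have h1 : (0 : ℝ) ≤ p.1 := Nat.cast_nonneg _
  have h2 : (0 : ℝ) ≤ p.2 := Nat.cast_nonneg _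
  nlinarith [mul_nonneg h1 h2]

/-- Along the vertical ray a single exponential satisfies `∫_τ^{i∞} e(Mz) dz = -e(Mτ)/(2πiM)`; the
integrated norms are summable, which permits termwise integration. -/
theorem integral_qser {c : ℕ × ℕ → ℂ} (hc : PolyBounded c) (hτ : 0 < τ.im) :
    ∫ s in Set.Ioi (0 : ℝ), qser c (τ + I * s) * I =
      qser (fun p => -(1 / (2 * π * I)) * (c p / ((p.1 + 1) * (p.2 + 1)))) τ := by
  have hM : ∀ p : ℕ × ℕ, (0 : ℝ) < 2 * π * ((p.1 + 1) * (p.2 + 1)) := fun p => by positivity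
  have hF : ∀ (p : ℕ × ℕ) (s : ℝ), c p * ee ((p.1 + 1) * (p.2 + 1) * (τ + I * s)) * I =
      c p * ee ((p.1 + 1) * (p.2 + 1) * τ) * I *
        ((Real.exp (-(2 * π * ((p.1 + 1) * (p.2 + 1))) * s) : ℝ) : ℂ) := by
    intro p s
    have : ee ((p.1 + 1) * (p.2 + 1) * (τ + I * s)) = ee ((p.1 + 1) * (p.2 + 1) * τ) *
        ((Real.exp (-(2 * π * ((p.1 + 1) * (p.2 + 1))) * s) : ℝ) : ℂ) := by
      rw [mul_add, ee_add]
      congr 1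
      rw [ee]
      push_cast
      congr 1
      linear_combination (2 * π * ((p.1 + 1) * (p.2 + 1)) * s) * I_mul_I
    rw [this]; ring
  have hexp : ∀ p : ℕ × ℕ, ∫ s in Set.Ioi (0 : ℝ),
      Real.exp (-(2 * π * ((p.1 + 1) * (p.2 + 1))) * s) =
        1 / (2 * π * ((p.1 + 1) * (p.2 + 1))) := by
    intro p
    have := integral_exp_mul_Ioi (a := -(2 * π * ((p.1 + 1) * (p.2 + 1)))) (by
      have := hM p; linarith) 0
    rw [this]
    simp
  have hint : ∀ p : ℕ × ℕ, MeasureTheory.IntegrableOn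
      (fun s : ℝ => Real.exp (-(2 * π * ((p.1 + 1) * (p.2 + 1))) * s)) (Set.Ioi 0) := fun p =>
    exp_neg_integrableOn_Ioi 0 (hM p)
  have hs := hc.summable hτ
  have key := MeasureTheory.hasSum_integral_of_summable_integral_norm
    (μ := MeasureTheory.volume.restrict (Set.Ioi (0 : ℝ)))
    (F := fun (p : ℕ × ℕ) (s : ℝ) => c p * ee ((p.1 + 1) * (p.2 + 1) * (τ + I * s)) * I)
    (fun p => by
      simp only [hF]
      exact (MeasureTheory.Integrable.ofReal (hint p)).const_mul _) (by
      refine Summable.of_nonneg_of_le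
        (fun p => MeasureTheory.integral_nonneg fun s => norm_nonneg _) (fun p => ?_) hs.norm
      simp only [hF, norm_mul, Complex.norm_real, Complex.norm_I, mul_one, Real.norm_eq_abs,
        Real.abs_exp]
      rw [MeasureTheory.integral_const_mul, hexp]
      refine mul_le_of_le_one_right (by positivity) ?_
      rw [div_le_one (hM p)]
      have h1 : (0 : ℝ) ≤ p.1 := Nat.cast_nonneg _
      have h2 : (0 : ℝ) ≤ p.2 := Nat.cast_nonneg _
      nlinarith [Real.pi_gt_three, mul_nonneg h1 h2])
  have h1 : ∀ s : ℝ, ∑' p : ℕ × ℕ, c p * ee ((p.1 + 1) * (p.2 + 1) * (τ + I * s)) * I =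
      qser c (τ + I * s) * I := fun s => tsum_mul_right
  simp only [h1] at key
  rw [← key.tsum_eq, qser]
  refine tsum_congr fun p => ?_
  simp only [hF]
  rw [MeasureTheory.integral_const_mul, integral_complex_ofReal, hexp]
  have h3 : ((p.1 : ℂ) + 1) ≠ 0 := by exact_mod_cast p.1.succ_ne_zero
  have h4 : ((p.2 : ℂ) + 1) ≠ 0 := by exact_mod_cast p.2.succ_ne_zero
  have h5 : (π : ℂ) ≠ 0 := by exact_mod_cast Real.pi_ne_zero
  push_cast
  field_simp
  rw [I_sq]
  ring

/-- The class "polynomial plus `q`-series" is stable under the regularized integral. The polynomial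
part is left unspecified, since only the `q`-series is compared later. -/
theorem regInt_eq {f : ℂ → ℂ} {c : ℕ × ℕ → ℂ} {P : Polynomial ℂ} (hc : PolyBounded c)
    (hf : ∀ τ : ℂ, 0 < τ.im → f τ = P.eval τ + qser c τ) :
    ∃ Q : Polynomial ℂ, ∀ τ : ℂ, 0 < τ.im → regInt f τ = Q.eval τ +
      qser (fun p => -(1 / (2 * π * I)) * (c p / ((p.1 + 1) * (p.2 + 1)))) τ := by
  obtain ⟨p, hp⟩ := exists_laurentLog_eq_eval P
  obtain ⟨Q, hQ⟩ := exists_integral_eval P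
  have hf' : ∀ τ : ℂ, 0 < τ.im → f τ = laurentLog p 0 τ + qser c τ := fun τ hτ => by
    rw [hf τ hτ, hp]
  have hinf : infPart f = fun τ => P.eval τ := by
    rw [(isSplitting_of_eq hf' hc.isExpSmall).infPart_eq]
    exact funext hp
  refine ⟨-Q, fun τ hτ => ?_⟩
  rw [regInt, hinf, hQ, Polynomial.eval_neg, ← integral_qser hc hτ]
  rw [sub_eq_neg_add]
  congr 1
  refine MeasureTheory.setIntegral_congr_fun measurableSet_Ioi fun s hs => ?_
  have : 0 < (τ + I * s).im := by
    have : (0 : ℝ) < s := hs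
    simp
    linarith
  simp only [expPart_eq_of_eq hf' hc.isExpSmall this]

/-! ### The `q`-expansion of the Eisenstein series -/

theorem tsum_one_div_pow_eq {N : ℕ} (hN : 2 ≤ N) (hτ : 0 < τ.im) (m : ℕ) :
    ∑' n : ℤ, 1 / (((m : ℂ) + 1) * τ + n) ^ N = (-2 * π * I) ^ N / ((N - 1).factorial : ℂ) *
      ∑' k : ℕ, ((k : ℂ) + 1) ^ (N - 1) * ee ((m + 1) * (k + 1) * τ) := by
  have him : 0 < (((m : ℂ) + 1) * τ).im := by
    have : (((m : ℂ) + 1) * τ).im = (m + 1) * τ.im := by simp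
    rw [this]; positivity
  obtain ⟨k, rfl⟩ : ∃ k, N = k + 1 := ⟨N - 1, by omega⟩
  have hk : 1 ≤ k := by omega
  have := EisensteinSeries.qExpansion_identity hk ⟨((m : ℂ) + 1) * τ, him⟩
  simp only [Nat.add_sub_cancel] at this ⊢
  refine this.trans ?_
  congr 1
  have hs : Summable fun n : ℕ => (n : ℂ) ^ k * cexp (2 * π * I * (((m : ℂ) + 1) * τ)) ^ n := by
    have := summable_pow_mul_cexp k 1 ⟨((m : ℂ) + 1) * τ, him⟩
    simpa using this
  refine hs.tsum_eq_zero_add.trans ?_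
  rw [Nat.cast_zero, zero_pow (by omega), zero_mul, zero_add]
  refine tsum_congr fun n => ?_
  rw [ee, ← Complex.exp_nat_mul]
  push_cast
  congr 2
  ring

/-- The constant term of `𝔾_N`. -/
noncomputable def ggConst (N : ℕ) : ℂ :=
  if Odd N then 0 else (2 * π * I) ^ (1 - (N : ℤ)) *
    ∑' n : ℤ, if n = 0 then 0 else 1 / (n : ℂ) ^ N

/-- Each row `m ≠ 0` is summed over `n` by the Lipschitz formula, and rows `m` and `-m` agree for
even `N`. As the rows are summed before `m`, the case `N = 2` needs no separate treatment; `1 +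
(-1)^N` also covers odd `N`. -/
theorem GG_eq {N : ℕ} (hN : 2 ≤ N) (hτ : 0 < τ.im) :
    GG N τ = ggConst N + (1 + (-1) ^ N) * (2 * π * I) / ((N - 1).factorial : ℂ) *
      sSer (N - 1) 0 τ := by
  have hN0 : N ≠ 0 := by omega
  rw [GG, G, if_neg hN0, ggConst]
  by_cases hodd : Odd N
  · simp [hodd, hodd.neg_one_pow]
  have heven : Even N := Nat.not_odd_iff_even.mp hodd
  rw [if_neg hodd, if_neg hodd]
  set f : ℤ → ℂ := fun m => ∑' n : ℤ, if m = 0 ∧ n = 0 then 0 else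
    1 / ((m : ℂ) * τ + n) ^ N with hf
  have hpb := (polyBounded_sCoeff (N - 1) 0).summable hτ
  have hpos : ∀ m : ℕ, f (m + 1) = (2 * π * I) ^ N / ((N - 1).factorial : ℂ) *
      ∑' k : ℕ, sCoeff (N - 1) 0 (m, k) * ee ((m + 1) * (k + 1) * τ) := by
    intro m
    have h1 : f (m + 1) = ∑' n : ℤ, 1 / (((m : ℂ) + 1) * τ + n) ^ N := by
      simp only [hf]
      refine tsum_congr fun n => ?_
      rw [if_neg (by omega)]
      push_cast; rfl
    rw [h1, tsum_one_div_pow_eq hN hτ, show (-2 * π * I : ℂ) = -(2 * π * I) by ring, heven.neg_pow]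
    simp [sCoeff]
  have hneg : ∀ m : ℤ, f (-m) = f m := by
    intro m
    simp only [hf]
    rw [← (Equiv.neg ℤ).tsum_eq]
    refine tsum_congr fun n => ?_
    simp only [Equiv.neg_apply, neg_eq_zero]
    split_ifs
    · rfl
    · push_cast
      rw [← heven.neg_pow]
      ring_nf
  have hS : HasSum (fun m : ℕ => f (m + 1))
      ((2 * π * I) ^ N / ((N - 1).factorial : ℂ) * sSer (N - 1) 0 τ) := by
    simp only [hpos]
    refine HasSum.mul_left _ ?_
    exact hpb.hasSum.prod_fiberwise fun m => (hpb.prod_factor m).hasSum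
  have h0 : f 0 = ∑' n : ℤ, if n = 0 then 0 else 1 / (n : ℂ) ^ N := by
    simp only [hf]
    refine tsum_congr fun n => ?_
    simp
  have hT := HasSum.of_add_one_of_neg_add_one hS
    (show HasSum (fun m : ℕ => f (-((m : ℤ) + 1))) _ by simpa only [hneg] using hS)
  rw [hT.tsum_eq, h0, heven.neg_one_pow]
  have hz : (2 * π * I : ℂ) ^ (1 - (N : ℤ)) * (2 * π * I) ^ N = 2 * π * I := by
    rw [← zpow_natCast, ← zpow_add₀ two_pi_I_ne_zero']
    simp
  linear_combination (2 / ((N - 1).factorial : ℂ) * sSer (N - 1) 0 τ) * hz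

/-! ### Iterated integrals of Eisenstein series -/

/-- The coefficients of the exponentially small part of `Γ^L_{N,k}`. -/
noncomputable def gCoeff (N k : ℕ) (p : ℕ × ℕ) : ℂ :=
  -((1 + (-1) ^ N) / ((N - 1).factorial : ℂ)) *
    (((p.2 : ℂ) + 1) ^ (N - 1) / (((p.1 : ℂ) + 1) * (p.2 + 1)) ^ k)

theorem gCoeff_succ (N k : ℕ) (p : ℕ × ℕ) :
    gCoeff N (k + 1) p = gCoeff N k p / ((p.1 + 1) * (p.2 + 1)) := by
  rw [gCoeff, gCoeff, pow_succ, ← div_div]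
  ring

theorem polyBounded_gCoeff (N k : ℕ) : PolyBounded (gCoeff N k) := by
  induction k with
  | zero =>
    have := (polyBounded_sCoeff (N - 1) 0).const_mul (-((1 + (-1) ^ N) / ((N - 1).factorial : ℂ)))
    refine (funext fun p => ?_ : gCoeff N 0 = _) ▸ this
    simp [gCoeff, sCoeff]
  | succ k ih => exact (funext (gCoeff_succ N k) : gCoeff N (k + 1) = _) ▸ ih.div

theorem GamL_one (N : ℕ) : GamL N 1 = regInt fun z => GG N z := by
  simp [GamL, Gam]

theorem GamL_succ_succ (N k : ℕ) :
    GamL N (k + 2) = regInt fun z => GG 0 z * GamL N (k + 1) z := by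
  simp [GamL, Gam, List.replicate_succ]

theorem GG_zero (τ : ℂ) : GG 0 τ = -(2 * π * I) := by simp [GG, G]

/-- The factor `𝔾_0 = -2πi` cancels the `-1/(2πi)` produced by each integration, so one step just
divides the coefficient at `(m,k)` by `mk`. -/
theorem exists_GamL_eq {N : ℕ} (hN : 2 ≤ N) (k : ℕ) : ∃ P : Polynomial ℂ, ∀ τ : ℂ, 0 < τ.im →
    GamL N (k + 1) τ = P.eval τ + qser (gCoeff N (k + 1)) τ := by
  have hpi := two_pi_I_ne_zero'
  induction k with
  | zero =>
    obtain ⟨Q, hQ⟩ := regInt_eq (f := fun z => GG N z) (P := Polynomial.C (ggConst N))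
      ((polyBounded_gCoeff N 0).const_mul (-(2 * π * I))) (fun τ hτ => by
        rw [GG_eq hN hτ, Polynomial.eval_C, qser_const_mul, sSer]
        congr 1
        rw [← qser_const_mul, ← qser_const_mul]
        congr 1
        funext p
        simp only [gCoeff, sCoeff]
        ring)
    refine ⟨Q, fun τ hτ => ?_⟩
    rw [GamL_one, hQ τ hτ]
    congr 2
    funext p
    rw [gCoeff_succ]
    field_simp
  | succ k ih =>
    obtain ⟨P, hP⟩ := ih
    obtain ⟨Q, hQ⟩ := regInt_eq (f := fun z => GG 0 z * GamL N (k + 1) z)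
      (P := Polynomial.C (-(2 * π * I)) * P)
      ((polyBounded_gCoeff N (k + 1)).const_mul (-(2 * π * I))) (fun τ hτ => by
        rw [GG_zero, hP τ hτ, Polynomial.eval_mul, Polynomial.eval_C, qser_const_mul]
        ring)
    refine ⟨Q, fun τ hτ => ?_⟩
    rw [GamL_succ_succ, hQ τ hτ]
    congr 2
    funext p
    rw [gCoeff_succ N (k + 1)]
    field_simp

theorem exists_isSplitting_GamL {N : ℕ} (hN : 2 ≤ N) (k : ℕ) :
    ∃ p : ℤ →₀ ℂ, IsSplitting (GamL N (k + 1)) p 0 := by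
  obtain ⟨P, hP⟩ := exists_GamL_eq hN k
  obtain ⟨p, hp⟩ := exists_laurentLog_eq_eval P
  exact ⟨p, isSplitting_of_eq (fun τ hτ => by rw [hP τ hτ, hp])
    (polyBounded_gCoeff N (k + 1)).isExpSmall⟩

/-- The exponentially small part of `Γ^L_{N,k}`. -/
theorem expPart_GamL {N k : ℕ} (hk : 1 ≤ k) (hkN : k < N) (hτ : 0 < τ.im) :
    expPart (GamL N k) τ = -((1 + (-1) ^ N) / ((N - 1).factorial : ℂ)) * sSer (N - 1 - k) k τ := by
  obtain ⟨k, rfl⟩ : ∃ l, k = l + 1 := ⟨k - 1, by omega⟩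
  obtain ⟨P, hP⟩ := exists_GamL_eq (N := N) (by omega) k
  obtain ⟨p, hp⟩ := exists_laurentLog_eq_eval P
  rw [expPart_eq_of_eq (p := p) (c := 0) (fun τ hτ => by rw [hP τ hτ, hp])
    (polyBounded_gCoeff N (k + 1)).isExpSmall hτ, sSer, ← qser_const_mul]
  congr 1
  funext p
  have h2 : ((p.2 : ℂ) + 1) ≠ 0 := by exact_mod_cast p.2.succ_ne_zero
  rw [gCoeff, sCoeff, mul_pow, show N - 1 = (N - 1 - (k + 1)) + (k + 1) by omega, pow_add,
    Nat.add_sub_cancel]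
  field_simp

/-! ### Regularized integrals over the unit interval -/

/-- `f` is continuous on `(0,1)` and `v` is the regularized value of `∫₀¹ f`. -/
def HasReg (f : ℝ → ℂ) (v : ℂ) : Prop :=
  ContinuousOn f (Set.Ioo 0 1) ∧ ∃ c₀ c₁, LogAsymp (fun ε => ∫ t in ε..1 - ε, f t) c₀ c₁ ∧
    v = c₀ - c₁ * Complex.log (-(2 * π * I))

theorem HasReg.add {f g : ℝ → ℂ} {v w : ℂ} (hf : HasReg f v) (hg : HasReg g w) :
    HasReg (fun t => f t + g t) (v + w) := by
  obtain ⟨hfc, a, b, h, rfl⟩ := hf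
  obtain ⟨hgc, c, d, h', rfl⟩ := hg
  exact ⟨hfc.add hgc, _, _, logAsymp_integral_add hfc hgc h h', by ring⟩

theorem HasReg.const_mul {f : ℝ → ℂ} {v : ℂ} (hf : HasReg f v) (x : ℂ) :
    HasReg (fun t => x * f t) (x * v) := by
  obtain ⟨hfc, a, b, h, rfl⟩ := hf
  exact ⟨continuousOn_const.mul hfc, _, _, logAsymp_integral_const_mul h x, by ring⟩

theorem HasReg.congr {f g : ℝ → ℂ} {v : ℂ} (hf : HasReg f v)
    (h : ∀ t ∈ Set.Ioo (0 : ℝ) 1, f t = g t) : HasReg g v := by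
  obtain ⟨hfc, a, b, h', rfl⟩ := hf
  exact ⟨hfc.congr fun t ht => (h t ht).symm, _, _, logAsymp_integral_congr h' h, rfl⟩

theorem hasReg_of_continuousOn {g : ℝ → ℂ} (hg : ContinuousOn g (Set.Icc 0 1)) :
    HasReg g (∫ t in (0 : ℝ)..1, g t) :=
  ⟨hg.mono Set.Ioo_subset_Icc_self, _, _, logAsymp_of_continuous hg, by ring⟩

theorem one_sub_mem_Ioo {t : ℝ} (ht : t ∈ Set.Ioo (0 : ℝ) 1) : 1 - t ∈ Set.Ioo (0 : ℝ) 1 :=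
  ⟨by linarith [ht.2], by linarith [ht.1]⟩

/-- Folding an integral along `t ↦ 1 - t`. -/
theorem HasReg.fold {S a b : ℝ → ℂ} {v : ℂ} (hS : ContinuousOn S (Set.Ioo 0 1)) (ha : Continuous a)
    (hb : Continuous b) (h : HasReg (fun t => S t * (a t + b (1 - t))) v) :
    HasReg (fun t => S t * a t + S (1 - t) * b t) v := by
  have hS' : ContinuousOn (fun t => S (1 - t)) (Set.Ioo 0 1) :=
    hS.comp (by fun_prop) fun t ht => one_sub_mem_Ioo ht
  obtain ⟨_, c₀, c₁, h, rfl⟩ := h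
  have j1 : ContinuousOn (fun t => S t * a t) (Set.Ioo 0 1) := hS.mul ha.continuousOn
  have j2 : ContinuousOn (fun t => S t * b (1 - t)) (Set.Ioo 0 1) :=
    hS.mul (by fun_prop : Continuous fun t => b (1 - t)).continuousOn
  have j3 : ContinuousOn (fun t => S (1 - t) * b t) (Set.Ioo 0 1) := hS'.mul hb.continuousOn
  refine ⟨j1.add j3, c₀, c₁, h.congr fun ε h0 h1 => ?_, rfl⟩
  have i1 := trunc_intervalIntegrable j1 h0 h1
  have i2 := trunc_intervalIntegrable j2 h0 h1
  have i3 := trunc_intervalIntegrable j3 h0 h1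
  rw [intervalIntegral.integral_add i1 i3]
  have h2 := intervalIntegral.integral_comp_sub_left (a := ε) (b := 1 - ε)
    (fun t : ℝ => S t * b (1 - t)) 1
  simp only [sub_sub_cancel] at h2
  rw [h2, ← intervalIntegral.integral_add i1 i2]
  exact intervalIntegral.integral_congr fun t _ => by ring

/-! ### Polynomials against exponentials -/

open Polynomial in
/-- The linear functional with `t^p ↦ (-1)^p p! / c^(p+1)`; it is minus the boundary contribution
at `0` of `∫ P(t) e^(ct) dt`. -/
noncomputable def bdryZero (c : ℂ) : ℂ[X] →ₗ[ℂ] ℂ :=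
  Polynomial.lsum fun p => ((-1) ^ p * (p.factorial : ℂ) / c ^ (p + 1)) • LinearMap.id

theorem bdryZero_monomial (c : ℂ) (p : ℕ) (a : ℂ) : bdryZero c (Polynomial.monomial p a) =
    (-1) ^ p * (p.factorial : ℂ) / c ^ (p + 1) * a := by
  rw [bdryZero, Polynomial.lsum_apply, Polynomial.sum_monomial_index] <;> simp

theorem bdryZero_X_pow (c : ℂ) (p : ℕ) : bdryZero c (Polynomial.X ^ p) =
    (-1) ^ p * (p.factorial : ℂ) / c ^ (p + 1) := by
  rw [← Polynomial.monomial_one_right_eq_X_pow, bdryZero_monomial, mul_one]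

theorem bdryZero_C_mul (c a : ℂ) (P : Polynomial ℂ) :
    bdryZero c (Polynomial.C a * P) = a * bdryZero c P := by
  rw [← Polynomial.smul_eq_C_mul, map_smul, smul_eq_mul]

/-- The boundary contribution at `1` is that at `0` for the translated polynomial. Expressing both
ends by one functional is what lets boundary terms of neighbouring unit intervals be combined. -/
theorem bdryZero_X_add_one_pow (c : ℂ) (p : ℕ) :
    bdryZero c ((Polynomial.X + 1) ^ p) = bdry p c := by
  rw [add_pow, map_sum, bdry]
  refine Finset.sum_congr rfl fun s _ => ?_
  rw [one_pow, mul_one, mul_comm, ← Polynomial.C_eq_natCast, bdryZero_C_mul, bdryZero_X_pow,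
    Nat.descFactorial_eq_factorial_mul_choose]
  push_cast
  ring

theorem integral_eval_mul_cexp (P : Polynomial ℂ) {c : ℂ} (hc : c ≠ 0) :
    ∫ t in (0 : ℝ)..1, P.eval (t : ℂ) * cexp (c * t) =
      cexp c * bdryZero c (P.comp (Polynomial.X + 1)) - bdryZero c P := by
  induction P using Polynomial.induction_on' with
  | add P Q hP hQ =>
    simp only [Polynomial.eval_add, add_mul, Polynomial.add_comp, map_add]
    rw [intervalIntegral.integral_add, hP, hQ]
    · ring
    · apply Continuous.intervalIntegrable; fun_prop
    · apply Continuous.intervalIntegrable; fun_prop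
  | monomial n a =>
    simp only [Polynomial.eval_monomial, Polynomial.monomial_comp, bdryZero_C_mul,
      bdryZero_X_add_one_pow, bdryZero_monomial, mul_assoc]
    rw [intervalIntegral.integral_const_mul, integral_pow_mul_cexp n hc]
    ring

theorem bdryZero_mul_X_pow (c : ℂ) (n s : ℕ) (K : ℂ) :
    bdryZero c ((Polynomial.X + Polynomial.C K) ^ n * Polynomial.X ^ s) =
      ∑ a ∈ Finset.range (n + 1), (n.choose a : ℂ) * K ^ (n - a) *
        ((-1) ^ (s + a) * ((s + a).factorial : ℂ) / c ^ (s + a + 1)) := by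
  rw [add_pow, Finset.sum_mul, map_sum]
  refine Finset.sum_congr rfl fun a _ => ?_
  rw [show (Polynomial.X ^ a * Polynomial.C K ^ (n - a) * (n.choose a : Polynomial ℂ)) *
      Polynomial.X ^ s = Polynomial.C ((n.choose a : ℂ) * K ^ (n - a)) * Polynomial.X ^ (s + a) by
    rw [Polynomial.C_mul, Polynomial.C_pow, Polynomial.C_eq_natCast]; ring,
    bdryZero_C_mul, bdryZero_X_pow]

/-! ### The coefficients `2πi m τ` -/

/-- `2πi(M+1)τ`. -/
noncomputable def freq (τ : ℂ) (M : ℕ) : ℂ := 2 * π * I * τ * ((M : ℂ) + 1)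

theorem freq_ne_zero (hτ : 0 < τ.im) (M : ℕ) : freq τ M ≠ 0 := by
  have h1 : τ ≠ 0 := fun h => by simp [h] at hτ
  have h2 : ((M : ℂ) + 1) ≠ 0 := by exact_mod_cast M.succ_ne_zero
  exact mul_ne_zero (mul_ne_zero two_pi_I_ne_zero' h1) h2

theorem cexp_freq_mul (τ : ℂ) (M : ℕ) (t : ℂ) : cexp (freq τ M * t) = ee (((M : ℂ) + 1) * (τ * t)) := by
  rw [ee, freq]; congr 1; ring

theorem cexp_freq (τ : ℂ) (M : ℕ) : cexp (freq τ M) = ee (((M : ℂ) + 1) * τ) := by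
  have := cexp_freq_mul τ M 1
  simpa using this

theorem bdryZero_freq_eq (τ : ℂ) (n s : ℕ) (p : ℕ × ℕ) :
    bdryZero (freq τ p.1)
      ((Polynomial.X + Polynomial.C ((p.2 : ℂ) + 1)) ^ n * Polynomial.X ^ s) =
      ∑ a ∈ Finset.range (n + 1), (n.choose a : ℂ) * ((-1) ^ (s + a) * ((s + a).factorial : ℂ) /
        (2 * π * I * τ) ^ (s + a + 1)) * sCoeff (n - a) (s + a + 1) p := by
  rw [bdryZero_mul_X_pow]
  refine Finset.sum_congr rfl fun a _ => ?_
  rw [freq, sCoeff, mul_pow _ ((p.1 : ℂ) + 1)]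
  field_simp

/-- The coefficients of the `q`-series attached to a polynomial `Z`. -/
noncomputable def bCoeff (τ : ℂ) (n : ℕ) (Z : Polynomial ℂ) (p : ℕ × ℕ) : ℂ :=
  bdryZero (freq τ p.1) ((Polynomial.X + Polynomial.C ((p.2 : ℂ) + 1)) ^ n * Z)

theorem bCoeff_add (τ : ℂ) (n : ℕ) (Z W : Polynomial ℂ) :
    bCoeff τ n (Z + W) = fun p => bCoeff τ n Z p + bCoeff τ n W p := by
  funext p
  rw [bCoeff, mul_add, map_add, bCoeff, bCoeff]

theorem bCoeff_C_mul (τ : ℂ) (n : ℕ) (x : ℂ) (Z : Polynomial ℂ) :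
    bCoeff τ n (Polynomial.C x * Z) = fun p => x * bCoeff τ n Z p := by
  funext p
  rw [bCoeff, mul_left_comm, bdryZero_C_mul, bCoeff]

theorem bCoeff_X_pow (τ : ℂ) (n s : ℕ) : bCoeff τ n (Polynomial.X ^ s) =
    fun p => ∑ a ∈ Finset.range (n + 1), (n.choose a : ℂ) *
      ((-1) ^ (s + a) * ((s + a).factorial : ℂ) /
        (2 * π * I * τ) ^ (s + a + 1)) * sCoeff (n - a) (s + a + 1) p := by
  funext p
  rw [bCoeff, bdryZero_freq_eq]

theorem polyBounded_bCoeff (τ : ℂ) (n : ℕ) (Z : Polynomial ℂ) : PolyBounded (bCoeff τ n Z) := by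
  induction Z using Polynomial.induction_on' with
  | add P Q hP hQ => rw [bCoeff_add]; exact PolyBounded.add hP hQ
  | monomial s x =>
    rw [← Polynomial.C_mul_X_pow_eq_monomial, bCoeff_C_mul, bCoeff_X_pow]
    refine PolyBounded.const_mul ?_ x
    exact PolyBounded.sum _ fun a _ => (polyBounded_sCoeff _ _).const_mul _

theorem hasSum_split {f : ℕ × ℕ → ℂ} {a : ℕ → ℂ} {b : ℕ × ℕ → ℂ} {x y : ℂ} (ha : HasSum a x)
    (hb : HasSum b y) (h0 : ∀ i, f (i, 0) = a i) (h1 : ∀ i j, f (i, j + 1) = b (i, j)) :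
    HasSum f (x + y) := by
  have hg1 : Function.Injective fun i : ℕ => (i, 0) := fun i j h => by simpa using h
  have hg2 : Function.Injective fun p : ℕ × ℕ => (p.1, p.2 + 1) := by
    rintro ⟨i, j⟩ ⟨k, l⟩ h; simpa using h
  have e1 : HasSum (fun p : ℕ × ℕ => if p.2 = 0 then f p else 0) x := by
    rw [← hg1.hasSum_iff]
    · exact ha.congr_fun fun i => by simp [h0]
    · rintro ⟨i, j⟩ hp
      have : j ≠ 0 := fun h => hp ⟨i, by simp [h]⟩
      simp [this]
  have e2 : HasSum (fun p : ℕ × ℕ => if p.2 = 0 then 0 else f p) y := by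
    rw [← hg2.hasSum_iff]
    · exact hb.congr_fun fun p => by simp [h1]
    · rintro ⟨i, j⟩ hp
      have : j = 0 := by
        by_contra h
        exact hp ⟨(i, j - 1), by simp; omega⟩
      simp [this]
  refine (e1.add e2).congr_fun fun p => ?_
  split_ifs <;> simp

/-! ### The kernel `q^t / (1 - q^t)` on the unit interval -/

/-- The function `t ↦ q^t / (1 - q^t)`. -/
noncomputable def bKernel (τ : ℂ) (t : ℝ) : ℂ := ee (τ * t) / (1 - ee (τ * t))

/-- The entire function `z ↦ (1 - q^z) / z`. -/
noncomputable def bDen (τ : ℂ) : ℂ → ℂ := fun z => -dslope (fun z => ee (τ * z)) 0 z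

theorem ne_zero_of_im_pos (hτ : 0 < τ.im) : τ ≠ 0 := fun h => by simp [h] at hτ

theorem mul_ofReal_im_pos (hτ : 0 < τ.im) {t : ℝ} (ht : 0 < t) : 0 < (τ * t).im := by
  simpa using mul_pos hτ ht

theorem differentiable_ee_mul (τ : ℂ) : Differentiable ℂ fun z => ee (τ * z) := by
  unfold ee; fun_prop

theorem hasDerivAt_ee_mul (τ z : ℂ) :
    HasDerivAt (fun z => ee (τ * z)) (2 * π * I * τ * ee (τ * z)) z := by
  have := (((hasDerivAt_id z).const_mul τ).const_mul (2 * π * I)).cexp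
  simp only [id, mul_one] at this
  convert! this using 1
  rw [ee]; ring

theorem differentiable_bDen (τ : ℂ) : Differentiable ℂ (bDen τ) := by
  have h : DifferentiableOn ℂ (dslope (fun z => ee (τ * z)) 0) Set.univ :=
    (Complex.differentiableOn_dslope univ_mem).mpr (differentiable_ee_mul τ).differentiableOn
  exact (differentiableOn_univ.mp h).neg

theorem bDen_zero (τ : ℂ) : bDen τ 0 = -(2 * π * I * τ) := by
  rw [bDen, dslope_same, (hasDerivAt_ee_mul τ 0).deriv, mul_zero, ee_zero, mul_one]

theorem mul_bDen (τ z : ℂ) : z * bDen τ z = 1 - ee (τ * z) := by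
  have h := sub_smul_dslope (fun z => ee (τ * z)) 0 z
  simp only [sub_zero, smul_eq_mul, mul_zero, ee_zero] at h
  rw [bDen, mul_neg, h]; ring

theorem bDen_ne_zero (hτ : 0 < τ.im) {t : ℝ} (ht : 0 ≤ t) : bDen τ t ≠ 0 := by
  rcases ht.eq_or_lt with rfl | ht
  · rw [Complex.ofReal_zero, bDen_zero]
    exact neg_ne_zero.mpr (mul_ne_zero two_pi_I_ne_zero' (ne_zero_of_im_pos hτ))
  · intro h
    have h1 := mul_bDen τ t
    rw [h, mul_zero] at h1
    exact ee_ne_one (mul_ofReal_im_pos hτ ht) (sub_eq_zero.mp h1.symm).symm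

/-- The function `t ↦ t q^t / (1 - q^t)`, extended to `t = 0`. -/
noncomputable def bKernelReg (τ : ℂ) (t : ℝ) : ℂ := ee (τ * t) / bDen τ t

theorem bKernelReg_eq (τ : ℂ) {t : ℝ} (ht : 0 < t) : bKernelReg τ t = t * bKernel τ t := by
  have h0 : (t : ℂ) ≠ 0 := by exact_mod_cast ht.ne'
  rw [bKernelReg, bKernel, ← mul_bDen]
  field_simp

theorem continuousOn_bKernelReg (hτ : 0 < τ.im) : ContinuousOn (bKernelReg τ) (Set.Icc 0 1) := by
  have h1 : Continuous fun t : ℝ => bDen τ t :=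
    (differentiable_bDen τ).continuous.comp Complex.continuous_ofReal
  have h2 : Continuous fun t : ℝ => ee (τ * t) := by unfold ee; fun_prop
  exact h2.continuousOn.div h1.continuousOn fun t ht => bDen_ne_zero hτ ht.1

theorem continuousOn_bKernel (hτ : 0 < τ.im) : ContinuousOn (bKernel τ) (Set.Ioi 0) := by
  have h2 : Continuous fun t : ℝ => ee (τ * t) := by unfold ee; fun_prop
  refine h2.continuousOn.div (continuous_const.sub h2).continuousOn fun t ht => ?_
  exact sub_ne_zero.mpr (ee_ne_one (mul_ofReal_im_pos hτ ht)).symm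

theorem exists_norm_bKernel_le (hτ : 0 < τ.im) :
    ∃ C : ℝ, 0 ≤ C ∧ ∀ t ∈ Set.Ioo (0 : ℝ) 1, ‖bKernel τ t‖ ≤ C * (1 / t) := by
  obtain ⟨C, hC⟩ := isCompact_Icc.exists_bound_of_continuousOn (continuousOn_bKernelReg hτ)
  refine ⟨C, (norm_nonneg _).trans (hC 0 (by simp)), fun t ht => ?_⟩
  have h := hC t (Set.Ioo_subset_Icc_self ht)
  rw [bKernelReg_eq τ ht.1, norm_mul, Complex.norm_real, Real.norm_of_nonneg ht.1.le] at h
  rw [mul_one_div, le_div_iff₀ ht.1, mul_comm]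
  exact h

/-- The arguments are `-π/2` and a number in `[0, π]`, so their sum stays within the principal
branch. -/
theorem log_neg_two_pi_I_mul_of_im_pos (hτ : 0 < τ.im) :
    Complex.log (-(2 * π * I * τ)) = Complex.log (-(2 * π * I)) + Complex.log τ := by
  have h0 : (-(2 * π * I) : ℂ) ≠ 0 := neg_ne_zero.mpr two_pi_I_ne_zero'
  have h1 : Complex.arg (-(2 * π * I)) = -(π / 2) := by
    rw [show (-(2 * π * I) : ℂ) = ((2 * π : ℝ) : ℂ) * (-I) by push_cast; ring,
      Complex.arg_real_mul _ (by positivity), Complex.arg_neg_I]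
  rw [← neg_mul, Complex.log_mul_eq_add_log_iff h0 (ne_zero_of_im_pos hτ), h1]
  have h2 : 0 ≤ Complex.arg τ := Complex.arg_nonneg_iff.mpr hτ.le
  have h3 := Complex.arg_le_pi τ
  have := Real.pi_pos
  exact ⟨by linarith, by linarith⟩

theorem one_sub_ee_mem_slitPlane {z : ℂ} (hz : 0 < z.im) : 1 - ee z ∈ Complex.slitPlane := by
  rw [sub_eq_add_neg]
  exact Complex.mem_slitPlane_of_norm_lt_one (by rw [norm_neg]; exact norm_ee_lt_one hz)

/-- A primitive is `-log(1 - q^t)/(2πiτ)`. Near `0` one has `1 - q^ε = ε · bDen(ε)` with `bDen(0) =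
-2πiτ`; after regularization removes `log(-2πi)`, precisely `log τ` is left over. -/
theorem hasReg_bKernel (hτ : 0 < τ.im) : HasReg (bKernel τ)
    (1 / (2 * π * I * τ) * (Complex.log τ - Complex.log (1 - ee τ))) := by
  have hw : (2 * π * I * τ : ℂ) ≠ 0 := mul_ne_zero two_pi_I_ne_zero' (ne_zero_of_im_pos hτ)
  obtain ⟨g, hg⟩ : ∃ g : ℂ → ℂ, g = fun z => -(1 / (2 * π * I * τ)) * Complex.log (1 - ee (τ * z)) :=
    ⟨_, rfl⟩
  have hd : ∀ t : ℝ, 0 < t → HasDerivAt g (bKernel τ t) t := by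
    intro t ht
    have h1 := ((hasDerivAt_ee_mul τ t).const_sub 1).clog
      (one_sub_ee_mem_slitPlane (mul_ofReal_im_pos hτ ht))
    have h2 := h1.const_mul (-(1 / (2 * π * I * τ)))
    rw [hg]
    convert! h2 using 1
    rw [bKernel]
    field_simp
    rw [mul_div_mul_left _ _ (ne_zero_of_im_pos hτ)]
  have hFTC : ∀ ε : ℝ, 0 < ε → ε < 1 / 2 →
      ∫ t in ε..1 - ε, bKernel τ t = g ((1 - ε : ℝ) : ℂ) - g ε := by
    intro ε h0 h1
    refine intervalIntegral.integral_eq_sub_of_hasDerivAt (f := fun t : ℝ => g t) ?_ ?_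
    · intro t ht
      rw [Set.uIcc_of_le (by linarith)] at ht
      exact (hd t (by linarith [ht.1])).comp_ofReal
    · refine ((continuousOn_bKernel hτ).mono ?_).intervalIntegrable
      rw [Set.uIcc_of_le (by linarith)]
      exact fun t ht => lt_of_lt_of_le h0 ht.1
  have hslit : -(2 * π * I * τ) ∈ Complex.slitPlane := by
    left
    simp only [Complex.neg_re, Complex.mul_re, Complex.mul_im]
    simp
    positivity
  have ho : Tendsto (fun ε : ℝ => (ε : ℂ)) (𝓝[>] 0) (𝓝 0) := by
    have := Complex.continuous_ofReal.tendsto 0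
    exact (this.mono_left nhdsWithin_le_nhds).trans (by simp)
  have ho1 : Tendsto (fun ε : ℝ => ((1 - ε : ℝ) : ℂ)) (𝓝[>] 0) (𝓝 ((1 : ℝ) : ℂ)) := by
    push_cast
    simpa using ho.const_sub 1
  have hO : (fun ε : ℝ => (ε : ℂ)) =O[𝓝[>] 0] fun ε : ℝ => ε ^ (1 / 2 : ℝ) :=
    (IsBigO.of_norm_left (by simpa using isBigO_id_sqrt.norm_left))
  have hO1 : (fun ε : ℝ => g ((1 - ε : ℝ) : ℂ) - g ((1 : ℝ) : ℂ)) =O[𝓝[>] 0]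
      fun ε : ℝ => ε ^ (1 / 2 : ℝ) := by
    have h1 := ((hd 1 one_pos).differentiableAt.isBigO_sub).comp_tendsto ho1
    refine IsBigO.trans (h1.trans ?_) hO
    refine (IsBigO.of_norm_left (isBigO_of_le _ fun ε => ?_))
    simp
  have hO0 : (fun ε : ℝ => Complex.log (bDen τ ε) - Complex.log (bDen τ 0)) =O[𝓝[>] 0]
      fun ε : ℝ => ε ^ (1 / 2 : ℝ) := by
    have h1 : DifferentiableAt ℂ (fun z => Complex.log (bDen τ z)) 0 :=
      (differentiable_bDen τ 0).clog (by rw [bDen_zero]; exact hslit)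
    refine IsBigO.trans (h1.isBigO_sub.comp_tendsto ho) ?_
    simpa [Function.comp_def] using hO
  have hlog : ∀ ε : ℝ, 0 < ε → g ε = -(1 / (2 * π * I * τ)) *
      (Real.log ε + Complex.log (bDen τ ε)) := by
    intro ε h0
    rw [hg, ← Complex.log_ofReal_mul h0 (bDen_ne_zero hτ h0.le), mul_bDen]
  refine ⟨(continuousOn_bKernel hτ).mono fun t ht => ht.1,
    g ((1 : ℝ) : ℂ) + 1 / (2 * π * I * τ) * Complex.log (bDen τ 0), 1 / (2 * π * I * τ), ?_, ?_⟩
  · refine LogAsymp.congr (J := fun ε => g ((1 - ε : ℝ) : ℂ) + 1 / (2 * π * I * τ) *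
      (Real.log ε + Complex.log (bDen τ ε))) ?_ fun ε h0 h1 => ?_
    · refine (hO1.add (hO0.const_mul_left (1 / (2 * π * I * τ)))).congr_left fun ε => ?_
      ring
    · rw [hFTC ε h0 h1, hlog ε h0]; ring
  · rw [bDen_zero, log_neg_two_pi_I_mul_of_im_pos hτ, hg, Complex.ofReal_one]
    simp only [mul_one]
    ring

/-! ### Laurent polynomials in `τ` -/

/-- `f` is a Laurent polynomial on the upper half-plane. -/
def IsLaurent (f : ℂ → ℂ) : Prop := ∃ p : ℤ →₀ ℂ, ∀ τ : ℂ, 0 < τ.im → f τ = laurentLog p 0 τ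

theorem isLaurent_zpow (k : ℤ) (a : ℂ) : IsLaurent fun τ => a * τ ^ k :=
  ⟨Finsupp.single k a, fun τ _ => by rw [laurentLog_single]; ring⟩

theorem laurentLog_add (p p' : ℤ →₀ ℂ) (c c' τ : ℂ) :
    laurentLog (p + p') (c + c') τ = laurentLog p c τ + laurentLog p' c' τ := by
  rw [laurentLog, Finsupp.sum_add_index' (by simp) (by intros; ring), laurentLog, laurentLog]
  ring

theorem IsLaurent.add {f g : ℂ → ℂ} (hf : IsLaurent f) (hg : IsLaurent g) :
    IsLaurent fun τ => f τ + g τ := by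
  obtain ⟨p, hp⟩ := hf
  obtain ⟨p', hp'⟩ := hg
  refine ⟨p + p', fun τ hτ => ?_⟩
  have := laurentLog_add p p' 0 0 τ
  rw [add_zero] at this
  simp only [hp τ hτ, hp' τ hτ, this]

theorem IsLaurent.mul_zpow {f : ℂ → ℂ} (hf : IsLaurent f) (k : ℤ) (a : ℂ) :
    IsLaurent fun τ => a * τ ^ k * f τ := by
  obtain ⟨p, hp⟩ := hf
  refine ⟨∑ i ∈ p.support, Finsupp.single (k + i) (a * p i), fun τ hτ => ?_⟩
  rw [laurentLog_sum_single]
  simp only [hp τ hτ, laurentLog, Finsupp.sum, zero_mul, add_zero,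
    Finset.mul_sum]
  refine Finset.sum_congr rfl fun i _ => ?_
  rw [zpow_add₀ (ne_zero_of_im_pos hτ)]
  ring

/-- The factor `X` raises the power of `1/M` to at least two, so the sums over `M` converge; they
are zeta values times negative powers of `τ`. -/
theorem exists_hasSum_bdryZero (P : Polynomial ℂ) : ∃ L : ℂ → ℂ, IsLaurent L ∧
    ∀ τ : ℂ, 0 < τ.im → HasSum (fun M => bdryZero (freq τ M) (Polynomial.X * P)) (L τ) := by
  induction P using Polynomial.induction_on' with
  | add P Q hP hQ =>
    obtain ⟨L, h1, h2⟩ := hP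
    obtain ⟨L', h1', h2'⟩ := hQ
    refine ⟨_, h1.add h1', fun τ hτ => ?_⟩
    simp only [mul_add, map_add]
    exact (h2 τ hτ).add (h2' τ hτ)
  | monomial s x =>
    obtain ⟨y, hy⟩ : ∃ y : ℂ, HasSum (fun M : ℕ => 1 / ((M : ℂ) + 1) ^ (s + 2)) y := by
      have h1 : Summable fun M : ℕ => (1 : ℝ) / (M : ℝ) ^ (s + 2) :=
        Real.summable_one_div_nat_pow.mpr (by omega)
      have h2 := (summable_nat_add_iff 1).mpr h1
      refine ⟨_, (Summable.of_norm_bounded h2 fun M => ?_).hasSum⟩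
      rw [norm_div, norm_one, norm_pow, ← Nat.cast_add_one, Complex.norm_natCast]
    refine ⟨fun τ => x * ((-1) ^ (s + 1) * ((s + 1).factorial : ℂ)) /
      (2 * π * I) ^ (s + 2) * y * τ ^ (-((s : ℤ) + 2)), isLaurent_zpow _ _, fun τ hτ => ?_⟩
    have h := hy.mul_left (x * ((-1) ^ (s + 1) * ((s + 1).factorial : ℂ)) /
      (2 * π * I) ^ (s + 2) * τ ^ (-((s : ℤ) + 2)))
    have hterm : ∀ M : ℕ, bdryZero (freq τ M) (Polynomial.X * Polynomial.monomial s x) =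
        x * ((-1) ^ (s + 1) * ((s + 1).factorial : ℂ)) / (2 * π * I) ^ (s + 2) *
          τ ^ (-((s : ℤ) + 2)) * (1 / ((M : ℂ) + 1) ^ (s + 2)) := by
      intro M
      have e : Polynomial.X * Polynomial.monomial s x = Polynomial.C x * Polynomial.X ^ (s + 1) := by
        rw [← Polynomial.C_mul_X_pow_eq_monomial]; ring
      have e2 : τ ^ (-((s : ℤ) + 2)) = 1 / τ ^ (s + 2) := by
        rw [zpow_neg, one_div]; norm_cast
      rw [e, bdryZero_C_mul, bdryZero_X_pow, freq, e2, mul_pow, mul_pow]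
      simp only [div_eq_mul_inv, mul_inv]
      ring
    simp only [hterm]
    rwa [mul_right_comm _ _ y] at h

/-! ### The kernel against a polynomial -/

theorem sum_ee_mul_eq (hτ : 0 < τ.im) {t : ℝ} (ht : 0 < t) (N : ℕ) :
    ∑ M ∈ Finset.range N, ee (((M : ℂ) + 1) * (τ * t)) =
      bKernel τ t * (1 - ee (τ * t) ^ N) := by
  have hne : 1 - ee (τ * t) ≠ 0 :=
    sub_ne_zero.mpr (ee_ne_one (mul_ofReal_im_pos hτ ht)).symm
  have h1 : ∀ M : ℕ, ee (((M : ℂ) + 1) * (τ * t)) = ee (τ * t) * ee (τ * t) ^ M := fun M => by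
    rw [add_mul, one_mul, ee_add, ee_nat_mul, mul_comm]
  simp only [h1]
  rw [← Finset.mul_sum, geom_sum_eq (sub_ne_zero.mp hne).symm, bKernel]
  rw [← neg_sub 1 (ee (τ * t)), ← neg_sub 1 (ee (τ * t) ^ N), neg_div_neg_eq]
  ring

theorem hasSum_ee_mul (hτ : 0 < τ.im) {t : ℝ} (ht : 0 < t) :
    HasSum (fun M : ℕ => ee (((M : ℂ) + 1) * (τ * t))) (bKernel τ t) := by
  have h1 : ∀ M : ℕ, ee (((M : ℂ) + 1) * (τ * t)) = ee (τ * t) * ee (τ * t) ^ M := fun M => by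
    rw [add_mul, one_mul, ee_add, ee_nat_mul, mul_comm]
  simp only [h1]
  exact (hasSum_geometric_of_norm_lt_one (norm_ee_lt_one (mul_ofReal_im_pos hτ ht))).mul_left _

theorem summable_row (hτ : 0 < τ.im) {c : ℕ × ℕ → ℂ} (hc : PolyBounded c) :
    Summable fun M : ℕ => c (M, 0) * ee (((M : ℂ) + 1) * τ) := by
  have h := (hc.summable hτ).comp_injective
    (i := fun M : ℕ => (M, 0)) fun i j h => by simpa using h
  refine h.congr fun M => ?_
  simp

/-- The kernel is expanded as a geometric series and integrated termwise: the boundary at `1` gives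
the `q`-series, the boundary at `0` sums to `l`. -/
theorem integral_bKernelReg_mul (hτ : 0 < τ.im) (P : Polynomial ℂ) {l : ℂ}
    (hl : HasSum (fun M => bdryZero (freq τ M) (Polynomial.X * P)) l) :
    ∫ t in (0 : ℝ)..1, bKernelReg τ t * P.eval (t : ℂ) =
      (∑' M : ℕ, bdryZero (freq τ M) ((Polynomial.X * P).comp (Polynomial.X + 1)) *
        ee (((M : ℂ) + 1) * τ)) - l := by
  have hs : Summable fun M : ℕ => bdryZero (freq τ M)
      ((Polynomial.X * P).comp (Polynomial.X + 1)) * ee (((M : ℂ) + 1) * τ) := by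
    have := summable_row hτ (polyBounded_bCoeff τ 0 ((Polynomial.X * P).comp (Polynomial.X + 1)))
    simpa [bCoeff] using this
  have h1 := (hs.hasSum.sub hl).tendsto_sum_nat
  refine tendsto_nhds_unique ?_ h1
  have hterm : ∀ M : ℕ, bdryZero (freq τ M) ((Polynomial.X * P).comp (Polynomial.X + 1)) *
      ee (((M : ℂ) + 1) * τ) - bdryZero (freq τ M) (Polynomial.X * P) =
      ∫ t in (0 : ℝ)..1, (Polynomial.X * P).eval (t : ℂ) * ee (((M : ℂ) + 1) * (τ * t)) := by
    intro M
    rw [← cexp_freq, mul_comm, ← integral_eval_mul_cexp _ (freq_ne_zero hτ M)]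
    simp only [cexp_freq_mul]
  have hsum : ∀ N : ℕ, ∑ M ∈ Finset.range N, (bdryZero (freq τ M)
      ((Polynomial.X * P).comp (Polynomial.X + 1)) *
      ee (((M : ℂ) + 1) * τ) - bdryZero (freq τ M) (Polynomial.X * P)) =
      ∫ t in (0 : ℝ)..1, ∑ M ∈ Finset.range N,
        (Polynomial.X * P).eval (t : ℂ) * ee (((M : ℂ) + 1) * (τ * t)) := by
    intro N
    rw [intervalIntegral.integral_finsetSum]
    · exact Finset.sum_congr rfl fun M _ => hterm M
    · intro M _
      apply Continuous.intervalIntegrable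
      unfold ee; fun_prop
  simp only [hsum]
  have hK := continuousOn_bKernelReg hτ
  have hP : Continuous fun t : ℝ => P.eval (t : ℂ) := by fun_prop
  -- The partial sums equal `1 - q^(Nt)` times the limit function, hence are dominated by twice its
  -- norm.
  refine intervalIntegral.tendsto_integral_filter_of_dominated_convergence
    (fun t => 2 * ‖bKernelReg τ t * P.eval (t : ℂ)‖) ?_ ?_ ?_ ?_
  · refine Eventually.of_forall fun N => Continuous.aestronglyMeasurable ?_
    unfold ee; fun_prop
  · refine Eventually.of_forall fun N => Eventually.of_forall fun t ht => ?_
    rw [Set.uIoc_of_le zero_le_one] at ht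
    rw [← Finset.mul_sum, sum_ee_mul_eq hτ ht.1, Polynomial.eval_mul, Polynomial.eval_X,
      bKernelReg_eq τ ht.1, show (t : ℂ) * P.eval (t : ℂ) * (bKernel τ t * (1 - ee (τ * t) ^ N)) =
        (1 - ee (τ * t) ^ N) * (t * bKernel τ t * P.eval (t : ℂ)) by ring, norm_mul]
    refine mul_le_mul_of_nonneg_right ((norm_sub_le _ _).trans ?_) (norm_nonneg _)
    rw [norm_one, norm_pow]
    have := pow_le_one₀ (n := N) (norm_nonneg _)
      (norm_ee_lt_one (mul_ofReal_im_pos hτ ht.1)).le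
    linarith
  · refine ContinuousOn.intervalIntegrable ?_
    rw [Set.uIcc_of_le zero_le_one]
    exact continuousOn_const.mul (hK.mul hP.continuousOn).norm
  · refine Eventually.of_forall fun t ht => ?_
    rw [Set.uIoc_of_le zero_le_one] at ht
    have h2 := ((hasSum_ee_mul hτ ht.1).tendsto_sum_nat).const_mul
      ((Polynomial.X * P).eval (t : ℂ))
    simp only [Finset.mul_sum] at h2
    convert h2 using 2
    rw [bKernelReg_eq τ ht.1, Polynomial.eval_mul, Polynomial.eval_X]
    ring

/-- The regularized value of `∫₀¹ P(t) q^t / (1 - q^t) dt`. -/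
theorem hasReg_bKernel_mul (hτ : 0 < τ.im) (P : Polynomial ℂ) {l : ℂ}
    (hl : HasSum (fun M => bdryZero (freq τ M) (Polynomial.X * P.divX)) l) :
    HasReg (fun t => bKernel τ t * P.eval (t : ℂ))
      (P.coeff 0 * Complex.log τ / (2 * π * I * τ) - l +
        ∑' M : ℕ, bdryZero (freq τ M) (P.comp (Polynomial.X + 1)) * ee (((M : ℂ) + 1) * τ)) := by
  have h1 := (hasReg_bKernel hτ).const_mul (P.coeff 0)
  have h2 := hasReg_of_continuousOn (g := fun t => bKernelReg τ t * P.divX.eval (t : ℂ))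
    ((continuousOn_bKernelReg hτ).mul (by fun_prop))
  have hfun := (h1.add h2).congr (g := fun t => bKernel τ t * P.eval (t : ℂ)) fun t ht => by
    conv_rhs => rw [← P.divX_mul_X_add]
    rw [bKernelReg_eq τ ht.1]
    simp
    ring
  convert hfun using 1
  rw [integral_bKernelReg_mul hτ _ hl]
  -- The constant term of `P` was integrated in closed form; the series of `-log(1-q)` puts its
  -- exponentially small part into the same shape as the other boundary terms at `1`.
  have hlog := (Complex.hasSum_taylorSeries_neg_log' (norm_ee_lt_one hτ)).mul_left
    (P.coeff 0 / (2 * π * I * τ))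
  have hs : Summable fun M : ℕ => bdryZero (freq τ M)
      ((Polynomial.X * P.divX).comp (Polynomial.X + 1)) * ee (((M : ℂ) + 1) * τ) := by
    have := summable_row hτ
      (polyBounded_bCoeff τ 0 ((Polynomial.X * P.divX).comp (Polynomial.X + 1)))
    simpa [bCoeff] using this
  have hadd := hlog.add hs.hasSum
  have hterm : ∀ M : ℕ, bdryZero (freq τ M) (P.comp (Polynomial.X + 1)) *
      ee (((M : ℂ) + 1) * τ) = P.coeff 0 / (2 * π * I * τ) * (ee τ ^ (M + 1) / (M + 1)) +
        bdryZero (freq τ M) ((Polynomial.X * P.divX).comp (Polynomial.X + 1)) *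
          ee (((M : ℂ) + 1) * τ) := by
    intro M
    have e : P = Polynomial.C (P.coeff 0) * Polynomial.X ^ 0 + Polynomial.X * P.divX := by
      conv_lhs => rw [← P.divX_mul_X_add]
      ring
    have e2 : ee (((M : ℂ) + 1) * τ) = ee τ ^ (M + 1) := by
      rw [← Nat.cast_add_one, ee_nat_mul]
    have e3 : bdryZero (freq τ M) (P.comp (Polynomial.X + 1)) =
        P.coeff 0 * (1 / freq τ M) +
          bdryZero (freq τ M) ((Polynomial.X * P.divX).comp (Polynomial.X + 1)) := by
      conv_lhs => rw [e]
      rw [Polynomial.add_comp, map_add, Polynomial.mul_comp, Polynomial.C_comp, pow_zero,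
        Polynomial.one_comp, ← pow_zero Polynomial.X, bdryZero_C_mul, bdryZero_X_pow]
      simp
    rw [e3, e2, freq, add_mul, ← div_div]
    ring
  rw [tsum_congr hterm, hadd.tsum_eq]
  ring

/-! ### The `q`-series of `ω_{n+1}` on the segment from `0` to `τ` -/

/-- The terms `q^(M(k+t)) (k+t)^n` with `k ≥ 1`. -/
noncomputable def bTerm (τ : ℂ) (n : ℕ) (p : ℕ × ℕ) (t : ℝ) : ℂ :=
  ee ((p.1 + 1) * (p.2 + 1) * τ + (p.1 + 1) * (τ * t)) * ((t : ℂ) + (p.2 + 1)) ^ n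

theorem continuous_bTerm (τ : ℂ) (n : ℕ) (p : ℕ × ℕ) : Continuous (bTerm τ n p) := by
  unfold bTerm ee; fun_prop

theorem norm_bTerm_le (hτ : 0 < τ.im) (n : ℕ) (p : ℕ × ℕ) {t : ℝ} (ht : t ∈ Set.Icc (0 : ℝ) 1) :
    ‖bTerm τ n p t‖ ≤ 2 ^ n * ‖sCoeff n 0 p * ee ((p.1 + 1) * (p.2 + 1) * τ)‖ := by
  have h1 : ‖ee (((p.1 : ℂ) + 1) * (τ * t))‖ ≤ 1 := by
    refine norm_ee_le_one ?_
    have : (((p.1 : ℂ) + 1) * (τ * t)).im = (p.1 + 1) * (τ.im * t) := by simp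
    rw [this]
    have := ht.1
    positivity
  have h2 : ‖(t : ℂ) + (p.2 + 1)‖ ≤ 2 * ‖(p.2 : ℂ) + 1‖ := by
    have e1 : (t : ℂ) + (p.2 + 1) = ((t + (p.2 + 1) : ℝ) : ℂ) := by push_cast; ring
    have e2 : (p.2 : ℂ) + 1 = ((p.2 + 1 : ℝ) : ℂ) := by push_cast; ring
    have h0 : (0 : ℝ) ≤ p.2 := Nat.cast_nonneg _
    rw [e1, e2, Complex.norm_real, Complex.norm_real, Real.norm_of_nonneg (by linarith [ht.1]),
      Real.norm_of_nonneg (by linarith)]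
    linarith [ht.2]
  rw [bTerm, ee_add, norm_mul, norm_mul, norm_pow, norm_mul, sCoeff, pow_zero, div_one, norm_pow]
  calc ‖ee ((p.1 + 1) * (p.2 + 1) * τ)‖ * ‖ee (((p.1 : ℂ) + 1) * (τ * t))‖ *
        ‖(t : ℂ) + (p.2 + 1)‖ ^ n
      ≤ ‖ee ((p.1 + 1) * (p.2 + 1) * τ)‖ * 1 * (2 * ‖(p.2 : ℂ) + 1‖) ^ n := by gcongr
    _ = _ := by rw [mul_pow]; ring

theorem summable_bTerm_bound (hτ : 0 < τ.im) (n : ℕ) : Summable fun p : ℕ × ℕ =>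
    2 ^ n * ‖sCoeff n 0 p * ee ((p.1 + 1) * (p.2 + 1) * τ)‖ :=
  ((polyBounded_sCoeff n 0).summable hτ).norm.mul_left _

/-- The series `∑_{M,k ≥ 1} q^(M(k+t)) (k+t)^n`. -/
noncomputable def bTail (τ : ℂ) (n : ℕ) (t : ℝ) : ℂ := ∑' p, bTerm τ n p t

theorem summable_bTerm (hτ : 0 < τ.im) (n : ℕ) {t : ℝ} (ht : t ∈ Set.Icc (0 : ℝ) 1) :
    Summable fun p => bTerm τ n p t :=
  Summable.of_norm_bounded (summable_bTerm_bound hτ n) fun p => norm_bTerm_le hτ n p ht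

theorem continuousOn_bTail (hτ : 0 < τ.im) (n : ℕ) : ContinuousOn (bTail τ n) (Set.Icc 0 1) :=
  continuousOn_tsum (fun p => (continuous_bTerm τ n p).continuousOn) (summable_bTerm_bound hτ n)
    fun p _ ht => norm_bTerm_le hτ n p ht

theorem integral_bTerm_mul (hτ : 0 < τ.im) (n : ℕ) (Q : Polynomial ℂ) (p : ℕ × ℕ) :
    ∫ t in (0 : ℝ)..1, bTerm τ n p t * Q.eval (t : ℂ) =
      bCoeff τ n (Q.comp (Polynomial.X + 1)) (p.1, p.2 + 1) *
          ee ((p.1 + 1) * (((p.2 + 1 : ℕ) : ℂ) + 1) * τ) -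
        bCoeff τ n Q p * ee ((p.1 + 1) * (p.2 + 1) * τ) := by
  have h1 : ∀ t : ℝ, bTerm τ n p t * Q.eval (t : ℂ) = ee ((p.1 + 1) * (p.2 + 1) * τ) *
      (((Polynomial.X + Polynomial.C ((p.2 : ℂ) + 1)) ^ n * Q).eval (t : ℂ) *
        cexp (freq τ p.1 * t)) := by
    intro t
    rw [bTerm, cexp_freq_mul, ee_add]
    simp only [Polynomial.eval_mul, Polynomial.eval_pow, Polynomial.eval_add, Polynomial.eval_X,
      Polynomial.eval_C]
    ring
  have h2 : ((Polynomial.X + Polynomial.C ((p.2 : ℂ) + 1)) ^ n * Q).comp (Polynomial.X + 1) =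
      (Polynomial.X + Polynomial.C (((p.2 + 1 : ℕ) : ℂ) + 1)) ^ n *
        Q.comp (Polynomial.X + 1) := by
    rw [Polynomial.mul_comp, Polynomial.pow_comp, Polynomial.add_comp, Polynomial.X_comp,
      Polynomial.C_comp]
    congr 2
    push_cast
    simp only [Polynomial.C_add, Polynomial.C_1]
    ring
  have h3 : ee ((p.1 + 1) * (((p.2 + 1 : ℕ) : ℂ) + 1) * τ) =
      ee ((p.1 + 1) * (p.2 + 1) * τ) * cexp (freq τ p.1) := by
    rw [cexp_freq, ← ee_add]
    congr 1
    push_cast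
    ring
  simp only [h1]
  rw [intervalIntegral.integral_const_mul, integral_eval_mul_cexp _ (freq_ne_zero hτ _), h2, h3,
    bCoeff, bCoeff]
  ring

theorem hasSum_integral_bTail (hτ : 0 < τ.im) (n : ℕ) (Q : Polynomial ℂ) :
    HasSum (fun p : ℕ × ℕ => bCoeff τ n (Q.comp (Polynomial.X + 1)) (p.1, p.2 + 1) *
          ee ((p.1 + 1) * (((p.2 + 1 : ℕ) : ℂ) + 1) * τ) -
        bCoeff τ n Q p * ee ((p.1 + 1) * (p.2 + 1) * τ))
      (∫ t in (0 : ℝ)..1, bTail τ n t * Q.eval (t : ℂ)) := by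
  have hQ : Continuous fun t : ℝ => Q.eval (t : ℂ) := by fun_prop
  obtain ⟨C, hC⟩ := isCompact_Icc.exists_bound_of_continuousOn (s := Set.Icc (0 : ℝ) 1)
    hQ.continuousOn
  have h := hasSum_integral_unit (F := fun p t => bTerm τ n p t * Q.eval (t : ℂ))
    (fun p => ((continuous_bTerm τ n p).mul hQ).continuousOn)
    ((summable_bTerm_bound hτ n).mul_right C)
    (fun p t ht => by
      rw [norm_mul]
      exact mul_le_mul (norm_bTerm_le hτ n p ht) (hC t ht) (norm_nonneg _) (by positivity))
  simp only [tsum_mul_right, integral_bTerm_mul hτ] at h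
  exact h

/-- The series `∑_{M ≥ 1, k ≥ 0} q^(M(k+t)) (k+t)^n`. -/
noncomputable def bFun (τ : ℂ) (n : ℕ) (t : ℝ) : ℂ := bKernel τ t * (t : ℂ) ^ n + bTail τ n t

theorem continuousOn_bFun (hτ : 0 < τ.im) (n : ℕ) : ContinuousOn (bFun τ n) (Set.Ioo 0 1) := by
  have h1 := (continuousOn_bKernel hτ).mono fun t (ht : t ∈ Set.Ioo (0 : ℝ) 1) => ht.1
  have h2 := (continuousOn_bTail hτ n).mono Set.Ioo_subset_Icc_self
  exact (h1.mul (by fun_prop)).add h2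

/-- The boundary at `1` of summand `k` and the boundary at `0` of summand `k + 1` both carry
`q^(M(k+1))` and the factor `(X+k+1)^n`, with `Q(X+1)` and `Q` respectively. Only the difference
survives; the unmatched boundary at `0` of `k = 0` gives `-l` and the logarithm. -/
theorem hasReg_bFun_mul (hτ : 0 < τ.im) (n : ℕ) (Q : Polynomial ℂ) {l : ℂ}
    (hl : HasSum (fun M => bdryZero (freq τ M) (Polynomial.X * (Polynomial.X ^ n * Q).divX)) l) :
    HasReg (fun t => bFun τ n t * Q.eval (t : ℂ))
      ((Polynomial.X ^ n * Q).coeff 0 * Complex.log τ / (2 * π * I * τ) - l +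
        qser (bCoeff τ n (Q.comp (Polynomial.X + 1) - Q)) τ) := by
  have h1 := hasReg_bKernel_mul hτ _ hl
  have h2 := hasReg_of_continuousOn (g := fun t => bTail τ n t * Q.eval (t : ℂ))
    ((continuousOn_bTail hτ n).mul (by fun_prop))
  have h3 := (h1.add h2).congr (g := fun t => bFun τ n t * Q.eval (t : ℂ)) fun t _ => by
    rw [bFun, Polynomial.eval_mul, Polynomial.eval_pow, Polynomial.eval_X]; ring
  convert h3 using 1
  rw [add_assoc]
  congr 1
  have hQ1 := polyBounded_bCoeff τ n (Q.comp (Polynomial.X + 1))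
  have hQ := polyBounded_bCoeff τ n Q
  have hD := polyBounded_bCoeff τ n (Q.comp (Polynomial.X + 1) - Q)
  have hrow : HasSum (fun M : ℕ => bCoeff τ n (Q.comp (Polynomial.X + 1)) (M, 0) *
      ee (((M : ℂ) + 1) * τ)) (∑' M : ℕ, bdryZero (freq τ M)
        ((Polynomial.X ^ n * Q).comp (Polynomial.X + 1)) * ee (((M : ℂ) + 1) * τ)) := by
    have e : ∀ M : ℕ, bdryZero (freq τ M)
        ((Polynomial.X ^ n * Q).comp (Polynomial.X + 1)) =
        bCoeff τ n (Q.comp (Polynomial.X + 1)) (M, 0) := by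
      intro M
      rw [bCoeff, Polynomial.mul_comp, Polynomial.pow_comp, Polynomial.X_comp]
      simp
    simp only [e]
    exact (summable_row hτ hQ1).hasSum
  have hrest := (hasSum_integral_bTail hτ n Q).add (hQ.summable hτ).hasSum
  simp only [sub_add_cancel] at hrest
  have hall := (hasSum_split (f := fun p => bCoeff τ n (Q.comp (Polynomial.X + 1)) p *
    ee ((p.1 + 1) * (p.2 + 1) * τ)) hrow hrest (fun i => by simp) (fun i j => rfl)).tsum_eq
  have e2 : bCoeff τ n (Q.comp (Polynomial.X + 1)) =
      fun p => bCoeff τ n Q p + bCoeff τ n (Q.comp (Polynomial.X + 1) - Q) p := by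
    rw [← bCoeff_add, add_sub_cancel]
  have e3 := qser_add hQ hD hτ
  rw [← e2, qser, hall, qser] at e3
  linear_combination -e3

/-- At `ξ = τt` one has `ρ = t`, so the exponential factor and the weight depend on `k ± t` in the
same way. In the second sum `k - t = (k-1) + (1-t)`, which reflects the first sum and makes `k`
start at `0`. -/
theorem lamCoeff_eq_bFun (hτ : 0 < τ.im) (n : ℕ) {t : ℝ} (ht : t ∈ Set.Ioo (0 : ℝ) 1) :
    lamCoeff τ (τ * t) t n = bFun τ n t - (-1) ^ n * bFun τ n (1 - t) := by
  have ht' := one_sub_mem_Ioo ht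
  have h1 := (hasSum_ee_mul hτ ht'.1).mul_left ((-1) ^ n * ((1 - t : ℝ) : ℂ) ^ n)
  have h2 := (summable_bTerm hτ n (Set.Ioo_subset_Icc_self ht')).hasSum.mul_left ((-1) ^ n)
  have h3 := hasSum_split (f := fun p : ℕ × ℕ =>
    ee ((p.1 + 1) * (p.2 + 1) * τ - (p.1 + 1) * (τ * t)) * ((t : ℂ) - (p.2 + 1)) ^ n) h1 h2
    (fun i => by
      rw [← mul_pow, mul_comm]
      push_cast
      congr 2 <;> ring)
    (fun i j => by
      rw [bTerm, mul_left_comm ((-1 : ℂ) ^ n), ← mul_pow]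
      push_cast
      congr 2 <;> ring)
  rw [lamCoeff, h3.tsum_eq, bFun, bFun, bKernel, bKernel, bTail, bTail]
  simp only [bTerm]
  push_cast
  ring

theorem omega_mul_eq (hτ : 0 < τ.im) (n : ℕ) {t : ℝ} (ht : t ∈ Set.Ioo (0 : ℝ) 1) :
    omega (n + 1) (τ * t) τ = 2 * π * I *
      (beta (n + 1) t - (bFun τ n t - (-1) ^ n * bFun τ n (1 - t)) / n.factorial) := by
  have him : (τ * t).im = τ.im * t := by simp
  have h := omega_succ (τ := τ) (ξ := τ * t) n (mul_ofReal_im_pos hτ ht.1).le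
    (ee_ne_one (mul_ofReal_im_pos hτ ht.1)) (by
      rw [him]; exact mul_lt_of_lt_one_right hτ ht.2)
  rw [him, mul_div_cancel_left₀ _ hτ.ne'] at h
  rw [h, lamCoeff_eq_bFun hτ n ht]

/-! ### Depth-one B-elliptic multiple zeta values -/

/-- The polynomial `t^m - (-1)^n (1-t)^m`. -/
noncomputable def foldPoly (n m : ℕ) : Polynomial ℂ :=
  Polynomial.X ^ m - Polynomial.C ((-1) ^ n) * (1 - Polynomial.X) ^ m

/-- The exponentially small part of `B_{n+1,m+1}`, up to normalization. -/
noncomputable def bSum (n m : ℕ) (τ : ℂ) : ℂ :=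
  ∑ s ∈ Finset.range m, (m.choose s : ℂ) * (1 + (-1) ^ (n + s)) *
    ∑ a ∈ Finset.range (n + 1), (n.choose a : ℂ) * ((-1) ^ (s + a) * ((s + a).factorial : ℂ) /
      (2 * π * I * τ) ^ (s + a + 1)) * sSer (n - a) (s + a + 1) τ

/-- Translation by one turns `1 - X` into `-X`, so both parts are binomial expansions without their
top term, with relative sign `(-1)^(n+s)`. -/
theorem foldPoly_comp_sub (n m : ℕ) :
    (foldPoly n m).comp (Polynomial.X + 1) - foldPoly n m =
      ∑ s ∈ Finset.range m, Polynomial.C ((m.choose s : ℂ) * (1 + (-1) ^ (n + s))) *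
        Polynomial.X ^ s := by
  have h1 : (foldPoly n m).comp (Polynomial.X + 1) - foldPoly n m =
      ((Polynomial.X + 1) ^ m - Polynomial.X ^ m) +
        Polynomial.C ((-1) ^ n) * ((-Polynomial.X + 1) ^ m - (-Polynomial.X) ^ m) := by
    simp only [foldPoly, Polynomial.sub_comp, Polynomial.mul_comp, Polynomial.pow_comp,
      Polynomial.X_comp, Polynomial.C_comp, Polynomial.one_comp]
    ring
  rw [h1, add_pow, add_pow, Finset.sum_range_succ, Finset.sum_range_succ]
  simp only [one_pow, mul_one, Nat.choose_self, Nat.cast_one, add_sub_cancel_right]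
  rw [Finset.mul_sum, ← Finset.sum_add_distrib]
  refine Finset.sum_congr rfl fun s _ => ?_
  rw [neg_pow, pow_add]
  simp only [Polynomial.C_mul, Polynomial.C_add, Polynomial.C_1, Polynomial.C_pow,
    Polynomial.C_neg, Polynomial.C_eq_natCast]
  ring

theorem qser_foldPoly (n m : ℕ) (hτ : 0 < τ.im) :
    qser (bCoeff τ n ((foldPoly n m).comp (Polynomial.X + 1) - foldPoly n m)) τ = bSum n m τ := by
  have h1 : bCoeff τ n ((foldPoly n m).comp (Polynomial.X + 1) - foldPoly n m) = fun p =>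
      ∑ s ∈ Finset.range m, (m.choose s : ℂ) * (1 + (-1) ^ (n + s)) *
        bCoeff τ n (Polynomial.X ^ s) p := by
    funext p
    rw [bCoeff, foldPoly_comp_sub, Finset.mul_sum, map_sum]
    refine Finset.sum_congr rfl fun s _ => ?_
    rw [mul_left_comm, bdryZero_C_mul, bCoeff]
  rw [h1, qser_sum (Finset.range m) (c := fun s p => (m.choose s : ℂ) * (1 + (-1) ^ (n + s)) *
        bCoeff τ n (Polynomial.X ^ s) p)
      (fun s _ => (polyBounded_bCoeff τ n (Polynomial.X ^ s)).const_mul _) hτ, bSum]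
  refine Finset.sum_congr rfl fun s _ => ?_
  rw [qser_const_mul, bCoeff_X_pow, qser_sum (Finset.range (n + 1)) (c := fun a p =>
      (n.choose a : ℂ) * ((-1) ^ (s + a) * ((s + a).factorial : ℂ) /
        (2 * π * I * τ) ^ (s + a + 1)) * sCoeff (n - a) (s + a + 1) p)
      (fun a _ => (polyBounded_sCoeff (n - a) (s + a + 1)).const_mul _) hτ]
  congr 1
  refine Finset.sum_congr rfl fun a _ => ?_
  rw [qser_const_mul, sSer]

/-- The exponentially small part of `B_{n+1,m+1}`. -/
noncomputable def bExp (n m : ℕ) (τ : ℂ) : ℂ :=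
  -((2 * π * I) ^ (m + 1) / (m.factorial * n.factorial)) * (τ ^ (n + 1) * bSum n m τ)

theorem isExpSmall_bExp (n m : ℕ) : IsExpSmall (bExp n m) := by
  refine IsExpSmall.const_mul ?_ _
  have h : IsExpSmall (bSum n m) := by
    refine IsExpSmall.sum _ fun s _ => (IsExpSmall.sum _ fun a _ => ?_).const_mul _
    have h1 := ((isExpSmall_sSer (n - a) (s + a + 1)).zpow_mul (-((s + a + 1 : ℕ) : ℤ))).const_mul
      ((n.choose a : ℂ) * ((-1) ^ (s + a) * ((s + a).factorial : ℂ) / (2 * π * I) ^ (s + a + 1)))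
    refine h1.congr fun τ _ => ?_
    rw [mul_pow, zpow_neg, zpow_natCast]
    ring
  refine (h.zpow_mul ((n + 1 : ℕ) : ℤ)).congr fun τ _ => ?_
  rw [zpow_natCast]

theorem truncB_depthOne (n m : ℕ) (τ : ℂ) : truncB (depthOne (n + 1) (m + 1)) τ =
    fun ε => τ ^ (n + 1) * iterInt ((fun t : ℝ => omega (n + 1) (τ * t) τ) ::
      List.replicate m fun _ => 2 * π * I) ε (1 - ε) := by
  funext ε
  simp [truncB, depthOne, omega_zero]

theorem exists_norm_bFun_le (hτ : 0 < τ.im) (n : ℕ) :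
    ∃ C : ℝ, 0 ≤ C ∧ ∀ t ∈ Set.Ioo (0 : ℝ) 1, ‖bFun τ n t‖ ≤ C * (1 / t) := by
  obtain ⟨C, hC0, hC⟩ := exists_norm_bKernel_le hτ
  obtain ⟨D, hD⟩ := isCompact_Icc.exists_bound_of_continuousOn (continuousOn_bTail hτ n)
  have hD0 : 0 ≤ D := (norm_nonneg _).trans (hD 0 (by simp))
  refine ⟨C + D, add_nonneg hC0 hD0, fun t ht => ?_⟩
  have h1 : 1 ≤ 1 / t := by rw [le_div_iff₀ ht.1]; linarith [ht.2]
  rw [bFun, add_mul]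
  refine (norm_add_le _ _).trans (add_le_add ?_ ?_)
  · rw [norm_mul, norm_pow, Complex.norm_real, Real.norm_of_nonneg ht.1.le]
    exact (mul_le_of_le_one_right (norm_nonneg _) (pow_le_one₀ ht.1.le ht.2.le)).trans (hC t ht)
  · exact (hD t (Set.Ioo_subset_Icc_self ht)).trans (le_mul_of_one_le_right hD0 h1)

theorem isRegValue_truncB (hτ : 0 < τ.im) (n m : ℕ) {l : ℂ}
    (hl : HasSum (fun M => bdryZero (freq τ M)
      (Polynomial.X * (Polynomial.X ^ n * foldPoly n m).divX)) l) :
    IsRegValue (m + 1) (truncB (depthOne (n + 1) (m + 1)) τ)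
      (τ ^ (n + 1) * (2 * π * I) ^ (m + 1) / m.factorial *
        ((∫ t in (0 : ℝ)..1, beta (n + 1) t * (t : ℂ) ^ m) - 1 / n.factorial *
          ((Polynomial.X ^ n * foldPoly n m).coeff 0 * Complex.log τ / (2 * π * I * τ) - l +
            bSum n m τ))) := by
  have hβ := continuous_beta (n + 1)
  have hbeta : Continuous fun t : ℝ => beta (n + 1) (t : ℂ) := hβ.comp Complex.continuous_ofReal
  have hB := continuousOn_bFun hτ n
  have hB' : ContinuousOn (fun t => bFun τ n (1 - t)) (Set.Ioo 0 1) :=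
    hB.comp (by fun_prop) fun t ht => one_sub_mem_Ioo ht
  obtain ⟨h, hh⟩ : ∃ h : ℝ → ℂ, h = fun t : ℝ => 2 * π * I *
      (beta (n + 1) t - (bFun τ n t - (-1) ^ n * bFun τ n (1 - t)) / n.factorial) := ⟨_, rfl⟩
  have hc : ContinuousOn h (Set.Ioo 0 1) := by
    rw [hh]
    exact continuousOn_const.mul (hbeta.continuousOn.sub
      ((hB.sub (continuousOn_const.mul hB')).div_const _))
  obtain ⟨C, hC0, hC⟩ := exists_norm_bFun_le hτ n
  obtain ⟨D, hD⟩ := isCompact_Icc.exists_bound_of_continuousOn (s := Set.Icc (0 : ℝ) 1)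
    hbeta.continuousOn
  have hD0 : 0 ≤ D := (norm_nonneg _).trans (hD 0 (by simp))
  have hbound : ∀ t ∈ Set.Ioo (0 : ℝ) 1, ‖h t‖ ≤
      (‖(2 * π * I : ℂ)‖ * (D + C / ‖(n.factorial : ℂ)‖)) * (1 / t + 1 / (1 - t)) := by
    intro t ht
    rw [hh]
    simp only
    rw [norm_mul, mul_assoc ‖(2 * π * I : ℂ)‖]
    refine mul_le_mul_of_nonneg_left ?_ (norm_nonneg (2 * π * I : ℂ))
    refine (norm_sub_le _ _).trans ?_
    rw [add_mul]
    refine add_le_add ?_ ?_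
    · exact (hD t (Set.Ioo_subset_Icc_self ht)).trans
        (le_mul_of_one_le_right hD0 (one_le_inv_add_inv ht))
    · rw [norm_div, div_mul_eq_mul_div]
      refine div_le_div_of_nonneg_right ((norm_sub_le _ _).trans ?_) (norm_nonneg _)
      rw [norm_mul, norm_pow, norm_neg, norm_one, one_pow, one_mul, mul_add]
      exact add_le_add (hC t ht) (hC _ (one_sub_mem_Ioo ht))
  -- The weights are chosen so that `a(t) + b(1-t)` is `foldPoly`.
  have hfold := HasReg.fold hB (a := fun t : ℝ => (t : ℂ) ^ m)
    (b := fun t : ℝ => -(-1) ^ n * (t : ℂ) ^ m) (by fun_prop) (by fun_prop)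
    ((hasReg_bFun_mul hτ n (foldPoly n m) hl).congr fun t _ => by
      simp only [foldPoly, Polynomial.eval_sub, Polynomial.eval_mul, Polynomial.eval_pow,
        Polynomial.eval_X, Polynomial.eval_C, Polynomial.eval_one]
      push_cast
      ring)
  rw [qser_foldPoly n m hτ] at hfold
  have hfirst := hasReg_of_continuousOn (g := fun t : ℝ => beta (n + 1) t * (t : ℂ) ^ m)
    (by fun_prop)
  obtain ⟨_, c₀, c₁, H, hv⟩ := ((hfirst.const_mul (2 * π * I)).add
    (hfold.const_mul (-(2 * π * I / n.factorial)))).congr (g := fun t => h t * (t : ℂ) ^ m)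
    fun t _ => by
      simp only [hh]
      ring
  have hreg := isRegValue_iterInt (f := fun t : ℝ => omega (n + 1) (τ * t) τ)
    (fun t ht => by rw [hh]; exact omega_mul_eq hτ n ht) hc hbound H (c := 2 * π * I) (τ ^ (n + 1))
  rw [← hv, ← truncB_depthOne] at hreg
  convert hreg using 1
  ring

theorem coeff_zero_foldPoly {n : ℕ} (hn : n ≠ 0) (m : ℕ) :
    (Polynomial.X ^ n * foldPoly n m).coeff 0 = 0 := by
  rw [Polynomial.mul_coeff_zero, Polynomial.coeff_X_pow, if_neg hn.symm, zero_mul]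

/-- The logarithm is multiplied by the constant coefficient of `X^n · foldPoly`, which vanishes
unless `n = 0`. In that case the prefactor `τ^(n+1) = τ` cancels the `1/τ` beside `log τ`, so the
logarithmic coefficient is constant. -/
theorem exists_B_eq (n m : ℕ) : ∃ (p : ℤ →₀ ℂ) (c : ℂ), (n ≠ 0 → c = 0) ∧
    ∀ τ : ℂ, 0 < τ.im → (∃ b, IsRegValue (m + 1) (truncB (depthOne (n + 1) (m + 1)) τ) b) ∧
      B (n + 1) (m + 1) τ = laurentLog p c τ + bExp n m τ := by
  obtain ⟨L, ⟨q, hq⟩, hL⟩ := exists_hasSum_bdryZero (Polynomial.X ^ n * foldPoly n m).divX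
  obtain ⟨x, hx⟩ : ∃ x : ℂ, x = (2 * π * I) ^ (m + 1) / m.factorial := ⟨_, rfl⟩
  obtain ⟨β, hβ⟩ : ∃ β : ℂ, β = ∫ t in (0 : ℝ)..1, beta (n + 1) t * (t : ℂ) ^ m := ⟨_, rfl⟩
  obtain ⟨a, ha⟩ : ∃ a : ℂ, a = (Polynomial.X ^ n * foldPoly n m).coeff 0 := ⟨_, rfl⟩
  have ha0 : n ≠ 0 → a = 0 := fun hn => by rw [ha, coeff_zero_foldPoly hn]
  obtain ⟨p, hp⟩ := (isLaurent_zpow ((n + 1 : ℕ) : ℤ) (x * β)).add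
    (IsLaurent.mul_zpow ⟨q, hq⟩ ((n + 1 : ℕ) : ℤ) (x / n.factorial))
  refine ⟨p, -(x / n.factorial * a / (2 * π * I)), fun hn => by rw [ha0 hn]; simp, fun τ hτ => ?_⟩
  have h := isRegValue_truncB hτ n m (hL τ hτ)
  refine ⟨⟨_, h⟩, ?_⟩
  have h1 := hp τ hτ
  have h2 : laurentLog p (-(x / n.factorial * a / (2 * π * I))) τ = laurentLog p 0 τ -
      x / n.factorial * a / (2 * π * I) * Complex.log τ := by
    rw [laurentLog, laurentLog]; ring
  have h3 : a * (τ ^ (n + 1) / τ) = a := by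
    by_cases hn : n = 0
    · rw [hn, zero_add, pow_one, div_self (ne_zero_of_im_pos hτ), mul_one]
    · rw [ha0 hn, zero_mul]
  rw [B, ellB, show (depthOne (n + 1) (m + 1)).length = m + 1 by simp [depthOne],
    h.regValue_eq, h2, ← h1, bExp, ← hβ, ← ha]
  simp only [zpow_natCast]
  rw [hx]
  have h4 : a * Complex.log τ / (2 * π * I * τ) * τ ^ (n + 1) = a * Complex.log τ / (2 * π * I) := by
    calc a * Complex.log τ / (2 * π * I * τ) * τ ^ (n + 1)
        = a * (τ ^ (n + 1) / τ) * Complex.log τ / (2 * π * I) := by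
          rw [← div_div]; ring
      _ = _ := by rw [h3]
  linear_combination (-((2 * π * I) ^ (m + 1) / m.factorial / n.factorial)) * h4

theorem expPart_B (n m : ℕ) (hτ : 0 < τ.im) : expPart (B (n + 1) (m + 1)) τ = bExp n m τ := by
  obtain ⟨p, c, _, h⟩ := exists_B_eq n m
  exact expPart_eq_of_eq (fun τ hτ => (h τ hτ).2) (isExpSmall_bExp n m) hτ

/-! ### Combinatorial identities -/

theorem iterate_fwdDiff_choose (s k n : ℕ) :
    (fwdDiff 1)^[s] (fun x : ℕ => (x.choose k : ℤ)) n =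
      if s ≤ k then (n.choose (k - s) : ℤ) else 0 := by
  split_ifs with h
  · obtain ⟨j, rfl⟩ := Nat.exists_eq_add_of_le h
    rw [fwdDiff_iter_choose, Nat.add_sub_cancel_left]
  · obtain ⟨j, rfl⟩ := Nat.exists_eq_add_of_lt (not_le.mp h)
    have h0 := fwdDiff_iter_choose 0 k
    rw [add_zero] at h0
    have h1 : (fwdDiff 1)^[k + 1] (fun x : ℕ => (x.choose k : ℤ)) = fun _ => 0 := by
      rw [Function.iterate_succ_apply', h0]
      funext x
      simp [fwdDiff]
    have h2 : ∀ j : ℕ, (fwdDiff (1 : ℕ))^[j] (fun _ : ℕ => (0 : ℤ)) = fun _ => 0 := by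
      intro j
      induction j with
      | zero => rfl
      | succ j ih => rw [Function.iterate_succ_apply', ih]; funext x; simp [fwdDiff]
    rw [show k + j + 1 = j + (k + 1) by ring, Function.iterate_add_apply, h1, h2]

/-- The left side is the `s`-th finite difference of `x ↦ C(x,k)` at `n`, and each difference lowers
`k` by one. -/
theorem sum_neg_one_pow_choose_mul_choose (n s k : ℕ) :
    ∑ i ∈ Finset.range (s + 1), (-1 : ℂ) ^ (s - i) * (s.choose i : ℂ) * ((n + i).choose k : ℂ) =
      if s ≤ k then (n.choose (k - s) : ℂ) else 0 := by
  have h := iterate_fwdDiff_choose s k n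
  rw [fwdDiff_iter_eq_sum_shift] at h
  have h2 := congrArg (Int.cast : ℤ → ℂ) h
  push_cast at h2
  simp only [smul_eq_mul, mul_one] at h2
  push_cast at h2
  exact h2

/-- As `(n+i)!/(n+1+i-k)! = (k-1)! C(n+i, k-1)`, the alternating sum over `i` is a finite difference
and leaves `C(n, k-1-s)`. This is non-zero only for `k = s + a + 1` with `0 ≤ a ≤ n`. -/
theorem sum_binomial_inversion (n s : ℕ) (f : ℕ → ℂ) :
    ∑ i ∈ Finset.range (s + 1), ((-1) ^ (s - i) * (n + i).factorial /
        (i.factorial * (s - i).factorial) : ℂ) *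
      ∑ k ∈ Finset.Icc 1 (n + 1 + i), f k / ((n + 1 + i - k).factorial : ℂ) =
    n.factorial * ∑ a ∈ Finset.range (n + 1),
      ((s + a).choose s : ℂ) / ((n - a).factorial : ℂ) * f (s + a + 1) := by
  have hfac : ∀ j : ℕ, (j.factorial : ℂ) ≠ 0 := fun j => by exact_mod_cast j.factorial_ne_zero
  have hin : ∀ i ∈ Finset.range (s + 1), ((n + i).factorial : ℂ) *
      ∑ k ∈ Finset.Icc 1 (n + 1 + i), f k / ((n + 1 + i - k).factorial : ℂ) =
      ∑ k ∈ Finset.range (s + (n + 1)), (k.factorial : ℂ) * ((n + i).choose k : ℂ) * f (k + 1) := by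
    intro i hi
    rw [Finset.mem_range] at hi
    -- The range of `k` is enlarged to one independent of `i`, at no cost because the new binomials
    -- vanish; the two sums can then be exchanged.
    rw [Finset.range_eq_Ico, ← Finset.sum_Ico_consecutive _ (Nat.zero_le (n + i + 1))
      (by omega : n + i + 1 ≤ s + (n + 1)), Finset.sum_eq_zero (s := Finset.Ico (n + i + 1) _)
      (fun k hk => by
        rw [Finset.mem_Ico] at hk
        rw [Nat.choose_eq_zero_of_lt (by omega)]; simp), add_zero, ← Finset.range_eq_Ico,
      Finset.mul_sum, ← Finset.Ico_add_one_right_eq_Icc, Finset.sum_Ico_eq_sum_range]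
    rw [show n + 1 + i + 1 - 1 = n + i + 1 by omega]
    refine Finset.sum_congr rfl fun k hk => ?_
    rw [Finset.mem_range] at hk
    rw [← Nat.choose_mul_factorial_mul_factorial (show k ≤ n + i by omega),
      show n + 1 + i - (1 + k) = n + i - k by omega, add_comm 1 k]
    have := hfac (n + i - k)
    push_cast
    field_simp
  have hterm : ∀ i ∈ Finset.range (s + 1), ((-1) ^ (s - i) * (n + i).factorial /
        (i.factorial * (s - i).factorial) : ℂ) *
      ∑ k ∈ Finset.Icc 1 (n + 1 + i), f k / ((n + 1 + i - k).factorial : ℂ) =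
      ∑ k ∈ Finset.range (s + (n + 1)), (k.factorial : ℂ) / s.factorial * f (k + 1) *
        ((-1 : ℂ) ^ (s - i) * (s.choose i : ℂ) * ((n + i).choose k : ℂ)) := by
    intro i hi
    have h1 : ((-1) ^ (s - i) * (n + i).factorial / (i.factorial * (s - i).factorial) : ℂ) =
        (-1) ^ (s - i) * (s.choose i : ℂ) / s.factorial * (n + i).factorial := by
      rw [Finset.mem_range] at hi
      have h2 := Nat.choose_mul_factorial_mul_factorial (show i ≤ s by omega)
      have h3 : (s.choose i : ℂ) * i.factorial * (s - i).factorial = s.factorial := by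
        exact_mod_cast h2
      have := hfac i
      have := hfac s
      have := hfac (s - i)
      field_simp
      linear_combination (-((n + i).factorial : ℂ)) * h3
    rw [h1, mul_assoc, hin i hi, Finset.mul_sum]
    refine Finset.sum_congr rfl fun k _ => by ring
  rw [Finset.sum_congr rfl hterm, Finset.sum_comm]
  simp only [← Finset.mul_sum, sum_neg_one_pow_choose_mul_choose]
  rw [Finset.sum_range_add, Finset.sum_eq_zero (s := Finset.range s) (fun k hk => by
    rw [Finset.mem_range] at hk
    rw [if_neg (by omega), mul_zero]), zero_add, Finset.mul_sum]
  refine Finset.sum_congr rfl fun a ha => ?_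
  rw [Finset.mem_range] at ha
  rw [if_pos (by omega), Nat.add_sub_cancel_left]
  have h2 : (n.choose a : ℂ) * a.factorial * (n - a).factorial = n.factorial := by
    exact_mod_cast Nat.choose_mul_factorial_mul_factorial (show a ≤ n by omega)
  have h3 : ((s + a).choose s : ℂ) * s.factorial * a.factorial = (s + a).factorial := by
    have := Nat.choose_mul_factorial_mul_factorial (show s ≤ s + a by omega)
    rw [Nat.add_sub_cancel_left] at this
    exact_mod_cast this
  have := hfac (n - a)
  have := hfac s
  rw [← h2, ← h3]
  field_simp

/-- Inversion of the convolution with the coefficients of `(e^x - 1)/x`. -/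
theorem sum_bernoulli_inversion (g : ℕ → ℂ) (k : ℕ) (hk : 1 ≤ k) :
    ∑ l ∈ Finset.Icc 2 (k + 1), ((bernoulli (k + 1 - l) : ℚ) : ℂ) / ((k + 1 - l).factorial : ℂ) *
      ∑ s ∈ Finset.range (l - 1), g s / ((l - 1 - s).factorial : ℂ) = g (k - 1) := by
  obtain ⟨k, rfl⟩ : ∃ j, k = j + 1 := ⟨k - 1, by omega⟩
  have hcoef : ∀ l : ℕ, PowerSeries.coeff l ((PowerSeries.exp ℂ - 1) * PowerSeries.mk g) =
      ∑ s ∈ Finset.range l, g s / ((l - s).factorial : ℂ) := by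
    intro l
    rw [mul_comm, PowerSeries.coeff_mul, Finset.Nat.sum_antidiagonal_eq_sum_range_succ_mk,
      Finset.sum_range_succ]
    simp only [PowerSeries.coeff_mk, map_sub, PowerSeries.coeff_exp, Nat.sub_self]
    simp only [Nat.factorial_zero, PowerSeries.coeff_one]
    simp only [if_true]
    rw [show (algebraMap ℚ ℂ) (1 / ((1 : ℕ) : ℚ)) - 1 = 0 by simp, mul_zero, add_zero]
    refine Finset.sum_congr rfl fun s hs => ?_
    rw [Finset.mem_range] at hs
    rw [if_neg (by omega)]
    simp
    ring
  -- The inner sums are the coefficients of `(e^x - 1) ∑ g_s x^s`; the Bernoulli series `x/(e^x -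
  -- 1)` turns this into `x ∑ g_s x^s`.
  have h : PowerSeries.coeff (k + 1) ((PowerSeries.exp ℂ - 1) * PowerSeries.mk g *
      bernoulliPowerSeries ℂ) = g k := by
    rw [mul_comm, ← mul_assoc, bernoulliPowerSeries_mul_exp_sub_one,
      PowerSeries.coeff_succ_X_mul, PowerSeries.coeff_mk]
  rw [PowerSeries.coeff_mul, Finset.Nat.sum_antidiagonal_eq_sum_range_succ_mk,
    Finset.sum_range_succ'] at h
  simp only [hcoef, Finset.range_zero, Finset.sum_empty, zero_mul, add_zero,
    bernoulliPowerSeries, PowerSeries.coeff_mk] at h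
  rw [Nat.add_sub_cancel, ← h, ← Finset.Ico_add_one_right_eq_Icc, Finset.sum_Ico_eq_sum_range,
    show k + 1 + 1 + 1 - 2 = k + 1 by omega]
  refine Finset.sum_congr rfl fun i _ => ?_
  rw [show k + 1 + 1 - (2 + i) = k + 1 - (i + 1) by omega, show 2 + i - 1 = i + 1 by omega, mul_comm]
  congr 1
  simp

/-! ### The formulas for the exponentially small parts -/

/-- Term by term: weight `n+s+2` and length `s+a+1` in `expPart_GamL` give precisely the series
`S_{n-a, s+a+1}` with parity factor `1 + (-1)^(n+s)`, and the rest is factorials. -/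
theorem bExp_eq (n m : ℕ) (hτ : 0 < τ.im) : bExp n m τ =
    (2 * π * I) ^ m * ∑ s ∈ Finset.range m, ((n + s + 1).factorial / (m - s).factorial : ℂ) *
      ∑ a ∈ Finset.range (n + 1), ((s + a).choose s : ℂ) / ((n - a).factorial : ℂ) *
        ((-1) ^ (s + a) * τ ^ (((n + 1 : ℕ) : ℤ) - (s + a + 1 : ℕ)) / (2 * π * I) ^ (s + a) *
          expPart (GamL (n + s + 2) (s + a + 1)) τ) := by
  have hfac : ∀ j : ℕ, (j.factorial : ℂ) ≠ 0 := fun j => by exact_mod_cast j.factorial_ne_zero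
  have hτ0 := ne_zero_of_im_pos hτ
  have hpi := two_pi_I_ne_zero'
  rw [bExp, bSum, Finset.mul_sum, Finset.mul_sum, Finset.mul_sum]
  refine Finset.sum_congr rfl fun s hs => ?_
  simp only [Finset.mul_sum]
  refine Finset.sum_congr rfl fun a ha => ?_
  rw [Finset.mem_range] at hs ha
  rw [expPart_GamL (by omega) (by omega) hτ, show n + s + 2 - 1 = n + s + 1 by omega,
    show n + s + 1 - (s + a + 1) = n - a by omega, zpow_sub₀ hτ0, zpow_natCast, zpow_natCast,
    mul_pow _ τ, show ((-1 : ℂ)) ^ (n + s + 2) = (-1) ^ (n + s) by rw [pow_add _ _ 2]; simp]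
  have h1 : (m.choose s : ℂ) * s.factorial * (m - s).factorial = m.factorial := by
    exact_mod_cast Nat.choose_mul_factorial_mul_factorial (show s ≤ m by omega)
  have h2 : (n.choose a : ℂ) * a.factorial * (n - a).factorial = n.factorial := by
    exact_mod_cast Nat.choose_mul_factorial_mul_factorial (show a ≤ n by omega)
  have h3 : ((s + a).choose s : ℂ) * s.factorial * a.factorial = (s + a).factorial := by
    have := Nat.choose_mul_factorial_mul_factorial (show s ≤ s + a by omega)
    rw [Nat.add_sub_cancel_left] at this
    exact_mod_cast this
  have hc1 : (m.choose s : ℂ) = m.factorial / (s.factorial * (m - s).factorial) := by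
    rw [eq_div_iff (mul_ne_zero (hfac _) (hfac _)), ← h1]; ring
  have hc2 : (n.choose a : ℂ) = n.factorial / (a.factorial * (n - a).factorial) := by
    rw [eq_div_iff (mul_ne_zero (hfac _) (hfac _)), ← h2]; ring
  rw [hc1, hc2, ← h3, pow_succ _ m, pow_succ _ (s + a)]
  have := hfac s
  have := hfac a
  have := hfac m
  have := hfac n
  have := hfac (m - s)
  have := hfac (n - a)
  have := hfac (n + s + 1)
  generalize (2 * π * I : ℂ) = w at *
  field_simp

theorem bExp_eq_sum_GamL (n m : ℕ) (hτ : 0 < τ.im) : bExp n m τ =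
    (2 * π * I) ^ m / (n.factorial : ℂ) *
      ∑ j ∈ Finset.Icc 1 m, ((n + j).factorial / (m + 1 - j).factorial : ℂ) *
        ∑ i ∈ Finset.range j, ((-1) ^ (j - i - 1) * (n + i).factorial /
            (i.factorial * (j - i - 1).factorial) : ℂ) *
          ∑ k ∈ Finset.Icc 1 (n + 1 + i), (-1) ^ (k - 1) * τ ^ (((n + 1 : ℕ) : ℤ) - k) /
            ((2 * π * I) ^ (k - 1) * ((n + 1 + i - k).factorial : ℂ)) *
              expPart (GamL (n + 1 + j) k) τ := by
  have hn : (n.factorial : ℂ) ≠ 0 := by exact_mod_cast n.factorial_ne_zero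
  rw [bExp_eq n m hτ, div_mul_eq_mul_div, eq_div_iff hn, mul_assoc]
  congr 1
  rw [Finset.sum_mul, ← Finset.Ico_add_one_right_eq_Icc, Finset.sum_Ico_eq_sum_range,
    Nat.add_sub_cancel]
  refine Finset.sum_congr rfl fun s hs => ?_
  rw [Finset.mem_range] at hs
  have h := sum_binomial_inversion n s fun k => (-1) ^ (k - 1) *
    τ ^ (((n + 1 : ℕ) : ℤ) - k) / (2 * π * I) ^ (k - 1) * expPart (GamL (n + s + 2) k) τ
  simp only [Nat.add_sub_cancel] at h
  rw [mul_assoc, mul_comm (∑ a ∈ Finset.range (n + 1), _), ← h, show n + (1 + s) = n + s + 1 by ring,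
    show m + 1 - (1 + s) = m - s by omega, add_comm 1 s]
  congr 1
  refine Finset.sum_congr rfl fun i hi => ?_
  rw [show s + 1 - i - 1 = s - i by omega]
  congr 1
  refine Finset.sum_congr rfl fun k _ => ?_
  rw [show n + 1 + (s + 1) = n + s + 2 by ring, ← div_div]
  ring

/-- After normalization `A⁰_{p+1,l}` is a sum of `g_s/(l-1-s)!` over `s < l-1`, a convolution with
the coefficients of `e^x - 1`. Bernoulli inversion isolates `g_{k-1}`, a multiple of `S_{p,k}` and
so of `Γ^{L,0}_{p+k+1,k}`. -/
theorem sum_bernoulli_aExp (p k : ℕ) (hk : 1 ≤ k) (hτ : 0 < τ.im) :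
    ∑ l ∈ Finset.Icc 2 (k + 1), ((bernoulli (k + 1 - l) : ℚ) : ℂ) /
        (((k + 1 - l).factorial : ℂ) * (2 * π * I) ^ (l - 1)) * expPart (A (p + 1) l) τ =
      ((p + k).factorial / p.factorial : ℂ) * ((-1) ^ p / (2 * π * I) ^ (k - 1)) *
        expPart (GamL (p + k + 1) k) τ := by
  have hfac : ∀ j : ℕ, (j.factorial : ℂ) ≠ 0 := fun j => by exact_mod_cast j.factorial_ne_zero
  have hpi := two_pi_I_ne_zero'
  obtain ⟨g, hg⟩ : ∃ g : ℕ → ℂ, g = fun s => (-1) ^ s / (2 * π * I) ^ (s + 1) *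
    (1 + (-1) ^ (p + s)) * sSer p (s + 1) τ := ⟨_, rfl⟩
  have hA : ∀ l ∈ Finset.Icc 2 (k + 1), ((bernoulli (k + 1 - l) : ℚ) : ℂ) /
        (((k + 1 - l).factorial : ℂ) * (2 * π * I) ^ (l - 1)) * expPart (A (p + 1) l) τ =
      -(2 * π * I / p.factorial) * (((bernoulli (k + 1 - l) : ℚ) : ℂ) /
        ((k + 1 - l).factorial : ℂ) *
        ∑ s ∈ Finset.range (l - 1), g s / ((l - 1 - s).factorial : ℂ)) := by
    intro l hl
    rw [Finset.mem_Icc] at hl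
    obtain ⟨l, rfl⟩ : ∃ j, l = j + 1 := ⟨l - 1, by omega⟩
    rw [expPart_A p l hτ, aExp, aSum, Nat.add_sub_cancel]
    have hsum : ∑ s ∈ Finset.range l, (l.descFactorial s : ℂ) * (-1) ^ s /
        (2 * π * I) ^ (s + 1) * (1 + (-1) ^ (p + s)) * sSer p (s + 1) τ =
        l.factorial * ∑ s ∈ Finset.range l, g s / ((l - s).factorial : ℂ) := by
      rw [Finset.mul_sum]
      refine Finset.sum_congr rfl fun s hs => ?_
      rw [Finset.mem_range] at hs
      have h1 : ((l - s).factorial : ℂ) * l.descFactorial s = l.factorial := by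
        exact_mod_cast Nat.factorial_mul_descFactorial hs.le
      rw [← h1, hg]
      have := hfac (l - s)
      field_simp
    rw [hsum, pow_succ]
    have := hfac l
    have := hfac p
    have := hfac (k + 1 - (l + 1))
    field_simp
  rw [Finset.sum_congr rfl hA, ← Finset.mul_sum, sum_bernoulli_inversion g k hk, hg]
  obtain ⟨k, rfl⟩ : ∃ j, k = j + 1 := ⟨k - 1, by omega⟩
  rw [expPart_GamL (by omega) (by omega) hτ]
  simp only [Nat.add_sub_cancel]
  rw [pow_succ _ k]
  have h1 := hfac p
  have h2 := hfac (p + (k + 1))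
  have h3 : ((-1 : ℂ)) ^ p * (-1) ^ p = 1 := by rw [← mul_pow]; simp
  have h4 : ((-1 : ℂ)) ^ k * (-1) ^ k = 1 := by rw [← mul_pow]; simp
  have h5 : ((-1 : ℂ)) ^ k * (1 + (-1) ^ (p + k)) = (-1) ^ p * (1 + (-1) ^ (p + (k + 1) + 1)) := by
    rw [pow_add _ p k, pow_add _ (p + (k + 1)) 1, pow_add _ p (k + 1), pow_add _ k 1]
    linear_combination (-1) ^ p * h4 - (-1) ^ k * h3
  generalize (2 * π * I : ℂ) = w at *
  have e : ((-1 : ℂ)) ^ k / (w ^ k * w) * (1 + (-1) ^ (p + k)) =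
      (-1) ^ p * (1 + (-1) ^ (p + (k + 1) + 1)) / (w ^ k * w) := by
    rw [← h5]; ring
  rw [e]
  field_simp

theorem bExp_eq_sum_A (n m : ℕ) (hτ : 0 < τ.im) : bExp n m τ =
    (-1) ^ n * (2 * π * I) ^ m / (n.factorial : ℂ) *
      ∑ j ∈ Finset.Icc 1 m, (1 / (m + 1 - j).factorial : ℂ) *
        ∑ i ∈ Finset.range j, ((-1) ^ i * (n + i).factorial /
            (i.factorial * (j - i - 1).factorial) : ℂ) *
          ∑ k ∈ Finset.Icc 1 (n + 1 + i), ((n + 1 + j - k - 1).factorial : ℂ) *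
              τ ^ (((n + 1 : ℕ) : ℤ) - k) / ((n + 1 + i - k).factorial : ℂ) *
            ∑ l ∈ Finset.Icc 2 (k + 1), ((bernoulli (k + 1 - l) : ℚ) : ℂ) /
              (((k + 1 - l).factorial : ℂ) * (2 * π * I) ^ (l - 1)) *
                expPart (A (n + 1 + j - k) l) τ := by
  have hfac : ∀ j : ℕ, (j.factorial : ℂ) ≠ 0 := fun j => by exact_mod_cast j.factorial_ne_zero
  rw [bExp_eq_sum_GamL n m hτ, mul_comm ((-1 : ℂ) ^ n), mul_div_right_comm,
    mul_assoc (_ / _)]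
  congr 1
  simp only [Finset.mul_sum]
  refine Finset.sum_congr rfl fun j hj => Finset.sum_congr rfl fun i hi =>
    Finset.sum_congr rfl fun k hk => ?_
  rw [Finset.mem_Icc] at hj hk
  rw [Finset.mem_range] at hi
  -- Here `k ≤ n + 1 + i ≤ n + j` because `i < j`, so the subtraction is not truncated.
  obtain ⟨p, hp⟩ : ∃ p, n + j = p + k := ⟨n + j - k, by omega⟩
  have h := sum_bernoulli_aExp p k hk.1 hτ
  rw [show n + 1 + j - k = p + 1 by omega, Nat.add_sub_cancel, show n + 1 + j = p + k + 1 by omega,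
    hp]
  simp only [← Finset.mul_sum]
  rw [h]
  -- The signs of the two formulas agree only when the weight `p + k + 1` is even; for odd weight
  -- `Γ^{L,0}` vanishes.
  have h0 : (((-1 : ℂ)) ^ (j - i - 1) * (-1) ^ (k - 1)) * expPart (GamL (p + k + 1) k) τ =
      (-1) ^ n * (-1) ^ i * (-1) ^ p * expPart (GamL (p + k + 1) k) τ := by
    rw [← pow_add, ← pow_add, ← pow_add]
    rcases Nat.even_or_odd (p + k + 1) with hpar | hpar
    · congr 1
      refine neg_one_pow_congr ?_
      simp only [Nat.even_iff] at hpar ⊢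
      omega
    · rw [expPart_GamL hk.1 (by omega) hτ, hpar.neg_one_pow]
      simp
  have := hfac p
  rw [← div_div]
  field_simp
  linear_combination ((p + k).factorial : ℂ) * ((n + i).factorial : ℂ) *
    τ ^ (((n + 1 : ℕ) : ℤ) - k) / ((m + 1 - j).factorial * i.factorial * (j - i - 1).factorial *
      (n + 1 + i - k).factorial) * h0

/-! ### The identity of generating series -/

theorem eq_single_add_single (d : Fin 2 →₀ ℕ) :
    Finsupp.single 0 (d 0) + Finsupp.single 1 (d 1) = d := by
  ext i
  fin_cases i <;> simp

/-- The product is homogeneous of degree `x + y`, and the exponent of `Y` fixes a single term in the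
binomial expansion of the second factor. -/
theorem coeff_substB_pow (τ : ℂ) (x y : ℕ) (d : Fin 2 →₀ ℕ) :
    MvPowerSeries.coeff d (substB τ 0 ^ x * substB τ 1 ^ y) =
      if x + y = d 0 + d 1 then (-τ) ^ x * (-1) ^ y * (y.choose (d 1) : ℂ) * τ⁻¹ ^ d 1 else 0 := by
  have h0 : substB τ 0 = MvPowerSeries.monomial (Finsupp.single 0 1) (-τ) := by
    ext e
    simp [substB, MvPowerSeries.coeff_X, MvPowerSeries.coeff_monomial]
  have h1 : substB τ 1 = MvPowerSeries.monomial (Finsupp.single 1 1) (-τ⁻¹) +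
      MvPowerSeries.monomial (Finsupp.single 0 1) (-1) := by
    ext e
    simp [substB, MvPowerSeries.coeff_X, MvPowerSeries.coeff_monomial]
    split_ifs <;> ring
  rw [h0, h1, add_pow, Finset.mul_sum, map_sum]
  have hterm : ∀ i ∈ Finset.range (y + 1), MvPowerSeries.coeff d
      (MvPowerSeries.monomial (Finsupp.single (0 : Fin 2) 1) (-τ) ^ x *
        (MvPowerSeries.monomial (Finsupp.single 1 1) (-τ⁻¹) ^ i *
          MvPowerSeries.monomial (Finsupp.single 0 1) (-1) ^ (y - i) *
            (y.choose i : MvPowerSeries (Fin 2) ℂ))) =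
      if i = d 1 then (if x + y = d 0 + d 1 then
        (-τ) ^ x * (-1) ^ y * (y.choose (d 1) : ℂ) * τ⁻¹ ^ d 1 else 0) else 0 := by
    intro i hi
    rw [Finset.mem_range] at hi
    have hc : (y.choose i : MvPowerSeries (Fin 2) ℂ) =
        MvPowerSeries.monomial 0 (y.choose i : ℂ) := by
      rw [MvPowerSeries.monomial_zero_eq_C_apply, map_natCast]
    rw [hc]
    simp only [MvPowerSeries.monomial_pow, MvPowerSeries.monomial_mul_monomial,
      MvPowerSeries.coeff_monomial]
    have hd : d = x • Finsupp.single (0 : Fin 2) 1 + (i • Finsupp.single 1 1 +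
        (y - i) • Finsupp.single 0 1 + 0) ↔ i = d 1 ∧ x + y = d 0 + d 1 := by
      rw [DFunLike.ext_iff, Fin.forall_fin_two]
      simp
      omega
    simp only [hd]
    by_cases h1 : i = d 1
    · subst h1
      simp only [true_and, if_true]
      split_ifs
      · have : ((-1 : ℂ)) ^ y = (-1) ^ (d 1) * (-1) ^ (y - d 1) := by
          rw [← pow_add]; congr 1; omega
        rw [this, neg_pow τ⁻¹]
        ring
      · rfl
    · simp [h1]
  rw [Finset.sum_congr rfl hterm, Finset.sum_ite_eq']
  by_cases h : d 1 < y + 1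
  · rw [if_pos (Finset.mem_range.mpr h)]
  · rw [if_neg (by simpa using h), Nat.choose_eq_zero_of_lt (by omega)]
    simp

/-- By homogeneity and the vanishing of binomials, only the monomials `X^(p-a) Y^(s+a)` of the
series, `0 ≤ a ≤ p`, reach `X^p Y^s`, each with the factor `C(s+a, s)`. -/
theorem coeff_subst_serE (hτ : 0 < τ.im) (p s : ℕ) :
    MvPowerSeries.coeff (Finsupp.single (0 : Fin 2) p + Finsupp.single 1 s)
      (MvPowerSeries.subst (substB τ) (serE τ)) = ((p + s + 1).factorial : ℂ) *
      ∑ a ∈ Finset.range (p + 1), ((s + a).choose s : ℂ) / ((p - a).factorial : ℂ) *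
        ((-1) ^ (s + a) * τ ^ (((p + 1 : ℕ) : ℤ) - (s + a + 1 : ℕ)) / (2 * π * I) ^ (s + a) *
          expPart (GamL (p + s + 2) (s + a + 1)) τ) := by
  have hτ0 := ne_zero_of_im_pos hτ
  rw [MvPowerSeries.coeff_subst (hasSubst_substB τ)]
  have hprod : ∀ d : Fin 2 →₀ ℕ, (d.prod fun s e => substB τ s ^ e) =
      substB τ 0 ^ d 0 * substB τ 1 ^ d 1 := fun d => by
    rw [Finsupp.prod_fintype _ _ (by simp), Fin.prod_univ_two]
  simp only [hprod, coeff_substB_pow]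
  simp only [Finsupp.add_apply, Finsupp.single_apply]
  simp only [Fin.isValue, if_true, one_ne_zero, zero_ne_one, if_false, add_zero, zero_add]
  obtain ⟨φ, hφ⟩ : ∃ φ : ℕ → (Fin 2 →₀ ℕ), φ = fun a =>
    Finsupp.single 0 (p - a) + Finsupp.single 1 (s + a) := ⟨_, rfl⟩
  have hφ0 : ∀ a, φ a 0 = p - a := fun a => by simp [hφ]
  have hφ1 : ∀ a, φ a 1 = s + a := fun a => by simp [hφ]
  have hinj : Set.InjOn φ (Finset.range (p + 1)) := fun a _ b _ h => by
    have := congrArg (fun d => d 1) h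
    simp only [hφ1] at this
    omega
  rw [finsum_eq_sum_of_support_subset (s := (Finset.range (p + 1)).image φ)]
  · rw [Finset.sum_image hinj, Finset.mul_sum]
    refine Finset.sum_congr rfl fun a ha => ?_
    rw [Finset.mem_range] at ha
    rw [MvPowerSeries.coeff_apply, serE]
    simp only [hφ0, hφ1]
    rw [if_pos (by omega), show p - a + 1 + (s + a + 1) - 1 = p + s + 1 by omega,
      show p - a + 1 + (s + a + 1) = p + s + 2 by omega, Nat.add_sub_cancel, Nat.add_sub_cancel,
      show (((p + 1 : ℕ) : ℤ) - (s + a + 1 : ℕ)) = ((p - a : ℕ) : ℤ) - (s : ℕ) by omega,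
      zpow_sub₀ hτ0, zpow_natCast, zpow_natCast, neg_pow τ, smul_eq_mul]
    have h1 : ((-1 : ℂ)) ^ (p - a) * (-1) ^ (p - a) = 1 := by rw [← mul_pow]; simp
    rw [inv_pow]
    linear_combination (((p + s + 1).factorial : ℂ) * ((s + a).choose s : ℂ) /
      ((p - a).factorial : ℂ) * (-1) ^ (s + a) * τ ^ (p - a) * (τ ^ s)⁻¹ / (2 * π * I) ^ (s + a) *
        expPart (GamL (p + s + 2) (s + a + 1)) τ) * h1
  · intro d hd
    rw [Function.mem_support] at hd
    have h1 : d 0 + d 1 = p + s := by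
      by_contra h
      exact hd (by rw [if_neg h, smul_zero])
    have h2 : s ≤ d 1 := by
      by_contra h
      exact hd (by rw [Nat.choose_eq_zero_of_lt (by omega)]; simp)
    rw [Finset.mem_coe, Finset.mem_image]
    refine ⟨d 1 - s, Finset.mem_range.mpr (by omega), ?_⟩
    ext i
    fin_cases i
    · simp only [Fin.zero_eta, hφ0]; omega
    · simp only [Fin.mk_one, hφ1]; omega

theorem coeff_expY_sub_one (d : Fin 2 →₀ ℕ) : MvPowerSeries.coeff d (expY - 1) =
    if d 0 = 0 ∧ d 1 ≠ 0 then 1 / ((d 1).factorial : ℂ) else 0 := by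
  rw [map_sub, expY, PowerSeries.coeff_subst_single, MvPowerSeries.coeff_one, PowerSeries.coeff_exp]
  have h1 : d = Finsupp.single 1 (d 1) ↔ d 0 = 0 := by
    rw [DFunLike.ext_iff, Fin.forall_fin_two]; simp
  have h2 : d = 0 ↔ d 0 = 0 ∧ d 1 = 0 := by
    rw [DFunLike.ext_iff, Fin.forall_fin_two]; simp
  simp only [h1, h2]
  by_cases h0 : d 0 = 0 <;> by_cases h3 : d 1 = 0 <;> simp [h0, h3]

/-- The coefficients of `e^Y - 1` are `1/(q-s)!` at `Y^(q-s)` for `s < q`. Multiplying by those of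
the substituted series reproduces the double sum of `bExp_eq`. -/
theorem serB_eq (hτ : 0 < τ.im) :
    serB τ = (expY - 1) * MvPowerSeries.subst (substB τ) (serE τ) := by
  ext d
  obtain ⟨p, q, rfl⟩ : ∃ p q, d = Finsupp.single 0 p + Finsupp.single 1 q :=
    ⟨_, _, (eq_single_add_single d).symm⟩
  have hpi : ((2 * π * I : ℂ)) ^ q ≠ 0 := pow_ne_zero _ two_pi_I_ne_zero'
  rw [MvPowerSeries.coeff_mul, MvPowerSeries.coeff_apply, serB]
  simp only [Finsupp.add_apply, Finsupp.single_apply]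
  simp only [Fin.isValue, if_true, one_ne_zero, zero_ne_one, if_false, add_zero, zero_add]
  rw [expPart_B p q hτ, Nat.add_sub_cancel, bExp_eq p q hτ, mul_div_cancel_left₀ _ hpi]
  refine Finset.sum_of_injOn
    (fun s => (Finsupp.single 1 (q - s), Finsupp.single 0 p + Finsupp.single 1 s)) ?_ ?_ ?_ ?_
  · intro a _ b _ h
    have := congrArg (fun x : (Fin 2 →₀ ℕ) × (Fin 2 →₀ ℕ) => x.2 1) h
    simpa using this
  · intro s hs
    rw [Finset.mem_coe, Finset.mem_range] at hs
    rw [Finset.mem_coe, Finset.HasAntidiagonal.mem_antidiagonal]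
    simp only
    rw [add_left_comm, ← Finsupp.single_add, Nat.sub_add_cancel hs.le]
  · rintro ⟨e, f⟩ hef hne
    rw [Finset.HasAntidiagonal.mem_antidiagonal] at hef
    simp only at hef
    have h0 : e 0 + f 0 = p := by simpa using DFunLike.congr_fun hef 0
    have h1 : e 1 + f 1 = q := by simpa using DFunLike.congr_fun hef 1
    simp only
    rw [coeff_expY_sub_one, if_neg, zero_mul]
    rintro ⟨h2, h3⟩
    refine hne ⟨f 1, by rw [Finset.mem_coe, Finset.mem_range]; omega, ?_⟩
    refine Prod.ext ?_ ?_
    · ext i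
      fin_cases i
      · simp [h2]
      · simp; omega
    · ext i
      fin_cases i
      · simp; omega
      · simp
  · intro s hs
    rw [Finset.mem_range] at hs
    simp only
    rw [coeff_expY_sub_one, coeff_subst_serE hτ]
    rw [if_pos (by simp; omega)]
    simp
    ring

end EMZV

/-! ### Assembly of the theorem -/

open EMZV in
theorem mainTheorem8 :
    -- the objects are well defined: the regularized values exist, and the functions split
    -- into a Laurent polynomial (plus a logarithmic term if n = 1) and an exponentially small part
    (∀ n r : ℕ, 1 ≤ n → 1 ≤ r →
      (∀ τ : ℂ, 0 < τ.im →
        (∃ a, IsRegValue r (truncA (depthOne n r) τ) a) ∧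
        (∃ b, IsRegValue r (truncB (depthOne n r) τ) b)) ∧
      (∃ a : ℂ, IsSplitting (A n r) (Finsupp.single 0 a) 0) ∧
      (∃ (p : ℤ →₀ ℂ) (c : ℂ), (n ≠ 1 → c = 0) ∧ IsSplitting (B n r) p c) ∧
      (∃ p : ℤ →₀ ℂ, IsSplitting (GamL (n + r) r) p 0)) ∧
    ∀ τ : ℂ, 0 < τ.im →
      -- the identity of generating series
      serB τ = (expY - 1) * MvPowerSeries.subst (substB τ) (serE τ) ∧
      ∀ n r : ℕ, 1 ≤ n → 1 ≤ r →
        -- the formula in terms of iterated integrals of Eisenstein series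
        B n r τ = infPart (B n r) τ +
          (2 * π * I) ^ (r - 1) / ((n - 1).factorial : ℂ) *
            ∑ j ∈ Finset.Icc 1 (r - 1), ((n + j - 1).factorial / (r - j).factorial : ℂ) *
              ∑ i ∈ Finset.range j,
                ((-1) ^ (j - i - 1) * (n + i - 1).factorial /
                    (i.factorial * (j - i - 1).factorial) : ℂ) *
                  ∑ k ∈ Finset.Icc 1 (n + i),
                    (-1) ^ (k - 1) * τ ^ ((n : ℤ) - k) /
                        ((2 * π * I) ^ (k - 1) * ((n + i - k).factorial : ℂ)) *
                      expPart (GamL (n + j) k) τ ∧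
        -- the formula in terms of A-elliptic multiple zeta values
        B n r τ = infPart (B n r) τ +
          (-1) ^ (n - 1) * (2 * π * I) ^ (r - 1) / ((n - 1).factorial : ℂ) *
            ∑ j ∈ Finset.Icc 1 (r - 1), (1 / (r - j).factorial : ℂ) *
              ∑ i ∈ Finset.range j,
                ((-1) ^ i * (n + i - 1).factorial /
                    (i.factorial * (j - i - 1).factorial) : ℂ) *
                  ∑ k ∈ Finset.Icc 1 (n + i),
                    ((n + j - k - 1).factorial : ℂ) * τ ^ ((n : ℤ) - k) /
                        ((n + i - k).factorial : ℂ) *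
                      ∑ l ∈ Finset.Icc 2 (k + 1),
                        ((bernoulli (k + 1 - l) : ℚ) : ℂ) /
                            (((k + 1 - l).factorial : ℂ) * (2 * π * I) ^ (l - 1)) *
                          expPart (A (n + j - k) l) τ := by
  refine ⟨fun n r hn hr => ?_, fun τ hτ => ⟨serB_eq hτ, fun n r hn hr => ?_⟩⟩
  · obtain ⟨n, rfl⟩ : ∃ k, n = k + 1 := ⟨n - 1, by omega⟩
    obtain ⟨r, rfl⟩ : ∃ k, r = k + 1 := ⟨r - 1, by omega⟩
    obtain ⟨a, ha⟩ := exists_regValue_A n r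
    obtain ⟨p, c, hc, hB⟩ := exists_B_eq n r
    refine ⟨fun τ hτ => ⟨⟨_, ha τ hτ⟩, (hB τ hτ).1⟩, exists_isSplitting_A n r,
      ⟨p, c, fun hn1 => hc fun h => hn1 (by rw [h]), ?_⟩, exists_isSplitting_GamL (by omega) r⟩
    exact isSplitting_of_eq (fun τ hτ => (hB τ hτ).2) (isExpSmall_bExp n r)
  · obtain ⟨n, rfl⟩ : ∃ k, n = k + 1 := ⟨n - 1, by omega⟩
    obtain ⟨r, rfl⟩ : ∃ k, r = k + 1 := ⟨r - 1, by omega⟩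
    -- Both closed formulas are evaluations of the same exponentially small part, so each is one
    -- rewriting of `bExp`.
    have h : B (n + 1) (r + 1) τ = infPart (B (n + 1) (r + 1)) τ + bExp n r τ := by
      rw [← expPart_B n r hτ, expPart]; ring
    have e1 : ∀ j : ℕ, n + 1 + j - 1 = n + j := fun j => by omega
    simp only [Nat.add_sub_cancel, e1]
    constructor
    · conv_lhs => rw [h, bExp_eq_sum_GamL n r hτ]
    · conv_lhs => rw [h, bExp_eq_sum_A n r hτ]
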